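/- **Lemma 3.1.** Let $G=(V,E)$ be a finite connected graph (loops and parallel edges are allowed) embedded on a closed orientable surface of genus $\gamma\ge 0$. Let $G^*$ be its geometric dual: its vertices are the faces of the embedding (the connected components of the complement of $G$), and each edge $e$ of $G$ gives an edge $e^*$ of $G^*$ joining the faces on the two sides of $e$. Let $g^*$ be the length of a shortest cycle of $G^*$ (a loop is a cycle of length $1$, two parallel edges form a cycle of length $2$; $g^*=\infty$ if $G^*$ has no cycle), and put $\alpha = 4+\lfloor 2\log_2(\gamma+\tfrac32)\rfloor$. Then $G$ has a spanning tree $T\subseteq E$ that is $\frac{2\alpha}{g^*}$-thin, that is, $$|T\cap\delta(U)|\le \frac{2\alpha}{g^*}\,|\delta(U)|\qquad\text{for every } U\subseteq V,$$ where $\delta(U)$ is the set of edges with exactly one end in $U$ (and $2\alpha/\infty=0$). Furthermore, such a tree can be found in polynomial time: there are a single algorithm and a polynomial $q$ such that, for every such embedded graph, given by its vertices, edges, the cyclic order of the edge ends around each vertex, and the faces on the two sides of each edge, the algorithm outputs such a tree $T$ after at most $q(|V|+|E|)$ steps. -/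

import Mathlib

/-!
Finite multigraphs, their embeddings in closed orientable surfaces, geometric duals, thin sets of
edges, and a small programming language on binary trees with a cost semantics.
-/

/-- A multigraph (loops and parallel edges allowed) with vertex type `V` and edge type `E`.
Every edge `e` consists of two darts (half-edges) `(e, true)` and `(e, false)`; `tail` gives the
vertex at which a dart starts. -/
structure MultiGraph (V E : Type*) where
  tail : E × Bool → V

namespace MultiGraph

variable {V E : Type*}

/-- The other half of the same edge. -/
def rev (d : E × Bool) : E × Bool := (d.1, !d.2)

/-- The vertex at which the dart `d` ends. -/
def head (G : MultiGraph V E) (d : E × Bool) : V := G.tail (rev d)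

/-- A cycle of length `l ≥ 1`: a closed sequence of darts without repeated vertices or edges.
A loop is a cycle of length `1` and two parallel edges form a cycle of length `2`. -/
structure IsCycle (G : MultiGraph V E) (l : ℕ) (c : Fin l → E × Bool) : Prop where
  pos : 0 < l
  closed : ∀ i, G.head (c i) = G.tail (c (finRotate l i))
  vertex_injective : Function.Injective fun i => G.tail (c i)
  edge_injective : Function.Injective fun i => (c i).1

/-- The length of a shortest cycle (`⊤` if there is no cycle). -/
noncomputable def girth (G : MultiGraph V E) : ℕ∞ :=
  ⨅ (l : ℕ) (c : Fin l → E × Bool) (_ : G.IsCycle l c), (l : ℕ∞)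

/-- The spanning subgraph with edge set `S` is connected (in particular there is a vertex). -/
def ConnectedVia (G : MultiGraph V E) (S : Set E) : Prop :=
  Nonempty V ∧
    ∀ u v : V, Relation.ReflTransGen
      (fun x y => ∃ d : E × Bool, d.1 ∈ S ∧ G.tail d = x ∧ G.head d = y) u v

/-- The graph is connected. -/
def Connected (G : MultiGraph V E) : Prop := G.ConnectedVia Set.univ

/-- `T` is the edge set of a spanning tree: it connects all vertices and contains no cycle. -/
def IsSpanningTree (G : MultiGraph V E) (T : Finset E) : Prop :=
  G.ConnectedVia (T : Set E) ∧
    ¬ ∃ (l : ℕ) (c : Fin l → E × Bool), G.IsCycle l c ∧ ∀ i, (c i).1 ∈ T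

/-- The edges with exactly one end in `U`. -/
noncomputable def cut [Fintype E] (G : MultiGraph V E) (U : Set V) : Finset E :=
  by classical exact
    Finset.univ.filter fun e => ¬ (G.tail (e, true) ∈ U ↔ G.tail (e, false) ∈ U)

/-- `F` contains at most an `ε`-fraction of the edges of every cut. -/
def IsThin [Fintype E] [DecidableEq E] (G : MultiGraph V E) (F : Finset E) (ε : ENNReal) : Prop :=
  ∀ U : Set V, ((F ∩ G.cut U).card : ENNReal) ≤ ε * ((G.cut U).card : ENNReal)

/-- The boundary walks obtained by tracing faces with respect to the cyclic order `rot` of the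
darts around the vertices: the cycles of `d ↦ rot (rev d)`, and one trivial walk for every vertex
without darts. -/
def BoundaryWalk (G : MultiGraph V E) (rot : Equiv.Perm (E × Bool)) : Type _ :=
  Quotient (Equiv.Perm.SameCycle.setoid
    ((⟨rev, rev, fun d => by simp [rev], fun d => by simp [rev]⟩ : Equiv.Perm (E × Bool)).trans
      rot)) ⊕ {v : V // ∀ d, G.tail d ≠ v}

/-- An embedding of a graph in a closed oriented surface, with face type `F`, given by
combinatorial data which determine it up to homeomorphism:
* the rotation system `rot`, whose cycles are the darts at a vertex in their cyclic order;
* the face `faceOf w` along which the boundary walk `w` runs. A face is a connected component of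
  the complement of the graph, that is, the interior of a compact surface with boundary; it is a
  disc only if it has one boundary walk and genus `0`, and embeddings with other faces are allowed;
* the genus of each face. -/
structure SurfaceEmbedding (G : MultiGraph V E) (F : Type*) where
  rot : Equiv.Perm (E × Bool)
  rot_sameCycle : ∀ d d', rot.SameCycle d d' ↔ G.tail d = G.tail d'
  faceOf : G.BoundaryWalk rot → F
  faceOf_surjective : Function.Surjective faceOf
  faceGenus : F → ℕ

namespace SurfaceEmbedding

variable {G : MultiGraph V E} {F : Type*}

/-- The face on the side of the dart `d`; the two darts of an edge belong to its two sides. -/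
def faceOfDart (M : G.SurfaceEmbedding F) (d : E × Bool) : F :=
  M.faceOf (Sum.inl (Quotient.mk _ d))

/-- The geometric dual: its vertices are the faces, and the edge `e` joins the faces on the two
sides of `e`. -/
def dual (M : G.SurfaceEmbedding F) : MultiGraph F E where
  tail := M.faceOfDart

/-- The surface has genus `γ`: its Euler characteristic `2 - 2γ` is the number of vertices minus
the number of edges plus the sum of the Euler characteristics of the faces, where a face of genus
`h` with `b` boundary walks has Euler characteristic `2 - 2h - b`. (If all faces are discs this is
Euler's formula `|V| - |E| + |F| = 2 - 2γ`.) -/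
def HasGenus [Fintype V] [Fintype E] [Fintype F] (M : G.SurfaceEmbedding F) (γ : ℕ) : Prop :=
  (Fintype.card V : ℤ) - Fintype.card E
    + ∑ f : F, (2 - 2 * (M.faceGenus f : ℤ) - Nat.card {w // M.faceOf w = f}) = 2 - 2 * γ

end SurfaceEmbedding

end MultiGraph

/-- The number `4 + ⌊2 log₂(γ + 3/2)⌋`. -/
noncomputable def genusAlpha (γ : ℕ) : ℕ := 4 + ⌊2 * Real.logb 2 ((γ : ℝ) + 3 / 2)⌋₊

/-- The data on which programs operate: binary trees. -/
inductive Data where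
  | nil : Data
  | cons : Data → Data → Data

namespace Data

/-- The number of nodes and leaves. -/
def size : Data → ℕ
  | nil => 1
  | cons x y => size x + size y + 1

/-- A natural number, in unary. -/
def ofNat : ℕ → Data
  | 0 => nil
  | n + 1 => cons nil (ofNat n)

/-- A truth value. -/
def ofBool : Bool → Data
  | false => nil
  | true => cons nil nil

/-- A list of data. -/
def ofList : List Data → Data
  | [] => nil
  | x :: l => cons x (ofList l)

end Data

/-- Programs, each transforming one binary tree into another: identity, the empty tree, the two
components of a tree, pairing, composition, branching, and the loop `while c(x) ≠ nil do x := p(x)`.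
-/
inductive Prog where
  | id : Prog
  | nil : Prog
  | fst : Prog
  | snd : Prog
  | pair : Prog → Prog → Prog
  | comp : Prog → Prog → Prog
  | ite : Prog → Prog → Prog → Prog
  | loop : Prog → Prog → Prog

/-- `p.Eval x y t`: on input `x` the program `p` halts with output `y` after `t` steps. Reading or
copying a tree takes as many steps as the tree is large, so the number of steps agrees with the
running time of a Turing machine up to a polynomial. -/
inductive Prog.Eval : Prog → Data → Data → ℕ → Prop where
  | id (x : Data) : Eval .id x x (x.size + 1)
  | nil (x : Data) : Eval .nil x .nil 1
  | fst_nil : Eval .fst .nil .nil 2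
  | fst_cons (x y : Data) : Eval .fst (.cons x y) x ((Data.cons x y).size + 1)
  | snd_nil : Eval .snd .nil .nil 2
  | snd_cons (x y : Data) : Eval .snd (.cons x y) y ((Data.cons x y).size + 1)
  | pair {p q : Prog} {x y z : Data} {s t : ℕ} :
      Eval p x y s → Eval q x z t → Eval (.pair p q) x (.cons y z) (s + t + 1)
  | comp {p q : Prog} {x y z : Data} {s t : ℕ} :
      Eval q x y s → Eval p y z t → Eval (.comp p q) x z (s + t + 1)
  | ite_true {c p q : Prog} {x a b y : Data} {s t : ℕ} :
      Eval c x (.cons a b) s → Eval p x y t → Eval (.ite c p q) x y (s + t + 1)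
  | ite_false {c p q : Prog} {x y : Data} {s t : ℕ} :
      Eval c x .nil s → Eval q x y t → Eval (.ite c p q) x y (s + t + 1)
  | loop_stop {c p : Prog} {x : Data} {s : ℕ} :
      Eval c x .nil s → Eval (.loop c p) x x (s + x.size + 1)
  | loop_step {c p : Prog} {x a b y z : Data} {s t r : ℕ} :
      Eval c x (.cons a b) s → Eval p x y t → Eval (.loop c p) y z r →
        Eval (.loop c p) x z (s + t + r + 1)

/-- Programs are deterministic. -/
theorem Prog.Eval.deterministic {p : Prog} {x y : Data} {t : ℕ} (h : p.Eval x y t) :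
    ∀ {y' : Data} {t' : ℕ}, p.Eval x y' t' → y = y' ∧ t = t' := by
  induction h with
  | id | nil | fst_nil | fst_cons | snd_nil | snd_cons =>
    intro _ _ h'; cases h'; exact ⟨rfl, rfl⟩
  | pair _ _ ih1 ih2 =>
    intro _ _ h'
    cases h' with
    | pair h1 h2 =>
      obtain ⟨rfl, rfl⟩ := ih1 h1
      obtain ⟨rfl, rfl⟩ := ih2 h2
      exact ⟨rfl, rfl⟩
  | comp _ _ ih1 ih2 =>
    intro _ _ h'
    cases h' with
    | comp h1 h2 =>
      obtain ⟨rfl, rfl⟩ := ih1 h1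
      obtain ⟨rfl, rfl⟩ := ih2 h2
      exact ⟨rfl, rfl⟩
  | ite_true _ _ ih1 ih2 =>
    intro _ _ h'
    cases h' with
    | ite_true h1 h2 =>
      obtain ⟨_, rfl⟩ := ih1 h1
      obtain ⟨rfl, rfl⟩ := ih2 h2
      exact ⟨rfl, rfl⟩
    | ite_false h1 h2 => exact absurd (ih1 h1).1 (by simp)
  | ite_false _ _ ih1 ih2 =>
    intro _ _ h'
    cases h' with
    | ite_true h1 h2 => exact absurd (ih1 h1).1 (by simp)
    | ite_false h1 h2 =>
      obtain ⟨_, rfl⟩ := ih1 h1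
      obtain ⟨rfl, rfl⟩ := ih2 h2
      exact ⟨rfl, rfl⟩
  | loop_stop _ ih =>
    intro _ _ h'
    cases h' with
    | loop_stop h1 =>
      obtain ⟨_, rfl⟩ := ih h1
      exact ⟨rfl, rfl⟩
    | loop_step h1 _ _ => exact absurd (ih h1).1 (by simp)
  | loop_step _ _ _ ih1 ih2 ih3 =>
    intro _ _ h'
    cases h' with
    | loop_stop h1 => exact absurd (ih1 h1).1 (by simp)
    | loop_step h1 h2 h3 =>
      obtain ⟨_, rfl⟩ := ih1 h1
      obtain ⟨rfl, rfl⟩ := ih2 h2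
      obtain ⟨rfl, rfl⟩ := ih3 h3
      exact ⟨rfl, rfl⟩

namespace MultiGraph

/-- The input describing a dart `d`: its tail, the edge and the side of the next dart around the
tail, and the face it belongs to. -/
def SurfaceEmbedding.encodeDart {n m k : ℕ} {G : MultiGraph (Fin n) (Fin m)}
    (M : G.SurfaceEmbedding (Fin k)) (d : Fin m × Bool) : Data :=
  Data.ofList [Data.ofNat (G.tail d), Data.ofNat (M.rot d).1, Data.ofBool (M.rot d).2,
    Data.ofNat (M.faceOfDart d)]

/-- The input describing an embedded graph: the numbers of vertices, edges and faces, and the list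
of all edges, each given by its two darts. The genera of the faces are not part of the input, so
a program has to do without them. -/
def SurfaceEmbedding.encode {n m k : ℕ} {G : MultiGraph (Fin n) (Fin m)}
    (M : G.SurfaceEmbedding (Fin k)) : Data :=
  Data.ofList [Data.ofNat n, Data.ofNat m, Data.ofNat k,
    Data.ofList ((List.finRange m).map fun e =>
      Data.cons (M.encodeDart (e, true)) (M.encodeDart (e, false)))]

/-- A set of edges as output: the list of the truth values of `e ∈ T`, in the order of the edges. -/
def encodeEdgeSet {m : ℕ} (T : Finset (Fin m)) : Data :=
  Data.ofList ((List.finRange m).map fun e => Data.ofBool (decide (e ∈ T)))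

end MultiGraph

/-! Write D for the dual graph, g for its girth and α for `genusAlpha γ`. Cuts of G are even edge
sets of D, hence disjoint unions of cycles of D. So it suffices to find a set F of edges that meets
every nonempty cut and has at most (2α/g)·l edges on each dual cycle of length l: then F contains a
spanning tree, and thinness passes to subsets.

F is obtained by peeling D (`Peel`). Edges at vertices of degree one are deleted as long as there
are any; they lie in no even set. If the remaining set H is nonempty, an edge at distance at least d
= ⌊(g-1)/(2α)⌋ from all branch vertices (those of degree at least three) is selected and deleted,
and the process is repeated. An even set loses no edge before one of its edges is selected, so F
meets it (`Peel.inter_nonempty`). After a selection the stretch of d edges on either side is pruned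
before anything else is selected, so distinct selected edges that are consecutive on a walk are more
than d steps apart (`Peel.lt_of_consecutive`). A dual cycle with k ≥ 2 selected edges thus has
length at least k(d+1) ≥ kg/(2α); for k ≤ 1 length at least g is enough.

The point is that a deep edge always exists (`deep_nonempty`). Otherwise every cycle of H has at
least q = α+1 branch vertices. The Moore bound (`BranchGirth.moore`) then makes their number b
exponential in q. On the other hand, H satisfies an Euler inequality (`card_add_card_add_card_le`),
proved by linear algebra modulo two: the cycle space of H and the cut space of G both lie in the
cycle space of D, and they intersect in the cuts given by functions constant on the pieces of G
without H. These pieces play the role of the faces of H. If there are several, each is bounded by a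
cut containing a cycle, hence sees many branch vertices, so there are few pieces and b(q-6) ≤
(4γ-4)q. The choice of α makes the two bounds incompatible (`not_moore_and_euler`).

The algorithm needs neither γ nor d: it prunes the unbranched part as long as something remains and
selects a survivor. A spanning tree inside F comes from contracting edges. Polynomial running time
follows from closure properties of `PolyTime`, mainly folds along lists whose states stay small. -/

/-! Functions computable in polynomial time by programs on binary trees. -/

/-- Types whose elements are represented by binary trees. -/
class Enc (α : Type*) where
  enc : α → Data

namespace Enc

instance : Enc Unit := ⟨fun _ => .nil⟩
instance : Enc Bool := ⟨Data.ofBool⟩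
instance : Enc ℕ := ⟨Data.ofNat⟩
instance {α β : Type*} [Enc α] [Enc β] : Enc (α × β) := ⟨fun x => .cons (enc x.1) (enc x.2)⟩
instance {α : Type*} [Enc α] : Enc (List α) := ⟨fun l => Data.ofList (l.map enc)⟩

/-- The size of the tree representing `a`. -/
def sz {α : Type*} [Enc α] (a : α) : ℕ := (enc a).size

variable {α β : Type*} [Enc α] [Enc β]

theorem size_enc (a : α) : (enc a).size = sz a := rfl

theorem size_ofList (l : List α) : (Data.ofList (l.map enc)).size = sz l := rfl

@[simp] theorem sz_prod (x : α × β) : sz x = sz x.1 + sz x.2 + 1 := rfl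

@[simp] theorem sz_nil : sz ([] : List α) = 1 := rfl

@[simp] theorem sz_cons (a : α) (l : List α) : sz (a :: l) = sz a + sz l + 1 := rfl

theorem sz_succ (n : ℕ) : sz (n + 1) = sz n + 2 := by
  change Data.size (.cons .nil (Data.ofNat n)) = Data.size (Data.ofNat n) + 2
  simp only [Data.size]
  omega

@[simp] theorem sz_nat (n : ℕ) : sz n = 2 * n + 1 := by
  induction n with
  | zero => rfl
  | succ n ih => rw [sz_succ, ih]; ring

theorem sz_bool_le (b : Bool) : sz b ≤ 3 := by
  cases b <;> decide

theorem length_le_sz (l : List α) : l.length ≤ sz l := by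
  induction l with
  | nil => simp
  | cons a l ih => simp; omega

theorem sz_append (l l' : List α) : sz (l ++ l') + 1 = sz l + sz l' := by
  induction l with
  | nil => simp; omega
  | cons a l ih => simp; omega

theorem sz_reverse (l : List α) : sz l.reverse = sz l := by
  induction l with
  | nil => rfl
  | cons a l ih =>
    have := sz_append l.reverse [a]
    simp at this ⊢
    omega

theorem sz_le_of_sublist {l l' : List α} (h : l.Sublist l') : sz l ≤ sz l' := by
  induction h with
  | slnil => rfl
  | cons a _ ih => simp; omega
  | cons_cons a _ ih => simp; omega

theorem sz_le_of_mem {a : α} {l : List α} (h : a ∈ l) : sz a ≤ sz l := by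
  have := sz_le_of_sublist (List.singleton_sublist.2 h)
  simp at this
  omega

theorem sz_le_of_length_le {l : List α} {k n : ℕ} (hk : ∀ a ∈ l, sz a ≤ k) (hn : l.length ≤ n) :
    sz l ≤ n * (k + 1) + 1 := by
  have : sz l ≤ l.length * (k + 1) + 1 := by
    clear hn
    induction l with
    | nil => simp
    | cons a l ih =>
      have h1 := hk a (by simp)
      have h2 := ih fun b hb => hk b (by simp [hb])
      simp only [sz_cons, List.length_cons, add_mul]
      omega
  exact this.trans (Nat.add_le_add_right (Nat.mul_le_mul_right _ hn) 1)

end Enc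

theorem List.foldl_cons_filter {β : Type*} (p : β → Bool) (l acc : List β) :
    l.foldl (fun acc x => if p x then x :: acc else acc) acc = (l.filter p).reverse ++ acc := by
  induction l generalizing acc with
  | nil => rfl
  | cons x l ih => cases h : p x <;> simp [ih, h]

open Enc in
/-- Numbers bounded by a polynomial in the size of the argument. -/
def PolyBound {α : Type*} [Enc α] (g : α → ℕ) : Prop :=
  ∃ q : Polynomial ℕ, ∀ a, g a ≤ q.eval (sz a)

theorem Polynomial.eval_le_eval_nat (q : Polynomial ℕ) {a b : ℕ} (h : a ≤ b) :
    q.eval a ≤ q.eval b := by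
  rw [Polynomial.eval_eq_sum, Polynomial.eval_eq_sum]
  exact Finset.sum_le_sum fun i _ => Nat.mul_le_mul_left _ (Nat.pow_le_pow_left h i)

namespace PolyBound

open Enc

variable {α β : Type*} [Enc α] [Enc β] {g h : α → ℕ}

theorem mono (hg : PolyBound g) (hle : ∀ a, h a ≤ g a) : PolyBound h := by
  obtain ⟨q, hq⟩ := hg
  exact ⟨q, fun a => (hle a).trans (hq a)⟩

theorem const (c : ℕ) : PolyBound fun _ : α => c := ⟨Polynomial.C c, fun a => by simp⟩

theorem size : PolyBound fun a : α => sz a := ⟨Polynomial.X, fun a => by simp⟩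

theorem add (hg : PolyBound g) (hh : PolyBound h) : PolyBound fun a => g a + h a := by
  obtain ⟨q, hq⟩ := hg
  obtain ⟨r, hr⟩ := hh
  exact ⟨q + r, fun a => by
    simp only [Polynomial.eval_add]
    exact Nat.add_le_add (hq a) (hr a)⟩

theorem mul (hg : PolyBound g) (hh : PolyBound h) : PolyBound fun a => g a * h a := by
  obtain ⟨q, hq⟩ := hg
  obtain ⟨r, hr⟩ := hh
  exact ⟨q * r, fun a => by
    simp only [Polynomial.eval_mul]
    exact Nat.mul_le_mul (hq a) (hr a)⟩

theorem eval (hg : PolyBound g) (q : Polynomial ℕ) : PolyBound fun a => q.eval (g a) := by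
  obtain ⟨r, hr⟩ := hg
  exact ⟨q.comp r, fun a => by
    simp only [Polynomial.eval_comp]
    exact Polynomial.eval_le_eval_nat q (hr a)⟩

end PolyBound

/-! ### Cost of evaluation and of loops -/

theorem Prog.Eval.size_le {p : Prog} {x y : Data} {t : ℕ} (h : p.Eval x y t) : y.size ≤ t := by
  induction h <;> (try simp only [Data.size] at *) <;> omega

/-- The single bound `K` covers each of the `k` rounds and also the final test, which includes
copying the last state; this gives the factor `k + 1`. -/
theorem Prog.Eval.exists_loop {c p : Prog} (st : ℕ → Data) (k K : ℕ)
    (hstep : ∀ i < k, ∃ a b s t, c.Eval (st i) (.cons a b) s ∧ p.Eval (st i) (st (i + 1)) t ∧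
      s + t + 1 ≤ K)
    (hfinal : ∃ s, c.Eval (st k) .nil s ∧ s + (st k).size + 1 ≤ K) :
    ∃ t, (Prog.loop c p).Eval (st 0) (st k) t ∧ t ≤ (k + 1) * K := by
  induction k generalizing st with
  | zero =>
    obtain ⟨s, hs, hK⟩ := hfinal
    refine ⟨s + (st 0).size + 1, ?_, by omega⟩
    constructor
    exact hs
  | succ k ih =>
    obtain ⟨t, ht, htK⟩ := ih (fun i => st (i + 1)) (fun i hi => hstep (i + 1) (by omega)) hfinal
    obtain ⟨a, b, s, r, h1, h2, h3⟩ := hstep 0 (by omega)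
    refine ⟨_, .loop_step h1 h2 ht, ?_⟩
    rw [add_mul]
    omega

open Enc in
/-- `f` is computed by a program in polynomial time. -/
def PolyTime {α β : Type*} [Enc α] [Enc β] (f : α → β) : Prop :=
  ∃ p : Prog, ∃ r : α → ℕ, PolyBound r ∧ ∀ a, ∃ t, p.Eval (enc a) (enc (f a)) t ∧ t ≤ r a

namespace PolyTime

open Enc

variable {α β γ δ : Type*} [Enc α] [Enc β] [Enc γ] [Enc δ]

theorem polyBound {f : α → β} (hf : PolyTime f) : PolyBound fun a => sz (f a) := by
  obtain ⟨p, r, hr, h⟩ := hf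
  refine hr.mono fun a => ?_
  obtain ⟨t, ht, hle⟩ := h a
  exact ht.size_le.trans hle

theorem exists_le {f : α → β} (hf : PolyTime f) :
    ∃ q : Polynomial ℕ, ∀ a, sz (f a) ≤ q.eval (sz a) := hf.polyBound

/-- A program that maps the code of `a` to the code of `f a` shows that `f` is polynomial-time
whenever it does so in linear time. -/
theorem of_linear {f : α → β} (p : Prog) (c : ℕ)
    (h : ∀ a, ∃ t, p.Eval (enc a) (enc (f a)) t ∧ t ≤ sz a + c) : PolyTime f :=
  ⟨p, fun a => sz a + c, PolyBound.size.add (.const c), h⟩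

theorem fst : PolyTime fun x : α × β => x.1 :=
  of_linear .fst 1 fun _ => ⟨_, .fst_cons _ _, le_rfl⟩

theorem snd : PolyTime fun x : α × β => x.2 :=
  of_linear .snd 1 fun _ => ⟨_, .snd_cons _ _, le_rfl⟩

theorem exists_const_prog (y : Data) : ∃ p : Prog, ∃ t, ∀ x, p.Eval x y t := by
  induction y with
  | nil => exact ⟨.nil, 1, .nil⟩
  | cons y z ihy ihz =>
    obtain ⟨p, s, hp⟩ := ihy
    obtain ⟨q, t, hq⟩ := ihz
    exact ⟨.pair p q, s + t + 1, fun x => .pair (hp x) (hq x)⟩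

theorem const (b : β) : PolyTime fun _ : α => b := by
  obtain ⟨p, t, h⟩ := exists_const_prog (enc b)
  exact of_linear p t fun a => ⟨t, h _, by omega⟩

theorem comp {f : β → γ} {g : α → β} (hf : PolyTime f) (hg : PolyTime g) :
    PolyTime fun a => f (g a) := by
  obtain ⟨q, hq⟩ := hg.exists_le
  obtain ⟨p₁, r₁, ⟨q₁, hr₁⟩, h₁⟩ := hf
  obtain ⟨p₂, r₂, hr₂, h₂⟩ := hg
  refine ⟨.comp p₁ p₂, fun a => r₂ a + q₁.eval (q.eval (sz a)) + 1,
    (hr₂.add ((PolyBound.size.eval q).eval q₁)).add (.const 1), fun a => ?_⟩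
  obtain ⟨t, ht, htr⟩ := h₂ a
  obtain ⟨s, hs, hsr⟩ := h₁ (g a)
  refine ⟨_, .comp ht hs, ?_⟩
  have := hr₁ (g a)
  have := Polynomial.eval_le_eval_nat q₁ (hq a)
  dsimp only at *
  omega

theorem pair {f : α → β} {g : α → γ} (hf : PolyTime f) (hg : PolyTime g) :
    PolyTime fun a => (f a, g a) := by
  obtain ⟨p₁, r₁, hr₁, h₁⟩ := hf
  obtain ⟨p₂, r₂, hr₂, h₂⟩ := hg
  refine ⟨.pair p₁ p₂, fun a => r₁ a + r₂ a + 1, (hr₁.add hr₂).add (.const 1), fun a => ?_⟩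
  obtain ⟨t, ht, htr⟩ := h₁ a
  obtain ⟨s, hs, hsr⟩ := h₂ a
  exact ⟨_, .pair ht hs, by dsimp only; omega⟩

theorem left {f : α → β × γ} (hf : PolyTime f) : PolyTime fun a => (f a).1 := fst.comp hf

theorem right {f : α → β × γ} (hf : PolyTime f) : PolyTime fun a => (f a).2 := snd.comp hf

/-- A function with the same codes of arguments and values as a polynomial-time function. -/
theorem recode {f : α → β} {f' : γ → δ} (hf : PolyTime f) (g : γ → α)
    (hg : ∀ c, enc c = enc (g c)) (hf' : ∀ c, enc (f' c) = enc (f (g c))) : PolyTime f' := by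
  obtain ⟨p, r, ⟨q, hr⟩, h⟩ := hf
  refine ⟨p, fun c => q.eval (sz c), PolyBound.size.eval q, fun c => ?_⟩
  obtain ⟨t, ht, hle⟩ := h (g c)
  rw [hg, hf']
  refine ⟨t, ht, hle.trans ((hr _).trans (le_of_eq ?_))⟩
  simp only [sz, hg c]

theorem ite {c : α → Bool} {f g : α → β} (hc : PolyTime c) (hf : PolyTime f) (hg : PolyTime g) :
    PolyTime fun a => if c a then f a else g a := by
  obtain ⟨p₀, r₀, hr₀, h₀⟩ := hc
  obtain ⟨p₁, r₁, hr₁, h₁⟩ := hf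
  obtain ⟨p₂, r₂, hr₂, h₂⟩ := hg
  refine ⟨.ite p₀ p₁ p₂, fun a => r₀ a + (r₁ a + r₂ a) + 1,
    (hr₀.add (hr₁.add hr₂)).add (.const 1), fun a => ?_⟩
  obtain ⟨u, hu, hur⟩ := h₀ a
  obtain ⟨t, ht, htr⟩ := h₁ a
  obtain ⟨s, hs, hsr⟩ := h₂ a
  cases hca : c a
  · rw [hca] at hu
    refine ⟨_, .ite_false hu (t := s) (by simpa [hca] using hs), by dsimp only; omega⟩
  · rw [hca] at hu
    refine ⟨_, .ite_true hu (t := t) (by simpa [hca] using ht), by dsimp only; omega⟩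

theorem cons {f : α → β} {g : α → List β} (hf : PolyTime f) (hg : PolyTime g) :
    PolyTime fun a => f a :: g a :=
  (hf.pair hg).recode (fun a => a) (fun _ => rfl) fun _ => rfl

/-- Case distinction on a list. -/
theorem list_cases {l : α → List β} {f : α → γ} {g : α → β → List β → γ} (hl : PolyTime l)
    (hf : PolyTime f) (hg : PolyTime fun x : α × β × List β => g x.1 x.2.1 x.2.2) :
    PolyTime fun a => match l a with
      | [] => f a
      | b :: l' => g a b l' := by
  obtain ⟨q, hq⟩ := hl.exists_le
  obtain ⟨p₀, r₀, hr₀, h₀⟩ := hl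
  obtain ⟨p₁, r₁, hr₁, h₁⟩ := hf
  obtain ⟨p₂, r₂, ⟨q₂, hr₂⟩, h₂⟩ := hg
  -- The list is computed twice: once as the condition, where a nonempty list counts as true, and
  -- once to hand its head and tail to `p₂`.
  refine ⟨.ite p₀ (.comp p₂ (.pair .id p₀)) p₁,
    fun a => r₀ a + (r₁ a + (r₀ a + (sz a + q₂.eval (sz a + q.eval (sz a) + 1)) + 3)) + 1,
    (hr₀.add (hr₁.add ((hr₀.add (PolyBound.size.add (((PolyBound.size.add
      (PolyBound.size.eval q)).add (.const 1)).eval q₂))).add (.const 3)))).add (.const 1),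
    fun a => ?_⟩
  obtain ⟨u, hu, hur⟩ := h₀ a
  obtain ⟨t, ht, htr⟩ := h₁ a
  have hqa := hq a
  cases hla : l a with
  | nil =>
    rw [hla] at hu
    exact ⟨_, .ite_false hu (t := t) (by simpa [hla] using ht), by dsimp only; omega⟩
  | cons b l' =>
    obtain ⟨s, hs, hsr⟩ := h₂ (a, b, l')
    rw [hla] at hu hqa
    refine ⟨_, .ite_true hu (.comp (.pair (.id _) hu) (t := s) (by simp only [hla]; exact hs)), ?_⟩
    have := hr₂ (a, b, l')
    have h3 : sz (a, b, l') ≤ sz a + q.eval (sz a) + 1 := by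
      simp at hqa ⊢
      omega
    have := Polynomial.eval_le_eval_nat q₂ h3
    have : (enc a).size = sz a := rfl
    dsimp only
    omega

/-- Iteration along a list, with polynomially bounded intermediate results. -/
theorem foldl {l : α → List β} {f : α → γ → β → γ} {b : α → γ} (hl : PolyTime l)
    (hf : PolyTime fun x : α × γ × β => f x.1 x.2.1 x.2.2) (hb : PolyTime b)
    (hB : ∃ B : α → ℕ, PolyBound B ∧ ∀ a l', l' <+: l a → sz (l'.foldl (f a) (b a)) ≤ B a) :
    PolyTime fun a => (l a).foldl (f a) (b a) := by
  obtain ⟨B, hBp, hB⟩ := hB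
  obtain ⟨q, hq⟩ := hl.exists_le
  obtain ⟨p₀, r₀, hr₀, h₀⟩ := hl
  obtain ⟨p₁, r₁, hr₁, h₁⟩ := hb
  obtain ⟨p₂, r₂, ⟨q₂, hr₂⟩, h₂⟩ := hf
  -- A loop state is the triple of argument, accumulator and unread part of the list. The condition
  -- `c` extracts the unread part, which is `nil` exactly at the end.
  set c : Prog := .comp .snd .snd with hc
  set body : Prog := .pair .fst (.pair
    (.comp p₂ (.pair .fst (.pair (.comp .fst .snd) (.comp .fst c)))) (.comp .snd c)) with hbody
  have hS : PolyBound fun a : α => sz a + B a + q.eval (sz a) + 2 :=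
    ((PolyBound.size.add hBp).add (PolyBound.size.eval q)).add (.const 2)
  set S : α → ℕ := fun a => sz a + B a + q.eval (sz a) + 2 with hSdef
  have hK : PolyBound fun a => 30 * S a + q₂.eval (S a) + 30 :=
    (((PolyBound.const 30).mul hS).add (hS.eval q₂)).add (.const 30)
  -- One round traverses parts of the state a bounded number of times and calls `p₂` once; the
  -- constant 30 is generous.
  set K : α → ℕ := fun a => 30 * S a + q₂.eval (S a) + 30 with hKdef
  refine ⟨.comp (.comp .fst .snd) (.comp (.loop c body) (.pair .id (.pair p₁ p₀))),
    fun a => sz a + r₁ a + r₀ a + (q.eval (sz a) + 1) * K a + 3 * S a + 20,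
    (((((PolyBound.size.add hr₁).add hr₀).add (((PolyBound.size.eval q).add (.const 1)).mul
      hK)).add ((PolyBound.const 3).mul hS)).add (.const 20)), fun a => ?_⟩
  obtain ⟨u, hu, hur⟩ := h₀ a
  obtain ⟨v, hv, hvr⟩ := h₁ a
  have hqa := hq a
  have hlen : (l a).length ≤ q.eval (sz a) := (length_le_sz _).trans hqa
  let st : ℕ → α × γ × List β := fun i => (a, ((l a).take i).foldl (f a) (b a), (l a).drop i)
  have hst : ∀ i, sz (st i) ≤ S a := fun i => by
    have h1 := hB a ((l a).take i) (List.take_prefix i _)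
    have h2 : sz ((l a).drop i) ≤ sz (l a) := sz_le_of_sublist (List.drop_sublist i _)
    simp only [st, sz_prod, hSdef]
    omega
  obtain ⟨t, ht, htK⟩ := Prog.Eval.exists_loop (c := c) (p := body) (fun i => enc (st i))
    (l a).length (K a) (by
      intro i hi
      have hd : (l a).drop i = (l a)[i] :: (l a).drop (i + 1) := List.drop_eq_getElem_cons hi
      set x := ((l a).take i).foldl (f a) (b a) with hx
      have hx' : ((l a).take (i + 1)).foldl (f a) (b a) = f a x (l a)[i] := by
        rw [List.take_succ_eq_append_getElem hi, List.foldl_append]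
        rfl
      have hsti : st i = (a, x, (l a)[i] :: (l a).drop (i + 1)) := by
        simp only [st, hd, hx]
      have hsti' : st (i + 1) = (a, f a x (l a)[i], (l a).drop (i + 1)) := by
        simp only [st, hx']
      have hsz := hst i
      obtain ⟨s, hs, hsr⟩ := h₂ (a, x, (l a)[i])
      have hr2 := hr₂ (a, x, (l a)[i])
      rw [hsti] at hsz
      rw [hsti, hsti']
      simp only [sz_prod, sz_cons] at hsz
      have hr2' := Polynomial.eval_le_eval_nat q₂
        (show sz (a, x, (l a)[i]) ≤ S a by simp only [sz_prod]; omega)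
      have hcE : c.Eval (enc (a, x, (l a)[i] :: (l a).drop (i + 1)))
          (enc ((l a)[i] :: (l a).drop (i + 1))) _ :=
        .comp (.snd_cons _ _) (.snd_cons _ _)
      refine ⟨enc (l a)[i], enc ((l a).drop (i + 1)), _, _, hcE,
        .pair (.fst_cons _ _) (.pair (.comp (.pair (.fst_cons _ _) (.pair
          (.comp (.snd_cons _ _) (.fst_cons _ _)) (.comp hcE (.fst_cons _ _)))) hs)
          (.comp hcE (.snd_cons _ _))), ?_⟩
      simp only [Data.size, size_enc, size_ofList, sz_prod, sz_cons]
      simp only [hKdef]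
      omega) (by
      have hsz := hst (l a).length
      have hsti : st (l a).length = (a, (l a).foldl (f a) (b a), []) := by simp [st]
      rw [hsti] at hsz ⊢
      refine ⟨_, Prog.Eval.comp (.snd_cons _ _) (.snd_cons _ _), ?_⟩
      simp only [Data.size, size_enc, sz_prod, sz_nil] at hsz ⊢
      simp only [hKdef]
      omega)
  have hsz := hst (l a).length
  have hsti : st (l a).length = (a, (l a).foldl (f a) (b a), []) := by simp [st]
  simp only [hsti] at ht hsz
  have h0 : st 0 = (a, b a, l a) := by simp [st]
  simp only [h0] at ht
  refine ⟨_, .comp (.comp (.pair (.id _) (.pair hv hu)) ht)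
    (.comp (.snd_cons _ _) (.fst_cons _ _)), ?_⟩
  have hKle : ((l a).length + 1) * K a ≤ (q.eval (sz a) + 1) * K a := by gcongr
  simp only [Data.size, size_enc, sz_prod, sz_nil] at hsz ⊢
  omega

/-- Iteration along a list of a function that does not increase the size. -/
theorem foldl_of_le {l : α → List β} {f : α → γ → β → γ} {b : α → γ} (hl : PolyTime l)
    (hf : PolyTime fun x : α × γ × β => f x.1 x.2.1 x.2.2) (hb : PolyTime b)
    (hle : ∀ a c x, sz (f a c x) ≤ sz c) : PolyTime fun a => (l a).foldl (f a) (b a) := by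
  refine foldl hl hf hb ⟨_, hb.polyBound, fun a l' _ => ?_⟩
  induction l' using List.reverseRecOn with
  | nil => exact le_rfl
  | append_singleton l' x ih =>
    rw [List.foldl_append]
    exact (hle _ _ _).trans (ih (by assumption |> (List.prefix_append l' [x]).trans))

theorem reverse {l : α → List β} (hl : PolyTime l) : PolyTime fun a => (l a).reverse := by
  have h := foldl (f := fun _ (acc : List β) x => x :: acc) (b := fun _ => []) hl
    (cons (snd.comp snd) (fst.comp snd)) (const [])
    ⟨_, hl.polyBound, fun a l' h => by
      rw [List.foldl_flip_cons_eq_append', List.append_nil, sz_reverse]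
      exact sz_le_of_sublist h.sublist⟩
  simpa [List.foldl_flip_cons_eq_append'] using h

theorem append {l l' : α → List β} (hl : PolyTime l) (hl' : PolyTime l') :
    PolyTime fun a => l a ++ l' a := by
  have h := foldl (f := fun _ (acc : List β) x => x :: acc) (b := l') hl.reverse
    (cons (snd.comp snd) (fst.comp snd)) hl'
    ⟨_, hl.polyBound.add hl'.polyBound, fun a m h => by
      rw [List.foldl_flip_cons_eq_append']
      have h1 := sz_append m.reverse (l' a)
      have h2 := sz_le_of_sublist h.sublist
      rw [sz_reverse] at h1 h2
      omega⟩
  simpa [List.foldl_flip_cons_eq_append'] using h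

theorem map {l : α → List β} {f : α → β → γ} (hl : PolyTime l)
    (hf : PolyTime fun x : α × β => f x.1 x.2) : PolyTime fun a => (l a).map (f a) := by
  obtain ⟨q, hq⟩ := hf.exists_le
  obtain ⟨r, hr⟩ := hl.exists_le
  have hm : PolyBound fun a : α =>
      r.eval (sz a) * (q.eval (sz a + r.eval (sz a) + 1) + 1) + 1 :=
    ((PolyBound.size.eval r).mul ((((PolyBound.size.add (PolyBound.size.eval r)).add
      (.const 1)).eval q).add (.const 1))).add (.const 1)
  have h := foldl (f := fun a (acc : List γ) x => f a x :: acc) (b := fun _ => []) hl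
    (cons (hf.comp (fst.pair (snd.comp snd))) (fst.comp snd)) (const [])
    ⟨_, hm, fun a l' h => by
      rw [List.foldl_flip_cons_eq_append, List.append_nil, sz_reverse]
      refine sz_le_of_length_le (fun c hc => ?_) ?_
      · obtain ⟨x, hx, rfl⟩ := List.mem_map.1 hc
        refine (hq (a, x)).trans (Polynomial.eval_le_eval_nat q ?_)
        have := sz_le_of_mem (h.subset hx)
        have := hr a
        simp only [sz_prod]
        omega
      · rw [List.length_map]
        exact (h.length_le.trans (length_le_sz _)).trans (hr a)⟩
  simpa [List.foldl_flip_cons_eq_append] using h.reverse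

theorem filter {l : α → List β} {p : α → β → Bool} (hl : PolyTime l)
    (hp : PolyTime fun x : α × β => p x.1 x.2) : PolyTime fun a => (l a).filter (p a) := by
  have h := foldl (f := fun a (acc : List β) x => if p a x then x :: acc else acc)
    (b := fun _ => []) hl
    (ite (hp.comp (fst.pair (snd.comp snd))) (cons (snd.comp snd) (fst.comp snd))
      (fst.comp snd)) (const [])
    ⟨_, hl.polyBound, fun a l' h => by
      rw [List.foldl_cons_filter, List.append_nil, sz_reverse]
      exact sz_le_of_sublist (List.filter_sublist.trans h.sublist)⟩
  simpa [List.foldl_cons_filter] using h.reverse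

/-! ### Tests on lists, truth values and unary arithmetic -/

theorem isEmpty {l : α → List β} (hl : PolyTime l) : PolyTime fun a => (l a).isEmpty := by
  have h := list_cases (g := fun _ _ _ => false) hl (const true) (const false)
  refine h.recode (fun a => a) (fun _ => rfl) fun a => ?_
  cases l a <;> rfl

theorem not {b : α → Bool} (hb : PolyTime b) : PolyTime fun a => !b a := by
  have h := ite hb (const false) (const true)
  refine h.recode (fun a => a) (fun _ => rfl) fun a => ?_
  cases b a <;> rfl

theorem and {b c : α → Bool} (hb : PolyTime b) (hc : PolyTime c) :
    PolyTime fun a => b a && c a := by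
  have h := ite hb hc (const false)
  refine h.recode (fun a => a) (fun _ => rfl) fun a => ?_
  cases b a <;> rfl

theorem beq_bool {b c : α → Bool} (hb : PolyTime b) (hc : PolyTime c) :
    PolyTime fun a => b a == c a := by
  have h := ite hb hc hc.not
  refine h.recode (fun a => a) (fun _ => rfl) fun a => ?_
  cases b a <;> cases c a <;> rfl

theorem any {l : α → List β} {p : α → β → Bool} (hl : PolyTime l)
    (hp : PolyTime fun x : α × β => p x.1 x.2) : PolyTime fun a => (l a).any (p a) := by
  refine (filter hl hp).isEmpty.not.recode (fun a => a) (fun _ => rfl) fun a => ?_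
  congr 1
  rw [Bool.eq_iff_iff]
  simp

/-- Unary numbers have the same codes as lists of units, so arithmetic is inherited from list
programs. -/
theorem ofNat_eq (n : ℕ) : Data.ofNat n = Data.ofList ((List.replicate n ()).map enc) := by
  induction n with
  | zero => rfl
  | succ n ih => rw [Data.ofNat, ih]; rfl

theorem replicate {f : α → ℕ} (hf : PolyTime f) : PolyTime fun a => List.replicate (f a) () :=
  hf.recode (fun a => a) (fun _ => rfl) fun a => (ofNat_eq (f a)).symm

theorem length {l : α → List β} (hl : PolyTime l) : PolyTime fun a => (l a).length := by
  refine (map (f := fun _ _ => ()) hl (const ())).recode (fun a => a) (fun _ => rfl) fun a => ?_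
  rw [List.map_const']
  exact ofNat_eq _

theorem pred {f : α → ℕ} (hf : PolyTime f) : PolyTime fun a => f a - 1 := by
  have h := list_cases (f := fun _ => []) (g := fun _ _ l => l) hf.replicate (const [])
    (snd.comp snd)
  refine h.recode (fun a => a) (fun _ => rfl) fun a => ?_
  cases hfa : f a with
  | zero => rfl
  | succ n => exact ofNat_eq n

theorem sub {f g : α → ℕ} (hf : PolyTime f) (hg : PolyTime g) : PolyTime fun a => f a - g a := by
  have h := foldl_of_le (f := fun _ n _ => n - 1) hg.replicate (fst.comp snd).pred hf
    (fun a n x => by simp)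
  refine h.recode (fun a => a) (fun _ => rfl) fun a => ?_
  congr 1
  generalize g a = m
  generalize f a = n
  induction m generalizing n with
  | zero => rfl
  | succ m ih =>
    rw [List.replicate_succ, List.foldl_cons, ← ih]
    omega

theorem le {f g : α → ℕ} (hf : PolyTime f) (hg : PolyTime g) :
    PolyTime fun a => decide (f a ≤ g a) := by
  refine (sub hf hg).replicate.isEmpty.recode (fun a => a) (fun _ => rfl) fun a => ?_
  congr 1
  rw [Bool.eq_iff_iff]
  simp [Nat.sub_eq_zero_iff_le]

theorem beq {f g : α → ℕ} (hf : PolyTime f) (hg : PolyTime g) : PolyTime fun a => f a == g a := by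
  refine (and (le hf hg) (le hg hf)).recode (fun a => a) (fun _ => rfl) fun a => ?_
  congr 1
  rw [Bool.eq_iff_iff, beq_iff_eq, Bool.and_eq_true, decide_eq_true_eq, decide_eq_true_eq]
  exact le_antisymm_iff

end PolyTime

/-! The algorithm, on lists of edges. -/

/-- An edge as it is stored by the algorithm: an identifier, its ends, and the faces on its two
sides. -/
abbrev EdgeRecord := (ℕ × Bool) × (ℕ × ℕ) × (ℕ × ℕ)

namespace ThinTree

/-- The degree in the dual graph with edges `L` of the face `f`. -/
def degree (L : List EdgeRecord) (f : ℕ) : ℕ :=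
  ((L.filter fun r => r.2.2.1 == f) ++ L.filter fun r => r.2.2.2 == f).length

/-- Delete the edges at dual vertices of degree one. -/
def prune (L : List EdgeRecord) : List EdgeRecord :=
  L.filter fun r => !(degree L r.2.2.1 == 1) && !(degree L r.2.2.2 == 1)

/-- Delete edges at dual vertices of degree one as long as there are any. -/
def core (L : List EdgeRecord) : List EdgeRecord := L.foldl (fun A _ => prune A) L

/-- The edges without an end of degree greater than two. -/
def unbranched (L : List EdgeRecord) : List EdgeRecord :=
  L.filter fun r => decide (degree L r.2.2.1 ≤ 2) && decide (degree L r.2.2.2 ≤ 2)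

/-- `B`, unless it is empty. -/
def orElse (A B : List EdgeRecord) : List EdgeRecord := if B.isEmpty then A else B

/-- Edges as far as possible from the dual vertices of degree greater than two. -/
def deepest (L : List EdgeRecord) : List EdgeRecord :=
  L.foldl (fun A _ => orElse A (prune A)) (orElse L (unbranched L))

/-- Equality of the identifiers. -/
def sameId (i j : ℕ × Bool) : Bool := i.1 == j.1 && i.2 == j.2

/-- Move an edge from the middle of a long path in the dual graph to the selected edges. -/
def selectStep (s : List EdgeRecord × List EdgeRecord) : List EdgeRecord × List EdgeRecord :=
  match deepest s.1 with
  | [] => s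
  | r :: _ => (core (s.1.filter fun r' => !sameId r'.1 r.1), r :: s.2)

/-- Edges that are pairwise far apart in the dual graph and meet all cuts. -/
def select (L : List EdgeRecord) : List EdgeRecord :=
  (L.foldl (fun s _ => selectStep s) (core L, [])).2

/-- Identify two labels. -/
def relabel (u v x : ℕ) : ℕ :=
  if x == (if decide (u ≤ v) then v else u) then (if decide (u ≤ v) then u else v) else x

/-- Identify the ends of the edge `r` in the edge `s`. -/
def contract (r s : EdgeRecord) : EdgeRecord :=
  (s.1, (relabel r.2.1.1 r.2.1.2 s.2.1.1, relabel r.2.1.1 r.2.1.2 s.2.1.2), s.2.2)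

/-- Contract the first edge, and choose it for the tree unless it is a loop. -/
def treeStep (s : List EdgeRecord × List (ℕ × Bool)) : List EdgeRecord × List (ℕ × Bool) :=
  match s.1 with
  | [] => s
  | r :: L => if r.2.1.1 == r.2.1.2 then (L, s.2) else (L.map (contract r), r.1 :: s.2)

/-- The identifiers of the edges of a maximal forest. -/
def forest (L : List EdgeRecord) : List (ℕ × Bool) :=
  (L.foldl (fun s _ => treeStep s) (L, [])).2

/-- The truth values of membership in the tree. -/
def output (L : List EdgeRecord) : List Bool :=
  L.map fun r => (forest (select L)).any fun i => sameId i r.1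

/-- The type of codes of darts. -/
abbrev DartRecord := ℕ × ℕ × Bool × ℕ × Unit

/-- The type of codes of embedded graphs. -/
abbrev Input := ℕ × ℕ × ℕ × List (DartRecord × DartRecord) × Unit

/-- The record of an edge. As the rotation is injective, the dart that follows the first dart of
an edge identifies the edge. -/
def record (x : DartRecord × DartRecord) : EdgeRecord :=
  ((x.1.2.1, x.1.2.2.1), (x.1.1, x.2.1), (x.1.2.2.2.1, x.2.2.2.2.1))

/-- The algorithm. -/
def algorithm (x : Input) : List Bool := output (x.2.2.2.1.map record)

/-! ### Size bounds and polynomial running time of the algorithm -/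

open Enc

theorem prune_sublist (L : List EdgeRecord) : (prune L).Sublist L := List.filter_sublist

theorem foldl_sublist {α β : Type*} {f : List α → List α} (hf : ∀ A, (f A).Sublist A) (l : List β)
    (A : List α) : (l.foldl (fun A _ => f A) A).Sublist A := by
  induction l generalizing A with
  | nil => exact List.Sublist.refl _
  | cons x l ih => exact (ih _).trans (hf A)

theorem core_sublist (L : List EdgeRecord) : (core L).Sublist L :=
  foldl_sublist prune_sublist L L

theorem orElse_sublist {A B C : List EdgeRecord} (hA : A.Sublist C) (hB : B.Sublist C) :
    (orElse A B).Sublist C := by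
  unfold orElse
  split_ifs
  · exact hA
  · exact hB

theorem deepest_sublist (L : List EdgeRecord) : (deepest L).Sublist L :=
  (foldl_sublist (fun A => orElse_sublist (List.Sublist.refl A) (prune_sublist A)) L _).trans
    (orElse_sublist (List.Sublist.refl L) List.filter_sublist)

section PolyTime

open PolyTime

variable {α : Type*} [Enc α]

theorem polyTime_degree {L : α → List EdgeRecord} {f : α → ℕ} (hL : PolyTime L)
    (hf : PolyTime f) : PolyTime fun a => degree (L a) (f a) := by
  unfold degree
  exact (append
    (filter (p := fun a r => r.2.2.1 == f a) hL (beq snd.right.right.left (hf.comp fst)))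
    (filter (p := fun a r => r.2.2.2 == f a) hL
      (beq snd.right.right.right (hf.comp fst)))).length

theorem polyTime_prune {L : α → List EdgeRecord} (hL : PolyTime L) :
    PolyTime fun a => prune (L a) := by
  have h₁ : PolyTime fun x : α × EdgeRecord => degree (L x.1) x.2.2.2.1 :=
    polyTime_degree (hL.comp fst) snd.right.right.left
  have h₂ : PolyTime fun x : α × EdgeRecord => degree (L x.1) x.2.2.2.2 :=
    polyTime_degree (hL.comp fst) snd.right.right.right
  exact filter hL (and (beq h₁ (const 1)).not (beq h₂ (const 1)).not)

theorem polyTime_core {L : α → List EdgeRecord} (hL : PolyTime L) :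
    PolyTime fun a => core (L a) :=
  foldl_of_le (f := fun _ A _ => prune A) hL (polyTime_prune snd.left) hL
    fun _ A _ => sz_le_of_sublist (prune_sublist A)

theorem polyTime_unbranched {L : α → List EdgeRecord} (hL : PolyTime L) :
    PolyTime fun a => unbranched (L a) := by
  unfold unbranched
  exact filter (p := fun a r =>
      decide (degree (L a) r.2.2.1 ≤ 2) && decide (degree (L a) r.2.2.2 ≤ 2))
    hL
    (and (le (polyTime_degree (hL.comp fst) snd.right.right.left) (const 2))
      (le (polyTime_degree (hL.comp fst) snd.right.right.right) (const 2)))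

theorem polyTime_orElse {A B : α → List EdgeRecord} (hA : PolyTime A) (hB : PolyTime B) :
    PolyTime fun a => orElse (A a) (B a) := ite hB.isEmpty hA hB

theorem polyTime_deepest {L : α → List EdgeRecord} (hL : PolyTime L) :
    PolyTime fun a => deepest (L a) :=
  foldl_of_le (f := fun _ A _ => orElse A (prune A)) hL
    (polyTime_orElse snd.left (polyTime_prune snd.left))
    (polyTime_orElse hL (polyTime_unbranched hL))
    fun _ A _ => sz_le_of_sublist (orElse_sublist (List.Sublist.refl A) (prune_sublist A))

theorem polyTime_sameId {i j : α → ℕ × Bool} (hi : PolyTime i) (hj : PolyTime j) :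
    PolyTime fun a => sameId (i a) (j a) :=
  and (beq hi.left hj.left) (beq_bool hi.right hj.right)

theorem sameId_eq_true {i j : ℕ × Bool} : sameId i j = true ↔ i = j := by
  simp [sameId, Prod.ext_iff]

/-- The record `r` itself is filtered out, which pays for adding it to the list of selected edges.
Hence the state of the selection never grows. -/
theorem sz_filter_not_sameId_le {L : List EdgeRecord} {r : EdgeRecord} (hr : r ∈ L) :
    sz (L.filter fun r' => !sameId r'.1 r.1) + sz r + 1 ≤ sz L := by
  obtain ⟨l₁, l₂, rfl⟩ := List.append_of_mem hr
  have h1 := sz_append (l₁.filter fun r' => !sameId r'.1 r.1)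
    (l₂.filter fun r' => !sameId r'.1 r.1)
  have h2 := sz_append l₁ (r :: l₂)
  have h3 : sz (l₁.filter fun r' => !sameId r'.1 r.1) ≤ sz l₁ :=
    sz_le_of_sublist List.filter_sublist
  have h4 : sz (l₂.filter fun r' => !sameId r'.1 r.1) ≤ sz l₂ :=
    sz_le_of_sublist List.filter_sublist
  rw [sz_cons] at h2
  rw [List.filter_append, List.filter_cons_of_neg (by simp [sameId_eq_true])]
  omega

theorem sz_selectStep_le (s : List EdgeRecord × List EdgeRecord) : sz (selectStep s) ≤ sz s := by
  unfold selectStep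
  split
  · exact le_rfl
  · rename_i r l h
    have hr : r ∈ s.1 := (deepest_sublist s.1).subset (h ▸ List.mem_cons_self)
    have h1 := sz_filter_not_sameId_le hr
    have h2 := sz_le_of_sublist (core_sublist (s.1.filter fun r' => !sameId r'.1 r.1))
    rw [sz_prod, sz_prod s, sz_cons]
    dsimp only
    omega

theorem polyTime_selectStep {s : α → List EdgeRecord × List EdgeRecord} (hs : PolyTime s) :
    PolyTime fun a => selectStep (s a) := by
  have h := list_cases (l := fun a => deepest (s a).1) (f := s)
    (g := fun a r _ => (core ((s a).1.filter fun r' => !sameId r'.1 r.1), r :: (s a).2))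
    (polyTime_deepest hs.left) hs (pair (polyTime_core ?_) (cons snd.left (hs.comp fst).right))
  · exact h.recode (fun a => a) (fun _ => rfl) fun a => by
      unfold selectStep
      cases deepest (s a).1 <;> rfl
  exact filter (p := fun (x : α × EdgeRecord × List EdgeRecord) r' => !sameId r'.1 x.2.1.1)
    (hs.comp fst).left
    (polyTime_sameId snd.left fst.right.left.left).not

theorem polyTime_select {L : α → List EdgeRecord} (hL : PolyTime L) :
    PolyTime fun a => select (L a) :=
  right (foldl_of_le (f := fun _ s _ => selectStep s) (b := fun a => (core (L a), [])) hL
    (polyTime_selectStep snd.left) ((polyTime_core hL).pair (const []))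
    fun _ s _ => sz_selectStep_le s)

theorem polyTime_relabel {u v x : α → ℕ} (hu : PolyTime u) (hv : PolyTime v) (hx : PolyTime x) :
    PolyTime fun a => relabel (u a) (v a) (x a) :=
  ite (beq hx (ite (le hu hv) hv hu)) (ite (le hu hv) hu hv) hx

/-- The larger of the two labels is the one that is replaced. With unary labels this keeps records
from growing under contraction, as `foldl_of_le` requires. -/
theorem relabel_le (u v x : ℕ) : relabel u v x ≤ x := by
  unfold relabel
  by_cases h : u ≤ v <;> simp [h] <;> split_ifs <;> omega

theorem polyTime_contract {r s : α → EdgeRecord} (hr : PolyTime r) (hs : PolyTime s) :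
    PolyTime fun a => contract (r a) (s a) :=
  hs.left.pair (((polyTime_relabel hr.right.left.left hr.right.left.right
    hs.right.left.left).pair (polyTime_relabel hr.right.left.left hr.right.left.right
    hs.right.left.right)).pair hs.right.right)

theorem sz_map_le {β : Type*} [Enc β] {f : β → β} (hf : ∀ b, sz (f b) ≤ sz b) (l : List β) :
    sz (l.map f) ≤ sz l := by
  induction l with
  | nil => exact le_rfl
  | cons b l ih =>
    have := hf b
    simp only [List.map_cons, sz_cons]
    omega

theorem sz_contract_le (r s : EdgeRecord) : sz (contract r s) ≤ sz s := by
  have h1 := relabel_le r.2.1.1 r.2.1.2 s.2.1.1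
  have h2 := relabel_le r.2.1.1 r.2.1.2 s.2.1.2
  simp only [contract, sz_prod, sz_nat]
  omega

theorem sz_treeStep_le (s : List EdgeRecord × List (ℕ × Bool)) : sz (treeStep s) ≤ sz s := by
  obtain ⟨L, T⟩ := s
  cases L with
  | nil => exact le_rfl
  | cons r L =>
    have h := sz_map_le (sz_contract_le r) L
    have h1 : sz r = sz r.1 + sz r.2 + 1 := rfl
    simp only [treeStep]
    split_ifs
    · rw [sz_prod, sz_prod (r :: L, T), sz_cons]
      dsimp only
      omega
    · rw [sz_prod, sz_prod (r :: L, T), sz_cons, sz_cons]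
      dsimp only
      omega

theorem polyTime_treeStep {s : α → List EdgeRecord × List (ℕ × Bool)} (hs : PolyTime s) :
    PolyTime fun a => treeStep (s a) := by
  have h := list_cases (l := fun a => (s a).1) (f := s)
    (g := fun a r L => if r.2.1.1 == r.2.1.2 then (L, (s a).2)
      else (L.map (contract r), r.1 :: (s a).2)) hs.left hs (ite ?_ ?_ ?_)
  · exact h.recode (fun a => a) (fun _ => rfl) fun a => by
      unfold treeStep
      cases (s a).1 <;> rfl
  · exact beq snd.left.right.left.left snd.left.right.left.right
  · exact snd.right.pair (hs.comp fst).right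
  · exact (map (f := fun x s => contract x.2.1 s) snd.right
      (polyTime_contract fst.right.left snd)).pair
      (cons snd.left.left (hs.comp fst).right)

theorem polyTime_forest {L : α → List EdgeRecord} (hL : PolyTime L) :
    PolyTime fun a => forest (L a) :=
  right (foldl_of_le (f := fun _ s _ => treeStep s) (b := fun a => (L a, [])) hL
    (polyTime_treeStep snd.left) (hL.pair (const [])) fun _ s _ => sz_treeStep_le s)

theorem polyTime_output {L : α → List EdgeRecord} (hL : PolyTime L) :
    PolyTime fun a => output (L a) := by
  unfold output
  exact map (f := fun a r => (forest (select (L a))).any fun i => sameId i r.1) hL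
    (any (p := fun (x : α × EdgeRecord) i => sameId i x.2.1)
      (polyTime_forest (polyTime_select (hL.comp fst)))
      (polyTime_sameId snd fst.right.left))

theorem polyTime_record : PolyTime record :=
  (fst.right.left.pair fst.right.right.left).pair
    ((fst.left.pair snd.left).pair
      (fst.right.right.right.left.pair snd.right.right.right.left))

theorem polyTime_algorithm : PolyTime algorithm :=
  polyTime_output (map (f := fun _ x => record x) snd.right.right.left
    (polyTime_record.comp snd))

end PolyTime

end ThinTree

/-! Degrees, cycles and even sets of edges in multigraphs. -/

namespace MultiGraph

variable {V E : Type*}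

@[simp] theorem rev_fst (d : E × Bool) : (rev d).1 = d.1 := rfl

@[simp] theorem rev_rev (d : E × Bool) : rev (rev d) = d := by simp [rev]

theorem rev_ne (d : E × Bool) : rev d ≠ d := by
  obtain ⟨e, b⟩ := d
  cases b <;> simp [rev]

theorem eq_or_eq_rev {d d' : E × Bool} (h : d.1 = d'.1) : d' = d ∨ d' = rev d := by
  obtain ⟨e, b⟩ := d
  obtain ⟨e', b'⟩ := d'
  obtain rfl : e = e' := h
  cases b <;> cases b' <;> simp [rev]

theorem rev_injective : Function.Injective (rev : E × Bool → E × Bool) :=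
  Function.LeftInverse.injective rev_rev

@[simp] theorem tail_rev (G : MultiGraph V E) (d : E × Bool) : G.tail (rev d) = G.head d := rfl

@[simp] theorem head_rev (G : MultiGraph V E) (d : E × Bool) : G.head (rev d) = G.tail d := by
  simp [head]

/-- The dart `d'` can follow the dart `d` in a walk without immediate reversals. -/
def Follows (G : MultiGraph V E) (d d' : E × Bool) : Prop := G.head d = G.tail d' ∧ d' ≠ rev d

theorem Follows.rev {G : MultiGraph V E} {d d' : E × Bool} (h : G.Follows d d') :
    G.Follows (rev d') (rev d) := by
  refine ⟨by simp [h.1], fun h' => h.2 ?_⟩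
  rw [h', rev_rev]

/-- A walk without immediate reversals that returns to its start contains a cycle. -/
theorem exists_isCycle_of_follows (G : MultiGraph V E) (s : ℕ → E × Bool) (n : ℕ)
    (hs : ∀ i, i + 1 < n → G.Follows (s i) (s (i + 1))) {i j : ℕ} (hij : i ≤ j) (hj : j < n)
    (h : G.head (s j) = G.tail (s i)) :
    ∃ i l, i + l ≤ n ∧ G.IsCycle l fun k : Fin l => s (i + k) := by
  classical
  -- A shortest closed stretch, with `m + 1` darts, repeats no vertex, since a repetition would cut
  -- off a shorter one.
  have hex : ∃ m i, i + m < n ∧ G.head (s (i + m)) = G.tail (s i) :=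
    ⟨j - i, i, by omega, by rwa [Nat.add_sub_cancel' hij]⟩
  obtain ⟨i, hin, hi⟩ := Nat.find_spec hex
  have hmin := fun m' (hm' : m' < Nat.find hex) => Nat.find_min hex hm'
  set m := Nat.find hex
  have hinj : ∀ a b, a < b → b ≤ m → G.tail (s (i + a)) ≠ G.tail (s (i + b)) := by
    intro a b hab hbm hE
    refine hmin (b - 1 - a) (by omega) ⟨i + a, by omega, ?_⟩
    have := (hs (i + b - 1) (by omega)).1
    rw [show i + a + (b - 1 - a) = i + b - 1 by omega, this,
      show i + b - 1 + 1 = i + b by omega, hE]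
  have hinj' : ∀ a b, a < b → b ≤ m → (s (i + a)).1 ≠ (s (i + b)).1 := by
    intro a b hab hbm hE
    rcases eq_or_eq_rev hE with h1 | h1
    · exact hinj a b hab hbm (by rw [h1])
    -- If an edge returned in the opposite direction, the vertex after its first passage would
    -- repeat, unless the two passages are adjacent, which is an immediate reversal.
    · have h2 := hs (i + a) (by omega)
      have h3 : a + 1 = b := by
        by_contra hne
        refine hinj (a + 1) b (by omega) hbm ?_
        rw [h1, tail_rev, h2.1]
        rfl
      rw [← h3] at h1
      exact h2.2 h1
  refine ⟨i, m + 1, by omega, Nat.succ_pos m, fun k => ?_, fun a b hab => ?_, fun a b hab => ?_⟩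
  · rcases Fin.eq_castSucc_or_eq_last k with ⟨k, rfl⟩ | rfl
    · have h2 := hs (i + k) (by omega)
      rw [finRotate_of_lt (by simp)]
      simpa [add_assoc] using h2.1
    · rw [finRotate_last]
      simpa using hi
  · by_contra hne
    rcases lt_or_gt_of_ne (fun h => hne (Fin.ext h) : (a : ℕ) ≠ b) with h | h
    · exact hinj a b h (by omega) hab
    · exact hinj b a h (by omega) hab.symm
  · by_contra hne
    rcases lt_or_gt_of_ne (fun h => hne (Fin.ext h) : (a : ℕ) ≠ b) with h | h
    · exact hinj' a b h (by omega) hab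
    · exact hinj' b a h (by omega) hab.symm

/-- The closed walk along a cycle, repeated periodically. -/
def IsCycle.walk {G : MultiGraph V E} {l : ℕ} {c : Fin l → E × Bool} (hc : G.IsCycle l c) (i : ℕ) :
    E × Bool := c ⟨i % l, Nat.mod_lt _ hc.pos⟩

namespace IsCycle

variable {G : MultiGraph V E} {l : ℕ} {c : Fin l → E × Bool} (hc : G.IsCycle l c)

theorem walk_congr {i j : ℕ} (h : i % l = j % l) : hc.walk i = hc.walk j := by
  simp only [walk, h]

theorem mod_eq_of_walk_fst_eq {i j : ℕ} (h : (hc.walk i).1 = (hc.walk j).1) : i % l = j % l :=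
  Fin.mk.inj (hc.edge_injective h)

theorem walk_coe (k : Fin l) : hc.walk k = c k := by
  simp only [walk, Nat.mod_eq_of_lt k.2]

theorem follows (i : ℕ) : G.Follows (hc.walk i) (hc.walk (i + 1)) := by
  have hmod : (i + 1) % l = (finRotate l ⟨i % l, Nat.mod_lt _ hc.pos⟩ : Fin l) := by
    obtain ⟨m, rfl⟩ : ∃ m, l = m + 1 := ⟨l - 1, by have := hc.pos; omega⟩
    rw [finRotate_apply, Fin.val_add]
    simp
  have h1 : G.head (hc.walk i) = G.tail (hc.walk (i + 1)) := by
    rw [walk, hc.closed]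
    simp only [walk]
    congr 2
    exact Fin.ext hmod.symm
  refine ⟨h1, fun h => ?_⟩
  have h2 := hc.mod_eq_of_walk_fst_eq (i := i + 1) (j := i) (by rw [h, rev_fst])
  rw [hc.walk_congr h2] at h
  exact rev_ne _ h.symm

end IsCycle

/-- An infinite walk without immediate reversals contains a cycle. -/
theorem exists_isCycle_of_walk [Finite E] {D : MultiGraph V E} {s : ℕ → E × Bool}
    (hs : ∀ i, D.Follows (s i) (s (i + 1))) :
    ∃ i l, D.IsCycle l fun k : Fin l => s (i + k) := by
  obtain ⟨i, j, hne, hij⟩ := Finite.exists_ne_map_eq_of_infinite s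
  wlog hlt : i < j generalizing i j
  · exact this j i hne.symm hij.symm (by omega)
  obtain ⟨a, l, -, h⟩ := D.exists_isCycle_of_follows s (j + 1) (fun i _ => hs i)
    (i := i) (j := j - 1) (by omega) (by omega) (by
      rw [(hs (j - 1)).1, Nat.sub_add_cancel (by omega), hij])
  exact ⟨a, l, h⟩

/-! ### Degrees, even edge sets and their decomposition into cycles -/

section Degree

variable [Fintype E] [DecidableEq E] [DecidableEq V]

/-- The darts of edges in `H` that start at `f`. -/
def dartsAt (D : MultiGraph V E) (H : Finset E) (f : V) : Finset (E × Bool) :=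
  Finset.univ.filter fun d => d.1 ∈ H ∧ D.tail d = f

/-- The degree of `f` in the subgraph with edge set `H`. -/
def deg (D : MultiGraph V E) (H : Finset E) (f : V) : ℕ := (D.dartsAt H f).card

/-- All degrees in the subgraph with edge set `X` are even. -/
def IsEven (D : MultiGraph V E) (X : Finset E) : Prop := ∀ f, Even (D.deg X f)

variable {D : MultiGraph V E} {H H' X : Finset E}

@[simp] theorem mem_dartsAt {f : V} {d : E × Bool} :
    d ∈ D.dartsAt H f ↔ d.1 ∈ H ∧ D.tail d = f := by simp [dartsAt]

theorem dartsAt_mono (h : H ⊆ H') (f : V) : D.dartsAt H f ⊆ D.dartsAt H' f := fun d hd => by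
  rw [mem_dartsAt] at hd ⊢
  exact ⟨h hd.1, hd.2⟩

theorem deg_mono (h : H ⊆ H') (f : V) : D.deg H f ≤ D.deg H' f :=
  Finset.card_le_card (dartsAt_mono h f)

theorem deg_pos {d : E × Bool} (hd : d.1 ∈ H) : 0 < D.deg H (D.tail d) :=
  Finset.card_pos.2 ⟨d, by simp [hd]⟩

theorem two_le_deg {d d' : E × Bool} (hne : d ≠ d') (hd : d.1 ∈ H) (hd' : d'.1 ∈ H)
    (ht : D.tail d = D.tail d') : 2 ≤ D.deg H (D.tail d) :=
  Finset.one_lt_card.2 ⟨d, by simp [hd], d', by simp [hd', ht], hne⟩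

theorem Follows.two_le_deg {d d' : E × Bool} (h : D.Follows d d') (hd : d.1 ∈ H) (hd' : d'.1 ∈ H) :
    2 ≤ D.deg H (D.tail d') :=
  MultiGraph.two_le_deg h.2 hd' (d' := MultiGraph.rev d) (by simpa) (by simp [h.1])

theorem exists_follows {d : E × Bool} (h : 2 ≤ D.deg H (D.head d)) :
    ∃ d', d'.1 ∈ H ∧ D.Follows d d' := by
  obtain ⟨d', hd', hne⟩ := Finset.exists_mem_ne h (rev d)
  rw [mem_dartsAt] at hd'
  exact ⟨d', hd'.1, hd'.2.symm, hne⟩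

/-- Walks without immediate reversals can be continued where degrees are at least two. -/
theorem exists_walk (h : ∀ d : E × Bool, d.1 ∈ H → 2 ≤ D.deg H (D.head d)) {d₀ : E × Bool}
    (h₀ : d₀.1 ∈ H) : ∃ s : ℕ → E × Bool, s 0 = d₀ ∧ (∀ i, (s i).1 ∈ H) ∧
      ∀ i, D.Follows (s i) (s (i + 1)) := by
  choose! next hn₁ hn₂ using fun d (hd : d.1 ∈ H) => exists_follows (h d hd)
  have hmem : ∀ i, ((next^[i]) d₀).1 ∈ H := fun i => by
    induction i with
    | zero => exact h₀
    | succ i ih =>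
      rw [Function.iterate_succ_apply']
      exact hn₁ _ ih
  refine ⟨fun i => (next^[i]) d₀, rfl, hmem, fun i => ?_⟩
  beta_reduce
  rw [Function.iterate_succ_apply']
  exact hn₂ _ (hmem i)

/-- A nonempty set of edges without vertices of degree one contains a cycle. -/
theorem exists_isCycle_of_deg_ne_one (hX : ∀ f, D.deg X f ≠ 1) (hne : X.Nonempty) :
    ∃ l, ∃ c : Fin l → E × Bool, D.IsCycle l c ∧ ∀ k, (c k).1 ∈ X := by
  obtain ⟨e, he⟩ := hne
  obtain ⟨s, -, hs, hs'⟩ := exists_walk (D := D) (H := X) (fun d hd => by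
    have h1 : 0 < D.deg X (D.head d) := D.deg_pos (d := rev d) (by simpa)
    have h2 := hX (D.head d)
    omega) (d₀ := (e, true)) he
  obtain ⟨i, l, h⟩ := exists_isCycle_of_walk hs'
  exact ⟨l, _, h, fun k => hs _⟩

theorem IsEven.deg_ne_one (hX : D.IsEven X) (f : V) : D.deg X f ≠ 1 := fun h => by
  have := hX f
  rw [h] at this
  exact Nat.not_even_one this

theorem IsEven.two_le_deg (hX : D.IsEven X) {d : E × Bool} (hd : d.1 ∈ X) :
    2 ≤ D.deg X (D.tail d) := by
  have h1 := D.deg_pos hd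
  have h2 := hX.deg_ne_one (D.tail d)
  omega

theorem deg_sdiff (h : H ⊆ X) (f : V) : D.deg (X \ H) f + D.deg H f = D.deg X f := by
  unfold deg
  rw [← Finset.card_union_of_disjoint]
  · congr 1
    ext d
    simp only [Finset.mem_union, mem_dartsAt, Finset.mem_sdiff]
    constructor
    · rintro (⟨⟨h1, -⟩, h2⟩ | ⟨h1, h2⟩)
      · exact ⟨h1, h2⟩
      · exact ⟨h h1, h2⟩
    · rintro ⟨h1, h2⟩
      by_cases h3 : d.1 ∈ H
      · exact Or.inr ⟨h3, h2⟩
      · exact Or.inl ⟨⟨h1, h3⟩, h2⟩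
  · rw [Finset.disjoint_left]
    intro d hd hd'
    rw [mem_dartsAt, Finset.mem_sdiff] at hd
    exact hd.1.2 (mem_dartsAt.1 hd').1

/-- The darts at `f` are the cycle darts that start there and the reverses of those that end there;
rotating the cycle matches the two kinds. -/
theorem IsCycle.isEven {l : ℕ} {c : Fin l → E × Bool} (hc : D.IsCycle l c) :
    D.IsEven (Finset.univ.image fun k => (c k).1) := by
  intro f
  have hinj : Function.Injective c := fun a b h => hc.edge_injective (by simp [h])
  set A := Finset.univ.filter fun k => D.tail (c k) = f
  set B := Finset.univ.filter fun k => D.head (c k) = f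
  have hAB : B.card = A.card := by
    refine Finset.card_bij (fun k _ => finRotate l k) (fun k hk => ?_)
      (fun a _ b _ h => (finRotate l).injective h) fun k hk => ?_
    · simp only [A, B, Finset.mem_filter, Finset.mem_univ, true_and] at hk ⊢
      rw [← hk, hc.closed]
    · simp only [A, B, Finset.mem_filter, Finset.mem_univ, true_and] at hk ⊢
      exact ⟨(finRotate l).symm k, by rw [hc.closed, Equiv.apply_symm_apply, hk],
        (finRotate l).apply_symm_apply k⟩
  have hU : D.dartsAt (Finset.univ.image fun k => (c k).1) f =
      A.image c ∪ B.image fun k => rev (c k) := by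
    ext d
    simp only [mem_dartsAt, Finset.mem_image, Finset.mem_univ, true_and, Finset.mem_union, A, B,
      Finset.mem_filter]
    constructor
    · rintro ⟨⟨k, hk⟩, hd⟩
      rcases eq_or_eq_rev hk with h | h
      · exact Or.inl ⟨k, by rw [← h, hd], h.symm⟩
      · exact Or.inr ⟨k, by rw [← tail_rev, ← h, hd], h.symm⟩
    · rintro (⟨k, hk, rfl⟩ | ⟨k, hk, rfl⟩)
      · exact ⟨⟨k, rfl⟩, hk⟩
      · exact ⟨⟨k, rfl⟩, hk⟩
  have hdis : Disjoint (A.image c) (B.image fun k => rev (c k)) := by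
    rw [Finset.disjoint_left]
    intro d hd hd'
    obtain ⟨a, -, rfl⟩ := Finset.mem_image.1 hd
    obtain ⟨b, -, hb⟩ := Finset.mem_image.1 hd'
    have : b = a := hc.edge_injective (show (c b).1 = (c a).1 by rw [← rev_fst (c b), hb])
    rw [this] at hb
    exact rev_ne _ hb
  rw [deg, hU, Finset.card_union_of_disjoint hdis, Finset.card_image_of_injective _ hinj,
    Finset.card_image_of_injective _ (show Function.Injective fun k => rev (c k) from
      rev_injective.comp hinj), hAB]
  exact ⟨_, rfl⟩

/-- A linear inequality between numbers of edges holds for even sets if it holds for cycles. -/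
theorem IsEven.card_mul_le (hX : D.IsEven X) (F : Finset E) (a b : ℕ)
    (h : ∀ l (c : Fin l → E × Bool), D.IsCycle l c →
      (F ∩ Finset.univ.image fun k => (c k).1).card * a ≤ b * l) :
    (F ∩ X).card * a ≤ b * X.card := by
  induction hn : X.card using Nat.strong_induction_on generalizing X with
  | _ n ih =>
    subst hn
    rcases X.eq_empty_or_nonempty with rfl | hne
    · simp
    obtain ⟨l, c, hc, hcX⟩ := exists_isCycle_of_deg_ne_one hX.deg_ne_one hne
    -- Removing a cycle leaves an even set, so the inequalities for the cycles of a decomposition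
    -- add up.
    set C := Finset.univ.image fun k => (c k).1 with hC
    have hCX : C ⊆ X := Finset.image_subset_iff.2 fun k _ => hcX k
    have hCl : C.card = l := by
      rw [hC, Finset.card_image_of_injective _ hc.edge_injective, Finset.card_fin]
    have hev : D.IsEven (X \ C) := fun f => by
      have h1 := deg_sdiff (D := D) hCX f
      have h2 := hX f
      rw [← h1, Nat.even_add] at h2
      exact h2.2 (hc.isEven f)
    have hcard : (X \ C).card + C.card = X.card := Finset.card_sdiff_add_card_eq_card hCX
    have := hc.pos
    have h1 := ih _ (by omega) hev rfl
    have h2 := h l c hc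
    have h3 : (F ∩ X).card ≤ (F ∩ (X \ C)).card + (F ∩ C).card := by
      rw [← Finset.sdiff_union_of_subset hCX, Finset.inter_union_distrib_left]
      refine (Finset.card_union_le _ _).trans ?_
      rw [Finset.sdiff_union_of_subset hCX]
    calc (F ∩ X).card * a ≤ ((F ∩ (X \ C)).card + (F ∩ C).card) * a := Nat.mul_le_mul_right _ h3
      _ ≤ b * (X \ C).card + b * l := by rw [add_mul]; exact Nat.add_le_add h1 h2
      _ = b * X.card := by rw [← mul_add, ← hcard, hCl]

end Degree

end MultiGraph

/-! Selection of edges in the middle of long paths. -/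

namespace MultiGraph

variable {V E : Type*} [Fintype E] [DecidableEq E] [DecidableEq V]

/-- Delete the edges at vertices of degree one. -/
def pruned (D : MultiGraph V E) (H : Finset E) : Finset E :=
  H.filter fun e => D.deg H (D.tail (e, true)) ≠ 1 ∧ D.deg H (D.tail (e, false)) ≠ 1

/-- The edges without an end of degree greater than two. -/
def unbranched (D : MultiGraph V E) (H : Finset E) : Finset E :=
  H.filter fun e => D.deg H (D.tail (e, true)) ≤ 2 ∧ D.deg H (D.tail (e, false)) ≤ 2

/-- The edges at distance at least `d` from the vertices of degree greater than two, in a graph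
without vertices of degree one. -/
def deep (D : MultiGraph V E) (H : Finset E) : ℕ → Finset E
  | 0 => H
  | d + 1 => D.pruned^[d] (D.unbranched H)

/-- `F` arises from the edge set `H` by repeatedly deleting edges at vertices of degree one and
selecting edges at distance at least `d` from the vertices of degree greater than two. -/
inductive Peel (D : MultiGraph V E) (d : ℕ) : Finset E → Finset E → Prop
  | done : Peel D d ∅ ∅
  | drop {H H' F : Finset E} : H' ⊆ H →
      (∀ e ∈ H, e ∉ H' → ∃ b, D.deg H (D.tail (e, b)) = 1) → Peel D d H' F → Peel D d H F
  | take {H F : Finset E} {e : E} : (∀ f, D.deg H f ≠ 1) → e ∈ H → e ∈ D.deep H d →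
      Peel D d (H.erase e) F → Peel D d H (insert e F)

variable {D : MultiGraph V E} {H F X : Finset E} {d : ℕ}

theorem pruned_subset : D.pruned H ⊆ H := Finset.filter_subset _ _

theorem mem_pruned {d : E × Bool} :
    d.1 ∈ D.pruned H ↔ d.1 ∈ H ∧ D.deg H (D.tail d) ≠ 1 ∧ D.deg H (D.head d) ≠ 1 := by
  obtain ⟨e, b⟩ := d
  cases b
  · simp only [pruned, Finset.mem_filter, head, rev, Bool.not_false]
    tauto
  · simp only [pruned, Finset.mem_filter, head, rev, Bool.not_true]

theorem mem_unbranched {d : E × Bool} :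
    d.1 ∈ D.unbranched H ↔ d.1 ∈ H ∧ D.deg H (D.tail d) ≤ 2 ∧ D.deg H (D.head d) ≤ 2 := by
  obtain ⟨e, b⟩ := d
  cases b
  · simp only [unbranched, Finset.mem_filter, head, rev, Bool.not_false]
    tauto
  · simp only [unbranched, Finset.mem_filter, head, rev, Bool.not_true]

theorem deep_succ_succ (k : ℕ) : D.deep H (k + 2) = D.pruned (D.deep H (k + 1)) :=
  Function.iterate_succ_apply' _ _ _

theorem deep_succ_subset (k : ℕ) : D.deep H (k + 1) ⊆ D.unbranched H := by
  induction k with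
  | zero => exact Finset.Subset.refl _
  | succ k ih =>
    rw [deep_succ_succ]
    exact pruned_subset.trans ih

theorem deep_subset (k : ℕ) : D.deep H k ⊆ H := by
  cases k with
  | zero => exact Finset.Subset.refl _
  | succ k => exact (deep_succ_subset k).trans (Finset.filter_subset _ _)

/-- One step along a walk decreases the distance to the vertices of large degree by at most one. -/
theorem mem_deep_of_follows {x y : E × Bool} {k : ℕ} (hx : x.1 ∈ D.deep H (k + 1))
    (hy : y.1 ∈ H) (h : D.Follows x y) : y.1 ∈ D.deep H k ∧ D.deg H (D.tail y) ≤ 2 := by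
  have h2 : D.deg H (D.tail y) ≤ 2 := by
    rw [← h.1]
    exact (mem_unbranched.1 (deep_succ_subset k hx)).2.2
  refine ⟨?_, h2⟩
  cases k with
  | zero => exact hy
  | succ k =>
    rw [deep_succ_succ, mem_pruned, h.1] at hx
    have h3 : 0 < D.deg (D.deep H (k + 1)) (D.tail y) := by
      rw [← h.1]
      exact deg_pos (d := rev x) (by simpa using hx.1)
    -- At the common vertex the degree in the deep set is positive and, as `x` survived pruning, not
    -- one; the degree in `H` is at most two. So all darts of `H` there are deep.
    have h4 : D.dartsAt (D.deep H (k + 1)) (D.tail y) = D.dartsAt H (D.tail y) :=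
      Finset.eq_of_subset_of_card_le (dartsAt_mono (deep_subset _) _) (by
        have : (D.dartsAt H (D.tail y)).card ≤ 2 := h2
        have h5 : D.deg (D.deep H (k + 1)) (D.tail y) ≠ 1 := hx.2.2
        unfold deg at h3 h5
        omega)
    have h5 : y ∈ D.dartsAt H (D.tail y) := by simp [hy]
    rw [← h4, mem_dartsAt] at h5
    exact h5.1

/-- `K` is the edge set present at the first selection, or empty if nothing is selected: everything
selected lies in it, and selections happen only when no vertex has degree one. -/
theorem Peel.exists_core (h : D.Peel d H F) : ∃ K ⊆ H, F ⊆ K ∧ ∀ f, D.deg K f ≠ 1 := by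
  induction h with
  | done => exact ⟨∅, Finset.Subset.refl _, Finset.Subset.refl _, fun f => by simp [deg, dartsAt]⟩
  | drop hs _ _ ih =>
    obtain ⟨K, h1, h2, h3⟩ := ih
    exact ⟨K, h1.trans hs, h2, h3⟩
  | take h1 h2 _ _ ih =>
    obtain ⟨K, h3, h4, -⟩ := ih
    exact ⟨_, Finset.Subset.refl _, Finset.insert_subset h2
      ((h4.trans h3).trans (Finset.erase_subset _ _)), h1⟩

theorem Peel.subset (h : D.Peel d H F) : F ⊆ H := by
  obtain ⟨K, h1, h2, -⟩ := h.exists_core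
  exact h2.trans h1

/-- The selected edges meet all nonempty even sets. -/
theorem Peel.inter_nonempty (h : D.Peel d H F) (hX : D.IsEven X) (hne : X.Nonempty)
    (hXH : X ⊆ H) : (F ∩ X).Nonempty := by
  induction h with
  | done => exact absurd (Finset.subset_empty.1 hXH) hne.ne_empty
  | @drop H H' F hs hd _ ih =>
    refine ih fun e he => ?_
    by_contra hne
    obtain ⟨b, hb⟩ := hd e (hXH he) hne
    -- Edges of an even set have both ends of degree at least two, so dropping never touches the
    -- set.
    have h1 := hX.two_le_deg (d := (e, b)) he
    have h2 := deg_mono (D := D) hXH (D.tail (e, b))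
    omega
  | @take H F e _ _ _ _ ih =>
    by_cases heX : e ∈ X
    · exact ⟨e, by simp [heX]⟩
    · obtain ⟨x, hx⟩ := ih fun y hy => Finset.mem_erase.2 ⟨fun h => heX (h ▸ hy), hXH hy⟩
      rw [Finset.mem_inter] at hx
      exact ⟨x, by simp [hx.1, hx.2]⟩

theorem dartsAt_eq_of_deg_le {H' : Finset E} (h : H' ⊆ H) {f : V}
    (hle : D.deg H f ≤ D.deg H' f) : D.dartsAt H' f = D.dartsAt H f :=
  Finset.eq_of_subset_of_card_le (dartsAt_mono h f) hle

/-- After an edge was selected, no edge near it is selected. -/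
theorem Peel.not_mem_of_near {e : E} (h : D.Peel d (H.erase e) F) (he : e ∈ D.deep H d)
    {s : ℕ → E × Bool} {n : ℕ} (h₀ : (s 0).1 = e) (hs : ∀ i < n, D.Follows (s i) (s (i + 1)))
    (hH : ∀ i ≤ n, (s i).1 ∈ H) (hn : n ≤ d) : (s n).1 ∉ F := by
  obtain ⟨K, hKH, hFK, hK⟩ := h.exists_core
  suffices h : ∀ j ≤ n, (s j).1 ∈ D.deep H (d - j) ∧ (s j).1 ∉ K from
    fun hF => (h n le_rfl).2 (hFK hF)
  intro j hj
  induction j with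
  | zero => exact ⟨by rwa [h₀], fun hK' => (Finset.mem_erase.1 (hKH hK')).1 h₀⟩
  | succ j ih =>
    obtain ⟨ih1, ih2⟩ := ih (by omega)
    obtain ⟨h1, h2⟩ := mem_deep_of_follows (k := d - (j + 1))
      (by rwa [show d - (j + 1) + 1 = d - j by omega]) (hH (j + 1) hj) (hs j (by omega))
    refine ⟨h1, fun h3 => ih2 ?_⟩
    -- Between the two edges lies a vertex of degree at most two in `H`. As `K` has no vertex of
    -- degree one, it contains both of them or neither, so absence from `K` propagates along the
    -- walk.
    have h4 := D.deg_pos h3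
    have h5 := hK (D.tail (s (j + 1)))
    have h6 := dartsAt_eq_of_deg_le (D := D) (hKH.trans (Finset.erase_subset _ _))
      (f := D.tail (s (j + 1))) (by omega)
    have h7 : rev (s j) ∈ D.dartsAt H (D.tail (s (j + 1))) := by
      rw [mem_dartsAt]
      exact ⟨hH j (by omega), by simp [(hs j (by omega)).1]⟩
    rw [← h6, mem_dartsAt] at h7
    exact h7.1

/-- Selected edges that are consecutive along a walk are far apart. -/
theorem Peel.lt_of_consecutive (h : D.Peel d H F) {s : ℕ → E × Bool} {n : ℕ}
    (hs : ∀ i < n, D.Follows (s i) (s (i + 1))) (hH : ∀ i ≤ n, (s i).1 ∈ H)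
    (h₀ : (s 0).1 ∈ F) (hn : (s n).1 ∈ F) (hne : (s 0).1 ≠ (s n).1)
    (hF : ∀ i, 0 < i → i < n → (s i).1 ∉ F) : d < n := by
  induction h with
  | done => simp at h₀
  | @drop H H' F hsub hd hp ih =>
    refine ih (fun i hi => ?_) h₀ hn hF
    rcases Nat.eq_zero_or_pos i with rfl | hpos
    · exact hp.subset h₀
    rcases hi.eq_or_lt with rfl | hlt
    · exact hp.subset hn
    by_contra hne'
    obtain ⟨b, hb⟩ := hd _ (hH i hi) hne'
    -- Both ends of an interior edge of the walk also meet a neighbouring edge of the walk, so they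
    -- have degree at least two and the edge is not dropped.
    have h1 : 2 ≤ D.deg H (D.tail (s i)) := by
      have h2 := hs (i - 1) (by omega)
      rw [Nat.sub_add_cancel hpos] at h2
      exact h2.two_le_deg (hH _ (by omega)) (hH _ hi)
    have h2 : 2 ≤ D.deg H (D.tail (rev (s i))) :=
      (hs i hlt).rev.two_le_deg (by simpa using hH (i + 1) hlt) (by simpa using hH i hi)
    rcases eq_or_eq_rev (d := s i) (d' := ((s i).1, b)) rfl with h3 | h3 <;>
      rw [h3] at hb <;> omega
  | @take H F e hdeg he hdeep hp ih =>
    by_contra! hnd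
    have hF' : ∀ x, x ∈ insert e F → x ≠ e → x ∈ F := fun x hx hxe =>
      (Finset.mem_insert.1 hx).resolve_left hxe
    by_cases h0 : (s 0).1 = e
    · exact hp.not_mem_of_near hdeep h0 hs hH hnd (hF' _ hn fun h => hne (h0.trans h.symm))
    by_cases h1 : (s n).1 = e
    -- If the last edge is the one just taken, the walk is read backwards.
    · refine hp.not_mem_of_near hdeep (s := fun i => rev (s (n - i))) (n := n) (by simpa using h1)
        (fun i hi => ?_) (fun i _ => by simpa using hH (n - i) (by omega)) hnd ?_
      · have := (hs (n - (i + 1)) (by omega)).rev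
        rwa [show n - (i + 1) + 1 = n - i by omega] at this
      · simpa using hF' _ h₀ h0
    -- If neither end is the edge taken, the walk avoids that edge altogether, because no interior
    -- edge is selected.
    · refine absurd (ih (fun i hi => Finset.mem_erase.2 ⟨fun h => ?_, hH i hi⟩) (hF' _ h₀ h0)
        (hF' _ hn h1) fun i hi hin h => hF i hi hin (Finset.mem_insert_of_mem h)) (by omega)
      rcases Nat.eq_zero_or_pos i with rfl | hpos
      · exact h0 h
      rcases hi.eq_or_lt with rfl | hlt
      · exact h1 h
      · exact hF i hpos hlt (by simp [h])

/-- A cycle with several selected edges is long. -/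
theorem Peel.card_inter_cycle (h : D.Peel d Finset.univ F) {l : ℕ} {c : Fin l → E × Bool}
    (hc : D.IsCycle l c) (h2 : 1 < (F ∩ Finset.univ.image fun k => (c k).1).card) :
    (F ∩ Finset.univ.image fun k => (c k).1).card * (d + 1) ≤ l := by
  have hl := hc.pos
  set I := (Finset.range l).filter fun i => (hc.walk i).1 ∈ F with hI
  have hcard : (F ∩ Finset.univ.image fun k => (c k).1) = I.image fun i => (hc.walk i).1 := by
    ext e
    simp only [Finset.mem_inter, Finset.mem_image, Finset.mem_univ, true_and, hI,
      Finset.mem_filter, Finset.mem_range]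
    constructor
    · rintro ⟨he, k, rfl⟩
      exact ⟨k, ⟨k.2, by rwa [hc.walk_coe]⟩, by rw [hc.walk_coe]⟩
    · rintro ⟨i, ⟨-, hi⟩, rfl⟩
      exact ⟨hi, _, rfl⟩
  have hinj : Set.InjOn (fun i => (hc.walk i).1) I := fun i hi j hj hij => by
    have := hc.mod_eq_of_walk_fst_eq hij
    simp only [hI, Finset.mem_coe, Finset.mem_filter, Finset.mem_range] at hi hj
    rwa [Nat.mod_eq_of_lt hi.1, Nat.mod_eq_of_lt hj.1] at this
  rw [hcard, Finset.card_image_of_injOn hinj] at h2 ⊢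
  have hgap : ∀ i t, (hc.walk i).1 ∈ F → 0 < t → t ≤ d → (hc.walk (i + t)).1 ∉ F := by
    intro i t hi ht htd hit
    have hex : ∃ t, 0 < t ∧ (hc.walk (i + t)).1 ∈ F := ⟨t, ht, hit⟩
    obtain ⟨h3, h4⟩ := Nat.find_spec hex
    have hmin : ∀ u, 0 < u → u < Nat.find hex → (hc.walk (i + u)).1 ∉ F :=
      fun u hu hlt hF => Nat.find_min hex hlt ⟨hu, hF⟩
    have hle : Nat.find hex ≤ t := Nat.find_min' hex ⟨ht, hit⟩
    set u := Nat.find hex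
    by_cases hE : (hc.walk i).1 = (hc.walk (i + u)).1
    -- If the next selected edge were the starting edge itself, the walk would have gone around the
    -- whole cycle and passed a second selected edge.
    · have hmod : (i + u) % l = (i + 0) % l := (hc.mod_eq_of_walk_fst_eq hE).symm
      have hdvd : u % l = 0 % l := Nat.ModEq.add_left_cancel' i hmod
      have hul : l ≤ u := Nat.le_of_dvd h3 (Nat.dvd_of_mod_eq_zero (by simpa using hdvd))
      obtain ⟨j, hj, hji⟩ := Finset.exists_mem_ne h2 (i % l)
      simp only [hI, Finset.mem_filter, Finset.mem_range] at hj
      have hil := Nat.mod_lt i hl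
      have hkey : ∀ v, 0 < v → v < l → (i % l + v) % l = j % l → False := fun v hv hvl hvj => by
        refine hmin v hv (by omega) ?_
        rw [hc.walk_congr (show (i + v) % l = j % l by rw [← hvj, Nat.mod_add_mod])]
        exact hj.2
      rcases lt_or_gt_of_ne hji with hlt | hlt
      · refine hkey (j + l - i % l) (by omega) (by omega) ?_
        rw [show i % l + (j + l - i % l) = j + l by omega, Nat.add_mod_right]
      · exact hkey (j - i % l) (by omega) (by omega) (by
          rw [show i % l + (j - i % l) = j by omega])
    · have := h.lt_of_consecutive (s := fun v => hc.walk (i + v)) (n := u)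
        (fun v _ => hc.follows _) (fun v _ => Finset.mem_univ _) hi h4 hE hmin
      omega
  -- The blocks of `d + 1` positions beginning at the selected edges are disjoint modulo `l`.
  have hinj2 : Set.InjOn (fun x : ℕ × ℕ => (x.1 + x.2) % l)
      ((I ×ˢ Finset.range (d + 1) : Finset (ℕ × ℕ)) : Set (ℕ × ℕ)) := by
    have hkey : ∀ i j i' j', i ∈ I → i' ∈ I → j ≤ j' → j' ≤ d → (i + j) % l = (i' + j') % l →
        (i, j) = (i', j') := by
      intro i j i' j' hi hi' hjj hj' hE
      simp only [hI, Finset.mem_filter, Finset.mem_range] at hi hi'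
      have h3 : i % l = (i' + (j' - j)) % l := by
        refine Nat.ModEq.add_right_cancel' j ?_
        change (i + j) % l = (i' + (j' - j) + j) % l
        rw [hE]
        congr 1
        omega
      rcases hjj.eq_or_lt with rfl | hlt
      · rw [Nat.sub_self, add_zero, Nat.mod_eq_of_lt hi.1, Nat.mod_eq_of_lt hi'.1] at h3
        rw [h3]
      · refine absurd hi.2 ?_
        rw [hc.walk_congr h3]
        exact hgap i' _ hi'.2 (by omega) (by omega)
    rintro ⟨i, j⟩ hx ⟨i', j'⟩ hx' hE
    simp only [Finset.coe_product, Set.mem_prod, Finset.mem_coe, Finset.mem_range] at hx hx'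
    rcases le_total j j' with hle | hle
    · exact hkey i j i' j' hx.1 hx'.1 hle (by omega) hE
    · exact (hkey i' j' i j hx'.1 hx.1 hle (by omega) hE.symm).symm
  have := Finset.card_le_card_of_injOn (t := Finset.range l) _
    (fun x _ => Finset.mem_coe.2 (Finset.mem_range.2 (Nat.mod_lt _ hl))) hinj2
  rwa [Finset.card_product, Finset.card_range, Finset.card_range] at this

end MultiGraph

/-! An Euler inequality for subgraphs of the dual graph. -/

namespace MultiGraph

variable {V W E : Type*}

/-- Vertices are identified if they are joined by an edge outside `H`. -/
def Outside (G : MultiGraph V E) (H : Finset E) (x y : V) : Prop :=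
  ∃ d : E × Bool, d.1 ∉ H ∧ G.tail d = x ∧ G.head d = y

/-- The components of the graph without the edges in `H`. -/
abbrev Pieces (G : MultiGraph V E) (H : Finset E) : Type _ := Quot (G.Outside H)

/-- The coboundary map modulo two. -/
def coboundary (G : MultiGraph V E) : (V → ZMod 2) →ₗ[ZMod 2] (E → ZMod 2) where
  toFun φ e := φ (G.tail (e, true)) + φ (G.tail (e, false))
  map_add' φ ψ := by ext e; simp only [Pi.add_apply]; ring
  map_smul' a φ := by ext e; simp [mul_add]

theorem coboundary_apply_fst (G : MultiGraph V E) (φ : V → ZMod 2) (d : E × Bool) :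
    G.coboundary φ d.1 = φ (G.tail d) + φ (G.head d) := by
  obtain ⟨e, b⟩ := d
  cases b
  · exact add_comm _ _
  · rfl

theorem coboundary_apply_eq_zero (G : MultiGraph V E) {φ : V → ZMod 2} {d : E × Bool} :
    G.coboundary φ d.1 = 0 ↔ φ (G.tail d) = φ (G.head d) := by
  rw [coboundary_apply_fst, CharTwo.add_eq_zero]

theorem Connected.eq_of_forall {α : Type*} {G : MultiGraph V E} (hG : G.Connected) {φ : V → α}
    (h : ∀ d, φ (G.tail d) = φ (G.head d)) (u v : V) : φ u = φ v := by
  induction hG.2 u v with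
  | refl => rfl
  | tail _ hd ih =>
    obtain ⟨d, -, rfl, rfl⟩ := hd
    rw [ih, h]

/-- By connectedness the kernel consists of constant functions. -/
theorem finrank_range_coboundary [Fintype V] {G : MultiGraph V E} (hG : G.Connected) :
    Fintype.card V ≤ Module.finrank (ZMod 2) (LinearMap.range G.coboundary) + 1 := by
  have h1 := G.coboundary.finrank_range_add_finrank_ker
  rw [Module.finrank_pi] at h1
  have h2 : LinearMap.ker G.coboundary ≤ Submodule.span (ZMod 2) {fun _ => 1} := fun φ hφ => by
    obtain ⟨v⟩ := hG.1
    rw [Submodule.mem_span_singleton]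
    refine ⟨φ v, funext fun u => ?_⟩
    have := hG.eq_of_forall (φ := φ) (fun d => G.coboundary_apply_eq_zero.1 (by
      rw [LinearMap.mem_ker.1 hφ]; rfl)) v u
    simp [this]
  have h3 : Module.finrank (ZMod 2) (LinearMap.ker G.coboundary) ≤ 1 :=
    (Submodule.finrank_mono h2).trans ((finrank_span_le_card _).trans (by simp))
  omega

/-! ### The boundary map, cycle spaces and the Euler inequality -/

variable [Fintype E] [DecidableEq W]

/-- The boundary map modulo two. -/
def boundary (D : MultiGraph W E) : (E → ZMod 2) →ₗ[ZMod 2] (W → ZMod 2) where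
  toFun x f := ∑ d : E × Bool, if D.tail d = f then x d.1 else 0
  map_add' x y := by
    ext f
    simp only [Pi.add_apply, ← Finset.sum_add_distrib]
    exact Finset.sum_congr rfl fun d _ => by split_ifs <;> simp
  map_smul' a x := by
    ext f
    simp only [Pi.smul_apply, Finset.smul_sum, RingHom.id_apply]
    exact Finset.sum_congr rfl fun d _ => by split_ifs <;> simp

theorem boundary_apply (D : MultiGraph W E) (x : E → ZMod 2) (f : W) :
    D.boundary x f = ∑ d : E × Bool, if D.tail d = f then x d.1 else 0 := rfl

theorem boundary_single [DecidableEq E] (D : MultiGraph W E) (d : E × Bool) :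
    D.boundary (Pi.single d.1 1) = Pi.single (D.tail d) 1 + Pi.single (D.head d) 1 := by
  have key : ∀ e, D.boundary (Pi.single e 1) =
      Pi.single (D.tail (e, true)) 1 + Pi.single (D.tail (e, false)) 1 := fun e => by
    ext f
    rw [boundary_apply, Fintype.sum_prod_type, Finset.sum_eq_single e]
    · simp only [Fintype.sum_bool, Pi.single_eq_same, Pi.add_apply, Pi.single_apply,
        eq_comm (a := f)]
    · intro e' _ hne
      simp [hne]
    · simp
  obtain ⟨e, b⟩ := d
  cases b
  · exact (key e).trans (add_comm _ _)
  · exact key e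

/-- Following edges from one base vertex, the boundaries of edges together with one unit vector span
everything. -/
theorem finrank_range_boundary [Fintype W] {D : MultiGraph W E} (hD : D.Connected) :
    Fintype.card W ≤ Module.finrank (ZMod 2) (LinearMap.range D.boundary) + 1 := by
  classical
  obtain ⟨f₀⟩ := hD.1
  set S : Submodule (ZMod 2) (W → ZMod 2) := Submodule.span (ZMod 2) {Pi.single f₀ 1} with hS
  have hmem : ∀ f, (Pi.single f 1 : W → ZMod 2) ∈ LinearMap.range D.boundary ⊔ S := fun f => by
    induction hD.2 f₀ f with
    | refl => exact Submodule.mem_sup_right (Submodule.mem_span_singleton_self _)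
    | tail _ hd ih =>
      obtain ⟨d, -, rfl, rfl⟩ := hd
      have h1 : D.boundary (Pi.single d.1 1) ∈ LinearMap.range D.boundary ⊔ S :=
        Submodule.mem_sup_left (LinearMap.mem_range_self _ _)
      rw [boundary_single] at h1
      exact (Submodule.add_mem_iff_right _ ih).1 h1
  have htop : LinearMap.range D.boundary ⊔ S = ⊤ := by
    rw [eq_top_iff]
    intro y _
    rw [pi_eq_sum_univ' y]
    refine Submodule.sum_mem _ fun f _ => Submodule.smul_mem _ _ ?_
    convert hmem f using 1
  have h1 := Submodule.finrank_add_le_finrank_add_finrank (LinearMap.range D.boundary) S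
  rw [htop, finrank_top, Module.finrank_pi] at h1
  have h2 : Module.finrank (ZMod 2) S ≤ 1 :=
    (finrank_span_le_card _).trans (by simp)
  omega

theorem sum_boundary [Fintype W] (D : MultiGraph W E) (x : E → ZMod 2) :
    ∑ f, D.boundary x f = 0 := by
  simp only [boundary_apply]
  rw [Finset.sum_comm]
  simp only [Finset.sum_ite_eq, Finset.mem_univ, if_true]
  rw [Fintype.sum_prod_type]
  refine Finset.sum_eq_zero fun e _ => ?_
  simp only [Fintype.sum_bool]
  exact CharTwo.add_self_eq_zero _

/-- The cycle space of the subgraph with edge set `H`. -/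
def cycleSpace (D : MultiGraph W E) (H : Finset E) : Submodule (ZMod 2) (E → ZMod 2) where
  carrier := {x | (∀ e ∉ H, x e = 0) ∧ D.boundary x = 0}
  zero_mem' := ⟨fun _ _ => rfl, map_zero _⟩
  add_mem' := fun ha hb => ⟨fun e he => by simp [ha.1 e he, hb.1 e he], by
    rw [map_add, ha.2, hb.2, add_zero]⟩
  smul_mem' := fun c x hx => ⟨fun e he => by simp [hx.1 e he], by rw [map_smul, hx.2, smul_zero]⟩

/-- Boundaries of edge sets in `H` live on the vertices met by `H` and have coordinate sum zero. As
`H` is nonempty this costs one dimension, whether or not `H` is connected. -/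
theorem card_le_finrank_cycleSpace [Fintype W] [DecidableEq E] (D : MultiGraph W E) {H : Finset E}
    (hne : H.Nonempty) : H.card + 1 ≤
      Module.finrank (ZMod 2) (D.cycleSpace H) +
        (Finset.univ.filter fun f => D.deg H f ≠ 0).card := by
  set B := Finset.univ.filter fun f => D.deg H f ≠ 0 with hB
  let ext : (H → ZMod 2) →ₗ[ZMod 2] (E → ZMod 2) :=
    { toFun := fun x e => if h : e ∈ H then x ⟨e, h⟩ else 0
      map_add' := fun x y => by ext e; by_cases h : e ∈ H <;> simp [h]
      map_smul' := fun a x => by ext e; by_cases h : e ∈ H <;> simp [h] }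
  have hext : ∀ x e, ext x e = if h : e ∈ H then x ⟨e, h⟩ else 0 := fun _ _ => rfl
  let L : (H → ZMod 2) →ₗ[ZMod 2] (B → ZMod 2) :=
    (LinearMap.funLeft (ZMod 2) (ZMod 2) (Subtype.val : B → W)).comp (D.boundary.comp ext)
  have hL : ∀ x (f : B), L x f = D.boundary (ext x) f := fun _ _ => rfl
  have hout : ∀ x f, f ∉ B → D.boundary (ext x) f = 0 := fun x f hf => by
    rw [boundary_apply]
    refine Finset.sum_eq_zero fun d _ => ?_
    split_ifs with h
    · rw [hext, dif_neg]
      intro hd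
      refine hf ?_
      rw [hB, Finset.mem_filter]
      subst h
      exact ⟨Finset.mem_univ _, (D.deg_pos hd).ne'⟩
    · rfl
  have h1 := L.finrank_range_add_finrank_ker
  rw [Module.finrank_pi, Fintype.card_coe] at h1
  have h2 : Module.finrank (ZMod 2) (LinearMap.range L) < B.card := by
    obtain ⟨e, he⟩ := hne
    have hf : D.tail (e, true) ∈ B := by
      rw [hB, Finset.mem_filter]
      exact ⟨Finset.mem_univ _, (D.deg_pos (d := (e, true)) he).ne'⟩
    have hlt : LinearMap.range L < ⊤ := by
      rw [lt_top_iff_ne_top]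
      intro htop
      have hm : (Pi.single ⟨_, hf⟩ 1 : B → ZMod 2) ∈ LinearMap.range L := htop ▸ Submodule.mem_top
      obtain ⟨x, hx⟩ := hm
      have h3 := D.sum_boundary (ext x)
      have h4 : ∑ f : B, L x f = ∑ f, D.boundary (ext x) f := by
        simp only [hL]
        rw [← Finset.sum_subset (Finset.subset_univ B) fun f _ hf => hout x f hf,
          Finset.sum_coe_sort B fun f => D.boundary (ext x) f]
      rw [h3, hx] at h4
      simp at h4
    have := Submodule.finrank_lt hlt.ne
    rwa [Module.finrank_pi, Fintype.card_coe] at this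
  have hinj : Function.Injective ext := fun x y hxy => by
    ext e
    have := congrFun hxy e
    simpa [hext, e.2] using this
  have h3 : Module.finrank (ZMod 2) ((LinearMap.ker L).map ext) =
      Module.finrank (ZMod 2) (LinearMap.ker L) :=
    (Submodule.equivMapOfInjective ext hinj _).finrank_eq.symm
  have h4 : (LinearMap.ker L).map ext ≤ D.cycleSpace H := by
    rintro _ ⟨x, hx, rfl⟩
    refine ⟨fun e he => by simp [hext, he], funext fun f => ?_⟩
    by_cases hf : f ∈ B
    · exact congrFun (LinearMap.mem_ker.1 hx) ⟨f, hf⟩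
    · exact hout x f hf
  have h5 := Submodule.finrank_mono h4
  omega

/-- The Euler inequality for a subgraph of the dual graph. -/
theorem card_add_card_add_card_le [Fintype V] [Fintype W] [DecidableEq E] {G : MultiGraph V E}
    {D : MultiGraph W E} (hG : G.Connected) (hD : D.Connected)
    (hort : ∀ φ, D.boundary (G.coboundary φ) = 0) {H : Finset E} (hne : H.Nonempty) :
    H.card + Fintype.card V + Fintype.card W ≤
      Fintype.card E + Nat.card (G.Pieces H) +
        (Finset.univ.filter fun f => D.deg H f ≠ 0).card := by
  classical
  have : Fintype (G.Pieces H) := Fintype.ofFinite _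
  rw [Nat.card_eq_fintype_card]
  have h1 := finrank_range_coboundary hG
  have h2 := finrank_range_boundary hD
  have h3 := D.card_le_finrank_cycleSpace hne
  have h4 := D.boundary.finrank_range_add_finrank_ker
  rw [Module.finrank_pi] at h4
  -- The dimension formula for the cycle space of `H` and the cut space of `G`, whose sum lies in
  -- the kernel of the boundary map.
  have h5 := Submodule.finrank_sup_add_finrank_inf_eq (D.cycleSpace H)
    (LinearMap.range G.coboundary)
  have h6 : D.cycleSpace H ⊔ LinearMap.range G.coboundary ≤ LinearMap.ker D.boundary := by
    refine sup_le (fun x hx => hx.2) ?_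
    rintro _ ⟨φ, rfl⟩
    exact hort φ
  have h7 := Submodule.finrank_mono h6
  let L : (G.Pieces H → ZMod 2) →ₗ[ZMod 2] (E → ZMod 2) :=
    G.coboundary.comp (LinearMap.funLeft (ZMod 2) (ZMod 2) (Quot.mk _))
  have h8 := L.finrank_range_add_finrank_ker
  rw [Module.finrank_pi] at h8
  -- A cut contained in `H` comes from a function that is constant on pieces. The constant functions
  -- give the empty cut, so the intersection has dimension less than the number of pieces.
  have h9 : D.cycleSpace H ⊓ LinearMap.range G.coboundary ≤ LinearMap.range L := by
    rintro _ ⟨hx, φ, rfl⟩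
    refine ⟨Quot.lift φ ?_, rfl⟩
    rintro _ _ ⟨d, hd, rfl, rfl⟩
    exact G.coboundary_apply_eq_zero.1 (hx.1 _ hd)
  have h10 := Submodule.finrank_mono h9
  have h11 : 0 < Module.finrank (ZMod 2) (LinearMap.ker L) := by
    rw [Module.finrank_pos_iff_exists_ne_zero]
    refine ⟨⟨fun _ => 1, ?_⟩, fun h => ?_⟩
    · rw [LinearMap.mem_ker]
      ext e
      change (1 : ZMod 2) + 1 = 0
      decide
    · obtain ⟨v⟩ := hG.1
      exact one_ne_zero (congrFun (congrArg Subtype.val h) (Quot.mk _ v))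
  omega

end MultiGraph

/-! Graphs embedded in surfaces. -/

namespace MultiGraph

variable {V W E : Type*}

theorem mem_cut [Fintype E] {G : MultiGraph V E} {U : Set V} {d : E × Bool} :
    d.1 ∈ G.cut U ↔ ¬ (G.tail d ∈ U ↔ G.head d ∈ U) := by
  classical
  obtain ⟨e, b⟩ := d
  cases b
  · simp only [cut, Finset.mem_filter, Finset.mem_univ, true_and, head, rev, Bool.not_false]
    tauto
  · simp only [cut, Finset.mem_filter, Finset.mem_univ, true_and, head, rev, Bool.not_true]

section Parity

variable [Fintype E] [DecidableEq E] [DecidableEq W]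

theorem boundary_indicator (D : MultiGraph W E) (X : Finset E) (f : W) :
    D.boundary (fun e => if e ∈ X then 1 else 0) f = D.deg X f := by
  rw [boundary_apply, deg, dartsAt, Finset.card_filter, Nat.cast_sum]
  refine Finset.sum_congr rfl fun d _ => ?_
  by_cases h1 : D.tail d = f <;> by_cases h2 : d.1 ∈ X <;> simp [h1, h2]

/-- The coboundary of the indicator function of `U` is the indicator of its cut, and the boundary of
an indicator is the degree modulo two. -/
theorem isEven_cut {G : MultiGraph V E} {D : MultiGraph W E}
    (hort : ∀ φ, D.boundary (G.coboundary φ) = 0) (U : Set V) : D.IsEven (G.cut U) := by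
  classical
  intro f
  have h : G.coboundary (fun v => if v ∈ U then 1 else 0) =
      fun e => if e ∈ G.cut U then 1 else 0 := by
    ext e
    have h1 := G.coboundary_apply_fst (fun v => if v ∈ U then 1 else 0) (e, true)
    have h2 := mem_cut (G := G) (U := U) (d := (e, true))
    dsimp only at h1 h2
    rw [h1]
    simp only [h2]
    by_cases h3 : G.tail (e, true) ∈ U <;> by_cases h4 : G.head (e, true) ∈ U <;>
      simp [h3, h4, CharTwo.add_self_eq_zero]
  have h1 := D.boundary_indicator (G.cut U) f
  rw [← h, hort] at h1
  exact (ZMod.natCast_eq_zero_iff_even).1 h1.symm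

end Parity

theorem Connected.cut_nonempty [Fintype E] {G : MultiGraph V E} (hG : G.Connected) {U : Set V}
    {u v : V} (hu : u ∈ U) (hv : v ∉ U) : (G.cut U).Nonempty := by
  by_contra! h
  have := hG.eq_of_forall (φ := fun x => x ∈ U) (fun d => by
    by_contra hne
    have : d.1 ∈ G.cut U := mem_cut.2 fun h => hne (propext h)
    simp [h] at this) u v
  exact hv (this ▸ hu)

/-! ### Orthogonality of cuts and faces, connectedness of the dual, and genus -/

namespace SurfaceEmbedding

variable {F : Type*} {G : MultiGraph V E} (M : G.SurfaceEmbedding F)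

/-- The permutation of darts that traces the faces. -/
def facePerm : Equiv.Perm (E × Bool) :=
  (⟨rev, rev, fun d => by simp [rev], fun d => by simp [rev]⟩ : Equiv.Perm (E × Bool)).trans M.rot

theorem facePerm_apply (d : E × Bool) : M.facePerm d = M.rot (rev d) := rfl

theorem faceOfDart_rot_rev (d : E × Bool) :
    M.faceOfDart (M.rot (rev d)) = M.faceOfDart d := by
  unfold faceOfDart
  congr 2
  exact Quotient.sound (s := Equiv.Perm.SameCycle.setoid M.facePerm)
    ((Equiv.Perm.SameCycle.refl M.facePerm d).apply_left)

theorem faceOfDart_rot (d : E × Bool) : M.faceOfDart (M.rot d) = M.faceOfDart (rev d) := by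
  rw [← M.faceOfDart_rot_rev (rev d), rev_rev]

theorem tail_rot (d : E × Bool) : G.tail (M.rot d) = G.tail d :=
  (M.rot_sameCycle _ _).1 ((Equiv.Perm.SameCycle.refl M.rot d).apply_left)

/-- Tracing a face, the next dart starts where the previous one ends. So over the darts of a face
the values at heads and at tails have equal sums, which cancel modulo two. This holds also for faces
with several boundary walks. -/
theorem boundary_coboundary [Fintype E] [DecidableEq F] (φ : V → ZMod 2) :
    M.dual.boundary (G.coboundary φ) = 0 := by
  ext f
  have h : ∑ d : E × Bool, (if M.faceOfDart d = f then φ (G.head d) else 0) =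
      ∑ d : E × Bool, if M.faceOfDart d = f then φ (G.tail d) else 0 := by
    rw [← Equiv.sum_comp M.facePerm fun d => if M.faceOfDart d = f then φ (G.tail d) else 0]
    refine Finset.sum_congr rfl fun d _ => ?_
    rw [facePerm_apply, faceOfDart_rot_rev, tail_rot, tail_rev]
  rw [boundary_apply]
  calc (∑ d : E × Bool, if M.faceOfDart d = f then G.coboundary φ d.1 else 0)
      = ∑ d : E × Bool, ((if M.faceOfDart d = f then φ (G.tail d) else 0) +
          if M.faceOfDart d = f then φ (G.head d) else 0) := by
        refine Finset.sum_congr rfl fun d _ => ?_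
        rw [coboundary_apply_fst]
        split_ifs <;> simp
    _ = 0 := by rw [Finset.sum_add_distrib, h, CharTwo.add_self_eq_zero]

/-- Turning from a dart to the next one around its tail changes the face by crossing one edge, so
all faces around a vertex are linked in the dual; edges of `G` carry this from vertex to vertex. A
vertex without darts must be the only vertex. -/
theorem dual_connected [Finite E] (hG : G.Connected) : M.dual.Connected := by
  set R : F → F → Prop := fun x y =>
    ∃ d : E × Bool, d.1 ∈ Set.univ ∧ M.dual.tail d = x ∧ M.dual.head d = y
  have hrev : ∀ d, R (M.faceOfDart d) (M.faceOfDart (rev d)) := fun d => ⟨d, trivial, rfl, rfl⟩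
  have hrot : ∀ d d', G.tail d = G.tail d' →
      Relation.ReflTransGen R (M.faceOfDart d) (M.faceOfDart d') := fun d d' h => by
    obtain ⟨i, hi⟩ := ((M.rot_sameCycle d d').2 h).exists_nat_pow_eq
    subst hi
    clear h
    induction i with
    | zero => exact .refl
    | succ i ih =>
      rw [pow_succ', Equiv.Perm.mul_apply, faceOfDart_rot]
      exact ih.tail (hrev _)
  have hdart : ∀ d d', Relation.ReflTransGen R (M.faceOfDart d) (M.faceOfDart d') := fun d => by
    suffices h : ∀ v, ∀ d', G.tail d' = v →
        Relation.ReflTransGen R (M.faceOfDart d) (M.faceOfDart d') from fun d' => h _ d' rfl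
    intro v
    induction hG.2 (G.tail d) v with
    | refl => exact fun d' h => hrot d d' h.symm
    | tail _ hd ih =>
      obtain ⟨x, -, rfl, rfl⟩ := hd
      exact fun d' h => ((ih x rfl).tail (hrev x)).trans (hrot _ _ (by rw [tail_rev, h]))
  have hiso : ∀ v : V, (∀ d, G.tail d ≠ v) → ∀ u, v = u := fun v hv u => by
    rcases (hG.2 v u).cases_head with h | ⟨_, ⟨d, -, h, -⟩, -⟩
    · exact h
    · exact absurd h (hv d)
  refine ⟨?_, fun f f' => ?_⟩
  · obtain ⟨v⟩ := hG.1
    by_cases h : ∀ d, G.tail d ≠ v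
    · exact ⟨M.faceOf (Sum.inr ⟨v, h⟩)⟩
    · push Not at h
      obtain ⟨d, -⟩ := h
      exact ⟨M.faceOfDart d⟩
  · obtain ⟨w, rfl⟩ := M.faceOf_surjective f
    obtain ⟨w', rfl⟩ := M.faceOf_surjective f'
    rcases w with w | ⟨v, hv⟩ <;> rcases w' with w' | ⟨v', hv'⟩
    · induction w using Quotient.ind
      induction w' using Quotient.ind
      exact hdart _ _
    · induction w using Quotient.ind with
      | _ d => exact absurd (hiso v' hv' (G.tail d)).symm (hv' d)
    · induction w' using Quotient.ind with
      | _ d => exact absurd (hiso v hv (G.tail d)).symm (hv d)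
    · obtain rfl := hiso v hv v'
      exact .refl

instance [Finite V] [Finite E] (rot : Equiv.Perm (E × Bool)) : Finite (G.BoundaryWalk rot) :=
  inferInstanceAs (Finite (_ ⊕ _))

theorem card_boundaryWalk_le [Fintype V] [Fintype E] (rot : Equiv.Perm (E × Bool)) :
    Nat.card (G.BoundaryWalk rot) ≤ Fintype.card E * 2 + Fintype.card V := by
  refine (Nat.card_sum (α := Quotient _) (β := {v : V // ∀ d, G.tail d ≠ v})).le.trans
    (Nat.add_le_add ?_ ?_)
  · refine (Nat.card_le_card_of_surjective _ Quotient.mk_surjective).trans ?_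
    simp
  · exact (Nat.card_le_card_of_injective _ Subtype.val_injective).trans (by simp)

theorem card_face_le (M : G.SurfaceEmbedding F) [Fintype V] [Fintype E] [Fintype F] :
    Fintype.card F ≤ Fintype.card E * 2 + Fintype.card V := by
  have := Nat.card_le_card_of_surjective _ M.faceOf_surjective
  rw [Nat.card_eq_fintype_card] at this
  exact this.trans (card_boundaryWalk_le _)

/-- Every face has at least one boundary walk, so its Euler characteristic is at most one. Only this
inequality is needed, and so faces need not be discs. -/
theorem HasGenus.card_le [Fintype V] [Fintype E] [Fintype F] {M : G.SurfaceEmbedding F} {γ : ℕ}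
    (h : M.HasGenus γ) : Fintype.card E + 2 ≤ Fintype.card V + Fintype.card F + 2 * γ := by
  have h1 : ∑ f : F, (2 - 2 * (M.faceGenus f : ℤ) - Nat.card {w // M.faceOf w = f}) ≤
      ∑ _f : F, 1 := by
    refine Finset.sum_le_sum fun f _ => ?_
    obtain ⟨w, hw⟩ := M.faceOf_surjective f
    have : Nonempty {w // M.faceOf w = f} := ⟨⟨w, hw⟩⟩
    have : 0 < Nat.card {w // M.faceOf w = f} := Nat.card_pos
    omega
  rw [Finset.sum_const, Finset.card_univ, nsmul_eq_mul, mul_one] at h1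
  unfold HasGenus at h
  omega

end SurfaceEmbedding

end MultiGraph

/-! Graphs in which all cycles have many vertices of degree at least three. -/

namespace MultiGraph

variable {W E : Type*}

/-- The walk in the opposite direction. -/
def reverseWalk (U : List (E × Bool)) : List (E × Bool) := (U.map rev).reverse

theorem isChain_reverseWalk {D : MultiGraph W E} {U : List (E × Bool)} (hU : U.IsChain D.Follows) :
    (reverseWalk U).IsChain D.Follows := by
  rw [reverseWalk, List.isChain_reverse, List.isChain_map]
  exact hU.imp fun a b h => h.rev

theorem mem_of_mem_reverseWalk {H : Finset E} {U : List (E × Bool)} (hH : ∀ d ∈ U, d.1 ∈ H) :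
    ∀ d ∈ reverseWalk U, d.1 ∈ H := fun d hd => by
  rw [reverseWalk, List.mem_reverse, List.mem_map] at hd
  obtain ⟨a, ha, rfl⟩ := hd
  exact hH a ha

variable [Fintype E] [DecidableEq E] [DecidableEq W]

/-- The number of darts in a list that start at a vertex of degree at least three. -/
def tailCount (D : MultiGraph W E) (H : Finset E) (U : List (E × Bool)) : ℕ :=
  U.countP fun d => decide (3 ≤ D.deg H (D.tail d))

/-- The number of darts in a list that end at a vertex of degree at least three. -/
def headCount (D : MultiGraph W E) (H : Finset E) (U : List (E × Bool)) : ℕ :=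
  U.countP fun d => decide (3 ≤ D.deg H (D.head d))

/-- All cycles of the subgraph with edge set `H` have at least `q` vertices of degree at least
three. -/
def BranchGirth (D : MultiGraph W E) (H : Finset E) (q : ℕ) : Prop :=
  ∀ l (c : Fin l → E × Bool), D.IsCycle l c → (∀ k, (c k).1 ∈ H) →
    q ≤ (Finset.univ.filter fun k => 3 ≤ D.deg H (D.tail (c k))).card

variable {D : MultiGraph W E} {H : Finset E} {q : ℕ}

/-- A closed walk without immediate reversals contains a cycle, whose branch vertices are distinct
tails of darts of the walk. A reversal at the closing point does no harm. -/
theorem BranchGirth.le_tailCount (hq : D.BranchGirth H q) {U : List (E × Bool)} (hne : U ≠ [])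
    (hU : U.IsChain D.Follows) (hH : ∀ d ∈ U, d.1 ∈ H)
    (hclosed : D.head (U.getLast hne) = D.tail (U.head hne)) : q ≤ D.tailCount H U := by
  have hpos : 0 < U.length := List.length_pos_iff.2 hne
  set s : ℕ → E × Bool := fun i => U.getD i (U.head hne) with hs
  have hsi : ∀ i (h : i < U.length), s i = U[i] := fun i h => by
    simp only [hs, List.getD_eq_getElem _ _ h]
  obtain ⟨i, l, hil, hc⟩ := D.exists_isCycle_of_follows s U.length (fun i hi => by
      rw [hsi i (by omega), hsi (i + 1) hi]
      exact List.isChain_iff_getElem.1 hU i hi) (Nat.zero_le (U.length - 1)) (by omega) (by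
      rw [hsi _ (by omega), hsi 0 hpos, ← List.getLast_eq_getElem hne, hclosed,
        List.head_eq_getElem])
  have hmem : ∀ k : Fin l, s (i + k) ∈ U := fun k => by
    rw [hsi _ (by omega)]
    exact List.getElem_mem _
  refine (hq l _ hc fun k => hH _ (hmem k)).trans ?_
  rw [tailCount, List.countP_eq_length_filter]
  refine le_trans ?_ (((List.toFinset_card_le
    ((U.filter fun d => decide (3 ≤ D.deg H (D.tail d))).map D.tail))).trans_eq (List.length_map _))
  refine Finset.card_le_card_of_injOn (fun k => D.tail (s (i + k))) (fun k hk => ?_)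
    hc.vertex_injective.injOn
  simp only [Finset.coe_filter, Finset.mem_univ, true_and, Set.mem_ofPred_eq] at hk
  simp only [List.coe_toFinset, List.mem_map, List.mem_filter, decide_eq_true_eq, Set.mem_ofPred_eq]
  exact ⟨_, ⟨hmem k, hk⟩, rfl⟩

theorem tailCount_append (U U' : List (E × Bool)) :
    D.tailCount H (U ++ U') = D.tailCount H U + D.tailCount H U' := List.countP_append

theorem headCount_append (U U' : List (E × Bool)) :
    D.headCount H (U ++ U') = D.headCount H U + D.headCount H U' := List.countP_append

theorem tailCount_reverseWalk (U : List (E × Bool)) :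
    D.tailCount H (reverseWalk U) = D.headCount H U := by
  rw [tailCount, headCount, reverseWalk, List.countP_reverse, List.countP_map]
  rfl

theorem BranchGirth.le_headCount (hq : D.BranchGirth H q) {U : List (E × Bool)} (hne : U ≠ [])
    (hU : U.IsChain D.Follows) (hH : ∀ d ∈ U, d.1 ∈ H)
    (hclosed : D.head (U.getLast hne) = D.tail (U.head hne)) : q ≤ D.headCount H U := by
  rw [← tailCount_reverseWalk]
  refine hq.le_tailCount (by simpa [reverseWalk]) (isChain_reverseWalk hU)
    (mem_of_mem_reverseWalk hH) ?_
  simp [reverseWalk, hclosed]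

/-- Two different walks without immediate reversals between the same vertices together contain
many vertices of degree at least three. -/
theorem BranchGirth.le_tailCount_add_headCount (hq : D.BranchGirth H q) {U U' : List (E × Bool)}
    (hne : U ≠ []) (hne' : U' ≠ []) (hU : U.IsChain D.Follows) (hU' : U'.IsChain D.Follows)
    (hH : ∀ d ∈ U, d.1 ∈ H) (hH' : ∀ d ∈ U', d.1 ∈ H)
    (hstart : D.tail (U.head hne) = D.tail (U'.head hne')) (hfirst : U.head hne ≠ U'.head hne')
    (hend : D.head (U.getLast hne) = D.head (U'.getLast hne')) :
    q ≤ D.tailCount H U + D.headCount H U' := by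
  induction U using List.reverseRecOn generalizing U' with
  | nil => exact absurd rfl hne
  | append_singleton U a ih =>
    rcases U'.eq_nil_or_concat' with rfl | ⟨U', a', rfl⟩
    · exact absurd rfl hne'
    simp only [List.getLast_append_singleton] at hend
    rw [tailCount_append, headCount_append]
    -- Equal last darts are removed from both walks. When one walk is used up, the rest of the other
    -- is closed; both cannot be used up, since the first darts differ.
    by_cases haa : a = a'
    · subst haa
      have hU1 := (List.isChain_append.1 hU)
      have hU1' := (List.isChain_append.1 hU')
      by_cases h : U = []
      · subst h
        by_cases h' : U' = []
        · subst h'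
          exact absurd rfl hfirst
        · have := hq.le_headCount h' hU1'.1 (fun d hd => hH' d (by simp [hd])) (by
            have h1 := hU1'.2.2 (U'.getLast h') (List.getLast_mem_getLast? h') a rfl
            rw [h1.1]
            simpa [List.head_append_of_ne_nil, h'] using hstart)
          omega
      · by_cases h' : U' = []
        · subst h'
          have := hq.le_tailCount h hU1.1 (fun d hd => hH d (by simp [hd])) (by
            have h1 := hU1.2.2 (U.getLast h) (List.getLast_mem_getLast? h) a rfl
            rw [h1.1]
            simpa [List.head_append_of_ne_nil, h] using hstart.symm)
          omega
        · rw [List.head_append_of_ne_nil h, List.head_append_of_ne_nil h'] at hstart hfirst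
          have h1 := hU1.2.2 (U.getLast h) (List.getLast_mem_getLast? h) a rfl
          have h2 := hU1'.2.2 (U'.getLast h') (List.getLast_mem_getLast? h') a rfl
          have := ih h h' hU1.1 hU1'.1 (fun d hd => hH d (by simp [hd]))
            (fun d hd => hH' d (by simp [hd])) hstart hfirst (by rw [h1.1, h2.1])
          omega
    -- With different last darts, going along the first walk and back along the second creates no
    -- reversal. Going back turns heads into tails.
    · have h := hq.le_tailCount (U := (U ++ [a]) ++ reverseWalk (U' ++ [a'])) (by simp)
        (List.isChain_append.2 ⟨hU, isChain_reverseWalk hU', fun x hx y hy => by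
          simp only [List.getLast?_append_cons, List.getLast?_singleton, Option.mem_def,
            Option.some.injEq] at hx
          simp only [reverseWalk, List.map_append, List.map_cons, List.map_nil,
            List.reverse_append, List.reverse_cons, List.reverse_nil, List.nil_append,
            List.cons_append, List.head?_cons, Option.mem_def, Option.some.injEq] at hy
          subst hx hy
          exact ⟨by simpa using hend, fun h => haa (rev_injective h).symm⟩⟩)
        (fun d hd => by
          rcases List.mem_append.1 hd with h | h
          · exact hH d h
          · exact mem_of_mem_reverseWalk hH' d h) (by
          rw [List.getLast_append_of_ne_nil _ (by simp [reverseWalk]),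
            List.head_append_of_ne_nil hne, hstart]
          simp only [reverseWalk, List.getLast_reverse, List.head_map, head_rev])
      rw [tailCount_append, tailCount_append, tailCount_reverseWalk, headCount_append] at h
      exact h

/-- The vertex `y` of degree at least three is the end of a walk without immediate reversals that
starts with `d` and runs through at most `r` vertices of degree at least three. -/
def Reaches (D : MultiGraph W E) (H : Finset E) (d : E × Bool) (r : ℕ) (y : W) : Prop :=
  ∃ U : List (E × Bool), (d :: U).IsChain D.Follows ∧ (∀ x ∈ d :: U, x.1 ∈ H) ∧
    D.head ((d :: U).getLast (List.cons_ne_nil _ _)) = y ∧ 3 ≤ D.deg H y ∧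
    D.tailCount H (d :: U) ≤ r ∧ D.headCount H (d :: U) ≤ r

/-- One walk enters with its tails and the other with its heads, which is why `Reaches` bounds both
counts. -/
theorem BranchGirth.le_of_reaches (hq : D.BranchGirth H q) {d d' : E × Bool} {r r' : ℕ} {y : W}
    (hne : d ≠ d') (ht : D.tail d = D.tail d') (h : D.Reaches H d r y)
    (h' : D.Reaches H d' r' y) : q ≤ r + r' := by
  obtain ⟨U, h1, h2, h3, -, h4, -⟩ := h
  obtain ⟨U', h1', h2', h3', -, -, h4'⟩ := h'
  exact (hq.le_tailCount_add_headCount (List.cons_ne_nil _ _) (List.cons_ne_nil _ _) h1 h1' h2 h2'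
    ht hne (h3.trans h3'.symm)).trans (Nat.add_le_add h4 h4')

theorem BranchGirth.le_of_reaches_tail (hq : D.BranchGirth H q) {d : E × Bool} {r : ℕ}
    (h : D.Reaches H d r (D.tail d)) : q ≤ r := by
  obtain ⟨U, h1, h2, h3, -, h4, -⟩ := h
  exact (hq.le_tailCount (List.cons_ne_nil _ _) h1 h2 h3).trans h4

/-- Along a stretch that stops on reaching its first branch vertex, only the first tail and the last
head can be branch vertices. -/
theorem exists_run {s : ℕ → E × Bool} (hs : ∀ i, D.Follows (s i) (s (i + 1)))
    (hH : ∀ i, (s i).1 ∈ H) (j : ℕ) (hj : ∀ i < j, ¬ 3 ≤ D.deg H (D.head (s i))) :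
    ∃ U : List (E × Bool), (s 0 :: U).IsChain D.Follows ∧ (∀ x ∈ s 0 :: U, x.1 ∈ H) ∧
      (s 0 :: U).getLast (List.cons_ne_nil _ _) = s j ∧ D.tailCount H U = 0 ∧
      D.headCount H (s 0 :: U) ≤ 1 := by
  induction j generalizing s with
  | zero =>
    refine ⟨[], by simp, by simpa using hH 0, rfl, rfl, ?_⟩
    exact List.countP_le_length
  | succ j ih =>
    obtain ⟨U, h1, h2, h3, h4, h5⟩ := ih (s := fun i => s (i + 1)) (fun i => hs (i + 1))
      (fun i => hH (i + 1)) fun i hi => hj (i + 1) (by omega)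
    have h0 := hj 0 (by omega)
    refine ⟨s 1 :: U, List.isChain_cons_cons.2 ⟨hs 0, h1⟩, ?_, ?_, ?_, ?_⟩
    · rintro x hx
      rcases List.mem_cons.1 hx with rfl | hx
      · exact hH 0
      · exact h2 x hx
    · rw [List.getLast_cons (List.cons_ne_nil _ _)]
      exact h3
    · rw [tailCount, List.countP_cons_of_neg]
      · exact h4
      · rw [← (hs 0).1]
        simpa using h0
    · rw [headCount, List.countP_cons_of_neg]
      · exact h5
      · simpa using h0

/-- A walk continued from `d` eventually runs around a cycle, and cycles have branch vertices. The
dart `a` enters the first branch vertex; prolonging the walk beyond it raises each count by at most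
one. -/
theorem BranchGirth.exists_reaches (hq : D.BranchGirth H q) (hpos : 0 < q)
    (hdeg : ∀ f, D.deg H f ≠ 1) {d : E × Bool} (hd : d.1 ∈ H) :
    ∃ a : E × Bool, a.1 ∈ H ∧ D.Reaches H d 1 (D.head a) ∧
      ∀ d' r z, D.Follows a d' → D.Reaches H d' r z → D.Reaches H d (r + 1) z := by
  obtain ⟨s, hs0, hsH, hs⟩ := exists_walk (D := D) (H := H) (fun d hd => by
    have h1 : 0 < D.deg H (D.head d) := D.deg_pos (d := rev d) (by simpa)
    have h2 := hdeg (D.head d)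
    omega) hd
  have hex : ∃ j, 3 ≤ D.deg H (D.head (s j)) := by
    obtain ⟨i, l, hc⟩ := exists_isCycle_of_walk (s := fun i => s (i + 1)) fun i => hs (i + 1)
    obtain ⟨k, hk⟩ := Finset.card_pos.1 (hpos.trans_le (hq l _ hc fun k => hsH _))
    rw [Finset.mem_filter, ← (hs _).1] at hk
    exact ⟨_, hk.2⟩
  have hj := Nat.find_spec hex
  have hmin := fun i (hi : i < Nat.find hex) => Nat.find_min hex hi
  set j := Nat.find hex
  obtain ⟨U, h1, h2, h3, h4, h5⟩ := exists_run hs hsH j hmin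
  rw [hs0] at h1 h2 h3 h5
  have h6 : D.tailCount H (d :: U) ≤ 1 := by
    rw [tailCount, List.countP_cons]
    unfold tailCount at h4
    split_ifs <;> omega
  refine ⟨s j, hsH j, ⟨U, h1, h2, by rw [h3], hj, h6, h5⟩, fun d' r z hf hz => ?_⟩
  obtain ⟨U', h1', h2', h3', h4', h5', h6'⟩ := hz
  refine ⟨U ++ d' :: U', ?_, ?_, ?_, h4', ?_, ?_⟩
  · rw [← List.cons_append]
    refine List.isChain_append.2 ⟨h1, h1', fun x hx y hy => ?_⟩
    rw [List.getLast?_eq_some_getLast (List.cons_ne_nil _ _), h3] at hx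
    simp only [Option.mem_def, Option.some.injEq, List.head?_cons] at hx hy
    subst hx hy
    exact hf
  · intro x hx
    rw [← List.cons_append] at hx
    rcases List.mem_append.1 hx with h | h
    · exact h2 x h
    · exact h2' x h
  · rw [← h3']
    congr 1
    simp only [← List.cons_append]
    rw [List.getLast_append_of_ne_nil _ (List.cons_ne_nil _ _)]
  · rw [← List.cons_append, tailCount_append]
    omega
  · rw [← List.cons_append, headCount_append]
    omega

theorem Reaches.mono {d : E × Bool} {r r' : ℕ} {y : W} (h : D.Reaches H d r y) (hr : r ≤ r') :
    D.Reaches H d r' y := by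
  obtain ⟨U, h1, h2, h3, h4, h5, h6⟩ := h
  exact ⟨U, h1, h2, h3, h4, h5.trans hr, h6.trans hr⟩

/-! ### Trees of branch vertices and the Moore bound -/

variable [Fintype W]

open Classical in
/-- The vertices reached by walks that start with a given dart. -/
noncomputable def reached (D : MultiGraph W E) (H : Finset E) (d : E × Bool) (r : ℕ) : Finset W :=
  Finset.univ.filter (D.Reaches H d r)

@[simp] theorem mem_reached {d : E × Bool} {r : ℕ} {y : W} :
    y ∈ D.reached H d r ↔ D.Reaches H d r y := by simp [reached]

theorem BranchGirth.disjoint_reached (hq : D.BranchGirth H q) {d d' : E × Bool} {r r' : ℕ}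
    (hne : d ≠ d') (ht : D.tail d = D.tail d') (hr : r + r' < q) :
    Disjoint (D.reached H d r) (D.reached H d' r') := by
  rw [Finset.disjoint_left]
  intro y hy hy'
  rw [mem_reached] at hy hy'
  have := hq.le_of_reaches hne ht hy hy'
  omega

theorem BranchGirth.tail_notMem_reached (hq : D.BranchGirth H q) {d : E × Bool} {r : ℕ}
    (hr : r < q) : D.tail d ∉ D.reached H d r := fun h => by
  have := hq.le_of_reaches_tail (mem_reached.1 h)
  omega

/-- At the first branch vertex the walk can continue in two ways, and the sets reached are disjoint
as long as twice the radius is below `q`: a binary tree with 2^r - 1 vertices. The hypothesis `2 * r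
< q + 2` provides this disjointness one level below `r`. -/
theorem BranchGirth.le_card_reached (hq : D.BranchGirth H q) (hpos : 0 < q)
    (hdeg : ∀ f, D.deg H f ≠ 1) (r : ℕ) (hr : 2 * r < q + 2) {d : E × Bool} (hd : d.1 ∈ H) :
    2 ^ r ≤ (D.reached H d r).card + 1 := by
  induction r generalizing d with
  | zero => simp
  | succ r ih =>
    obtain ⟨a, haH, ha, hstep⟩ := hq.exists_reaches hpos hdeg hd
    have ha3 : 3 ≤ D.deg H (D.head a) := by
      obtain ⟨U, -, -, -, h, -⟩ := ha
      exact h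
    have hcard : 1 < ((D.dartsAt H (D.head a)).erase (rev a)).card := by
      have := Finset.pred_card_le_card_erase (s := D.dartsAt H (D.head a)) (a := rev a)
      have h3 : 3 ≤ (D.dartsAt H (D.head a)).card := ha3
      omega
    obtain ⟨d₁, hd₁, d₂, hd₂, hne⟩ := Finset.one_lt_card.1 hcard
    rw [Finset.mem_erase, mem_dartsAt] at hd₁ hd₂
    have h1 := ih (by omega) hd₁.2.1
    have h2 := ih (by omega) hd₂.2.1
    have ht : D.tail d₁ = D.tail d₂ := by rw [hd₁.2.2, hd₂.2.2]
    have hdis := hq.disjoint_reached (r := r) (r' := r) hne ht (by omega)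
    have hn1 := hq.tail_notMem_reached (d := d₁) (r := r) (by omega)
    have hn2 := hq.tail_notMem_reached (d := d₂) (r := r) (by omega)
    rw [hd₁.2.2] at hn1
    rw [hd₂.2.2] at hn2
    have hsub : insert (D.head a) (D.reached H d₁ r ∪ D.reached H d₂ r) ⊆
        D.reached H d (r + 1) := by
      intro y hy
      rw [mem_reached]
      rcases Finset.mem_insert.1 hy with rfl | hy
      · exact ha.mono (by omega)
      rcases Finset.mem_union.1 hy with hy | hy
      · exact hstep d₁ r y ⟨hd₁.2.2.symm, hd₁.1⟩ (mem_reached.1 hy)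
      · exact hstep d₂ r y ⟨hd₂.2.2.symm, hd₂.1⟩ (mem_reached.1 hy)
    have h3 := Finset.card_le_card hsub
    rw [Finset.card_insert_of_notMem (by simpa using ⟨by simpa using hn1, by simpa using hn2⟩),
      Finset.card_union_of_disjoint hdis] at h3
    rw [pow_succ]
    omega

/-- The Moore bound. -/
theorem BranchGirth.moore (hq : D.BranchGirth H q) (hdeg : ∀ f, D.deg H f ≠ 1) {x : W}
    (hx : 3 ≤ D.deg H x) (r r' : ℕ) (hr : r + r' < q) (hr' : r' ≤ r) (hr₂ : r ≤ r' + 1) :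
    2 ^ r + 2 * 2 ^ r' ≤ (Finset.univ.filter fun f => 3 ≤ D.deg H f).card + 2 := by
  obtain ⟨d₀, d₁, d₂, h₀, h₁, h₂, h01, h02, h12⟩ := Finset.two_lt_card_iff.1 hx
  rw [mem_dartsAt] at h₀ h₁ h₂
  have c0 := hq.le_card_reached (by omega) hdeg r (by omega) h₀.1
  have c1 := hq.le_card_reached (by omega) hdeg r' (by omega) h₁.1
  have c2 := hq.le_card_reached (by omega) hdeg r' (by omega) h₂.1
  have e01 := hq.disjoint_reached h01 (h₀.2.trans h₁.2.symm) hr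
  have e02 := hq.disjoint_reached h02 (h₀.2.trans h₂.2.symm) hr
  have e12 := hq.disjoint_reached (r := r') (r' := r') h12 (h₁.2.trans h₂.2.symm) (by omega)
  have n0 := hq.tail_notMem_reached (d := d₀) (r := r) (by omega)
  have n1 := hq.tail_notMem_reached (d := d₁) (r := r') (by omega)
  have n2 := hq.tail_notMem_reached (d := d₂) (r := r') (by omega)
  rw [h₀.2] at n0
  rw [h₁.2] at n1
  rw [h₂.2] at n2
  -- The root and three disjoint trees, one of radius `r` and two of radius `r'`, give 1 + (2^r - 1)
  -- + 2(2^r' - 1) branch vertices.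
  have hsub : insert x (D.reached H d₀ r ∪ (D.reached H d₁ r' ∪ D.reached H d₂ r')) ⊆
      Finset.univ.filter fun f => 3 ≤ D.deg H f := by
    intro y hy
    rw [Finset.mem_filter]
    refine ⟨Finset.mem_univ _, ?_⟩
    have key : ∀ d r, y ∈ D.reached H d r → 3 ≤ D.deg H y := fun d r h => by
      obtain ⟨U, -, -, -, h, -⟩ := mem_reached.1 h
      exact h
    simp only [Finset.mem_insert, Finset.mem_union] at hy
    rcases hy with rfl | hy | hy | hy
    · exact hx
    all_goals exact key _ _ hy
  have h3 := Finset.card_le_card hsub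
  rw [Finset.card_insert_of_notMem (by
      simp only [Finset.mem_union, not_or]
      exact ⟨n0, n1, n2⟩),
    Finset.card_union_of_disjoint (Finset.disjoint_union_right.2 ⟨e01, e02⟩),
    Finset.card_union_of_disjoint e12] at h3
  omega

end MultiGraph

/-! Long paths in subgraphs of the dual graph. -/

/-- The left side is 4(γ + 3/2)², and 2 log₂(γ + 3/2) is less than its floor plus one; this is where
the form of α is used. -/
theorem two_mul_add_three_sq_lt (γ : ℕ) : (2 * γ + 3) ^ 2 < 2 ^ (genusAlpha γ - 1) := by
  set x : ℝ := (γ : ℝ) + 3 / 2 with hx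
  have hx0 : 0 < x := by positivity
  have h1 := Nat.lt_floor_add_one (2 * Real.logb 2 x)
  set n := ⌊2 * Real.logb 2 x⌋₊ with hn
  have hα : genusAlpha γ - 1 = n + 3 := by
    rw [genusAlpha, ← hx, ← hn]
    omega
  have h2 : x ^ 2 < 2 ^ (n + 1) := by
    have h3 : Real.logb 2 (x ^ 2) < ((n + 1 : ℕ) : ℝ) := by
      rw [Real.logb_pow]
      push_cast
      exact h1
    rw [Real.logb_lt_iff_lt_rpow one_lt_two (by positivity), Real.rpow_natCast] at h3
    exact h3
  rw [hα]
  have h4 : ((2 * γ + 3 : ℕ) : ℝ) ^ 2 < 2 ^ (n + 3) := by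
    have : ((2 * γ + 3 : ℕ) : ℝ) = 2 * x := by
      push_cast
      rw [hx]
      ring
    rw [this, show n + 3 = (n + 1) + 2 from rfl, pow_add]
    nlinarith
  exact_mod_cast h4

/-- The Moore bound and the Euler inequality contradict each other if the girth is large. -/
theorem not_moore_and_euler (q γ b c s : ℕ) (hq : 6 ≤ q) (hγ : (2 * γ + 3) ^ 2 < 2 ^ (q - 2))
    (hmoore : ∀ r r', r + r' < q → r' ≤ r → r ≤ r' + 1 → 2 ^ r + 2 * 2 ^ r' ≤ b + 2)
    (hb : 3 * b ≤ s) (heuler : s + 4 ≤ 2 * b + 2 * c + 4 * γ) (hc : c ≤ 1 ∨ c * q ≤ s) : False := by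
  -- Multiply the Euler inequality by q, replace cq by s, and then use s ≥ 3b.
  have hkey : c ≤ 1 ∨ (b : ℤ) * (q - 6) ≤ (4 * γ - 4) * q := by
    refine hc.imp id fun h => ?_
    have hb' : (3 * b : ℤ) ≤ s := by exact_mod_cast hb
    have he' : (s : ℤ) + 4 ≤ 2 * b + 2 * c + 4 * γ := by exact_mod_cast heuler
    have h' : (c : ℤ) * q ≤ s := by exact_mod_cast h
    have hq' : (6 : ℤ) ≤ q := by exact_mod_cast hq
    nlinarith
  -- The two radii add up to q - 1: they are q/2 and q/2 - 1 for even q, and equal for odd q.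
  rcases Nat.even_or_odd' q with ⟨r, rfl | rfl⟩
  · have h1 := hmoore r (r - 1) (by omega) (by omega) (by omega)
    obtain ⟨k, rfl⟩ : ∃ k, r = k + 1 := ⟨r - 1, by omega⟩
    simp only [Nat.add_sub_cancel] at h1
    have h2 : 2 * γ + 4 ≤ 2 ^ k := by
      rw [show 2 * (k + 1) - 2 = k * 2 by omega, pow_mul] at hγ
      exact lt_of_pow_lt_pow_left₀ 2 (Nat.zero_le _) hγ
    rw [pow_succ] at h1
    rcases hkey with h | h
    · omega
    · have h2' : (2 * γ + 4 : ℤ) ≤ 2 ^ k := by exact_mod_cast h2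
      have h1' : (2 ^ k * 2 + 2 * 2 ^ k : ℤ) ≤ b + 2 := by exact_mod_cast h1
      have h3 : (8 * γ + 14 : ℤ) ≤ b := by linarith
      push_cast at h
      -- From k = 5 on, the linear bound on b suffices, since 8(2k-4) ≥ 4(2k+2). For smaller k the
      -- actual powers of two bound γ and b.
      rcases Nat.lt_or_ge k 5 with hk | hk
      · interval_cases k
        · omega
        · omega
        · omega
        · omega
        · omega
      · have hk' : (5 : ℤ) ≤ k := by exact_mod_cast hk
        have hg : (0 : ℤ) ≤ γ := Int.natCast_nonneg _
        nlinarith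
  · have h1 := hmoore r r (by omega) le_rfl (by omega)
    -- Here 2γ + 3 < 2^r/√2, and 5/7 is a rational number slightly above 1/√2.
    have h2 : 7 * (2 * γ + 3) ≤ 5 * 2 ^ r := by
      by_contra! hlt
      have h4 : 2 ^ (2 * r + 1 - 2) * 2 = (2 ^ r) ^ 2 := by
        rw [← pow_succ, ← pow_mul]
        congr 1
        omega
      have h5 : (5 * 2 ^ r) * (5 * 2 ^ r) < (7 * (2 * γ + 3)) * (7 * (2 * γ + 3)) :=
        Nat.mul_self_lt_mul_self hlt
      nlinarith
    rcases hkey with h | h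
    · omega
    · have h2' : (7 * (2 * γ + 3) : ℤ) ≤ 5 * 2 ^ r := by exact_mod_cast h2
      have h1' : (2 ^ r + 2 * 2 ^ r : ℤ) ≤ b + 2 := by exact_mod_cast h1
      have h3 : (42 * γ + 53 : ℤ) ≤ 5 * b := by linarith
      push_cast at h
      -- From r = 6 on, 42(2r-5) ≥ 20(2r+1), so the linear bound suffices.
      rcases Nat.lt_or_ge r 6 with hk | hk
      · interval_cases r
        · omega
        · omega
        · omega
        · omega
        · omega
        · omega
      · have hk' : (6 : ℤ) ≤ r := by exact_mod_cast hk
        have hg : (0 : ℤ) ≤ γ := Int.natCast_nonneg _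
        nlinarith

namespace MultiGraph

variable {V W E : Type*} [Fintype E] [DecidableEq E] [DecidableEq W] {D : MultiGraph W E}
  {G : MultiGraph V E} {H : Finset E} {q : ℕ}

/-- An edge of a cycle is deep if no vertex of large degree is near it. -/
theorem IsCycle.mem_deep {l : ℕ} {c : Fin l → E × Bool} (hc : D.IsCycle l c)
    (hH : ∀ k, (c k).1 ∈ H) (k i : ℕ)
    (h : ∀ t, t < 2 * (k + 1) → D.deg H (D.tail (hc.walk (i + t))) ≤ 2) :
    (hc.walk (i + k)).1 ∈ D.deep H (k + 1) := by
  induction k generalizing i with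
  | zero =>
    refine mem_unbranched.2 ⟨hH _, h 0 (by omega), ?_⟩
    rw [(hc.follows _).1]
    exact h 1 (by omega)
  | succ k ih =>
    -- Three consecutive edges are deep at the previous level. The middle one then has both ends of
    -- degree at least two there and survives the next pruning.
    have h0 := ih i fun t ht => h t (by omega)
    have h1 := ih (i + 1) fun t ht => by
      rw [show i + 1 + t = i + (t + 1) by omega]
      exact h _ (by omega)
    have h2 := ih (i + 2) fun t ht => by
      rw [show i + 2 + t = i + (t + 2) by omega]
      exact h _ (by omega)
    rw [show i + 1 + k = i + (k + 1) by omega] at h1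
    rw [show i + 2 + k = i + (k + 1) + 1 by omega] at h2
    rw [deep_succ_succ, mem_pruned]
    have h3 := (hc.follows (i + k)).two_le_deg h0 h1
    have h4 := (hc.follows (i + (k + 1))).two_le_deg h1 h2
    rw [← (hc.follows (i + (k + 1))).1] at h4
    refine ⟨h1, ?_, by omega⟩
    rw [show i + (k + 1) = i + k + 1 by omega]
    omega

/-- If there are no deep edges then vertices of large degree are dense on cycles. -/
theorem IsCycle.le_card_mul {l : ℕ} {c : Fin l → E × Bool} (hc : D.IsCycle l c)
    (hH : ∀ k, (c k).1 ∈ H) {d : ℕ} (hd : D.deep H (d + 1) = ∅) :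
    l ≤ (Finset.univ.filter fun k => 3 ≤ D.deg H (D.tail (c k))).card * (2 * (d + 1)) := by
  have hl := hc.pos
  have hex : ∀ i, ∃ t < 2 * (d + 1), 3 ≤ D.deg H (D.tail (hc.walk (i + t))) := fun i => by
    by_contra! h
    have := hc.mem_deep hH d i fun t ht => by
      have := h t ht
      omega
    simp [hd] at this
  choose t ht ht' using hex
  -- Every window of 2(d+1) positions contains a branch vertex. Its position and its offset in the
  -- window determine where the window begins.
  have := Finset.card_le_card_of_injOn (s := Finset.range l)
    (t := (Finset.univ.filter fun k => 3 ≤ D.deg H (D.tail (c k))) ×ˢ Finset.range (2 * (d + 1)))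
    (fun i => (⟨(i + t i) % l, Nat.mod_lt _ hl⟩, t i)) (fun i _ => by
      simp only [Finset.coe_product, Set.mem_prod, Finset.mem_coe, Finset.mem_filter,
        Finset.mem_univ, true_and, Finset.mem_range]
      exact ⟨ht' i, ht i⟩) (fun i hi j hj hij => by
      simp only [Prod.mk.injEq, Fin.mk.injEq] at hij
      rw [Finset.mem_coe, Finset.mem_range] at hi hj
      have h1 : (i + t i) % l = (j + t i) % l := by rw [hij.1, hij.2]
      have h2 : i % l = j % l := Nat.ModEq.add_right_cancel' _ h1
      rwa [Nat.mod_eq_of_lt hi, Nat.mod_eq_of_lt hj] at h2)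
  rwa [Finset.card_range, Finset.card_product, Finset.card_range] at this

/-! ### Counting branch vertices and pieces -/

variable [Fintype W]

theorem sum_deg (D : MultiGraph W E) (H : Finset E) : ∑ f, D.deg H f = 2 * H.card := by
  have h : ∀ f, D.deg H f =
      ((H ×ˢ (Finset.univ : Finset Bool)).filter fun d => D.tail d = f).card := fun f => by
    rw [deg]
    congr 1
    ext d
    simp
  simp only [h]
  rw [← Finset.card_eq_sum_card_fiberwise fun d _ => Finset.mem_coe.2 (Finset.mem_univ (D.tail d)),
    Finset.card_product]
  simp [mul_comm]

/-- Compare vertex by vertex after writing 2|H| as the sum of degrees: vertices of degree two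
cancel. This suppresses the paths between branch vertices in the Euler inequality. -/
theorem sum_branch_deg (hdeg : ∀ f, D.deg H f ≠ 1) :
    (∑ f with 3 ≤ D.deg H f, D.deg H f) + 2 * (Finset.univ.filter fun f => D.deg H f ≠ 0).card =
      2 * H.card + 2 * (Finset.univ.filter fun f => 3 ≤ D.deg H f).card := by
  rw [← sum_deg D, Finset.card_filter, Finset.card_filter, Finset.sum_filter, Finset.mul_sum,
    Finset.mul_sum, ← Finset.sum_add_distrib, ← Finset.sum_add_distrib]
  refine Finset.sum_congr rfl fun f _ => ?_
  have := hdeg f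
  split_ifs <;> omega

/-- The even set contains a cycle, which passes at least `q` branch vertices of `H`, and each has
degree at least two in the even set. -/
theorem BranchGirth.two_mul_le (hq : D.BranchGirth H q) {X : Finset E} (hX : D.IsEven X)
    (hne : X.Nonempty) (hXH : X ⊆ H) : 2 * q ≤ ∑ f with 3 ≤ D.deg H f, D.deg X f := by
  obtain ⟨l, c, hc, hcX⟩ := exists_isCycle_of_deg_ne_one hX.deg_ne_one hne
  have h1 := hq l c hc fun k => hXH (hcX k)
  set I := Finset.univ.filter fun k => 3 ≤ D.deg H (D.tail (c k))
  calc 2 * q ≤ I.card * 2 := by omega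
    _ = ∑ k ∈ I, 2 := by rw [Finset.sum_const, smul_eq_mul]
    _ ≤ ∑ k ∈ I, D.deg X (D.tail (c k)) := Finset.sum_le_sum fun k _ => hX.two_le_deg (hcX k)
    _ = ∑ f ∈ I.image fun k => D.tail (c k), D.deg X f :=
      (Finset.sum_image fun a _ b _ h => hc.vertex_injective h).symm
    _ ≤ ∑ f with 3 ≤ D.deg H f, D.deg X f := by
      refine Finset.sum_le_sum_of_subset (Finset.image_subset_iff.2 fun k hk => ?_)
      simpa [I] using hk

/-- The edges of `G` that leave one component of the graph without the edges in `H`. -/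
noncomputable def pieceCut (G : MultiGraph V E) (H : Finset E) (p : G.Pieces H) : Finset E :=
  G.cut {v | Quot.mk _ v = p}

theorem mem_pieceCut {p : G.Pieces H} {d : E × Bool} (h : d.1 ∈ G.pieceCut H p) :
    d.1 ∈ H ∧ (p = Quot.mk _ (G.tail d) ∨ p = Quot.mk _ (G.head d)) := by
  rw [pieceCut, mem_cut] at h
  constructor
  · by_contra hd
    refine h ?_
    have : (Quot.mk _ (G.tail d) : G.Pieces H) = Quot.mk _ (G.head d) :=
      Quot.sound ⟨d, hd, rfl, rfl⟩
    rw [Set.mem_ofPred_eq, Set.mem_ofPred_eq, this]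
  · by_contra! hne
    exact h (iff_of_false (fun h => hne.1 h.symm) fun h => hne.2 h.symm)

/-- With at least two pieces, the cut around each piece is a nonempty even subset of `H`, to which
`two_mul_le` applies. An edge lies in at most two of these cuts, so the factors two cancel. -/
theorem BranchGirth.card_pieces_mul_le [Finite V] (hq : D.BranchGirth H q) (hG : G.Connected)
    (hort : ∀ φ, D.boundary (G.coboundary φ) = 0) (hc : 1 < Nat.card (G.Pieces H)) :
    Nat.card (G.Pieces H) * q ≤ ∑ f with 3 ≤ D.deg H f, D.deg H f := by
  classical
  have : Fintype (G.Pieces H) := Fintype.ofFinite _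
  rw [Nat.card_eq_fintype_card] at hc ⊢
  have h1 : ∀ p : G.Pieces H, 2 * q ≤ ∑ f with 3 ≤ D.deg H f, D.deg (G.pieceCut H p) f := by
    intro p
    refine hq.two_mul_le (isEven_cut hort _) ?_ fun e he => (mem_pieceCut (d := (e, true)) he).1
    obtain ⟨p', hp'⟩ := Fintype.exists_ne_of_one_lt_card hc p
    obtain ⟨u, rfl⟩ := Quot.exists_rep p
    obtain ⟨v, rfl⟩ := Quot.exists_rep p'
    exact hG.cut_nonempty (u := u) (v := v) rfl hp'
  have h2 : ∀ f, ∑ p : G.Pieces H, D.deg (G.pieceCut H p) f ≤ D.deg H f * 2 := by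
    intro f
    have h3 : ∀ p, D.deg (G.pieceCut H p) f =
        ∑ d ∈ D.dartsAt H f, if d.1 ∈ G.pieceCut H p then 1 else 0 := fun p => by
      rw [deg, ← Finset.card_filter]
      congr 1
      ext d
      simp only [Finset.mem_filter, mem_dartsAt]
      exact ⟨fun h => ⟨⟨(mem_pieceCut h.1).1, h.2⟩, h.1⟩, fun h => ⟨h.2, h.1.2⟩⟩
    simp only [h3]
    rw [Finset.sum_comm, deg, ← smul_eq_mul, ← Finset.sum_const]
    refine Finset.sum_le_sum fun d _ => ?_
    rw [← Finset.card_filter]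
    refine (Finset.card_le_card (t := {Quot.mk _ (G.tail d), Quot.mk _ (G.head d)})
      fun p hp => ?_).trans Finset.card_le_two
    rw [Finset.mem_filter] at hp
    simpa using (mem_pieceCut hp.2).2
  have h3 : Fintype.card (G.Pieces H) * (2 * q) ≤
      ∑ p : G.Pieces H, ∑ f with 3 ≤ D.deg H f, D.deg (G.pieceCut H p) f := by
    rw [← Finset.card_univ, ← smul_eq_mul, ← Finset.sum_const]
    exact Finset.sum_le_sum fun p _ => h1 p
  rw [Finset.sum_comm] at h3
  have h4 := h3.trans (Finset.sum_le_sum fun f _ => h2 f)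
  rw [← Finset.sum_mul] at h4
  nlinarith

/-- A subgraph of the dual graph without vertices of degree one has an edge in the middle of a long
path without vertices of large degree. -/
theorem deep_nonempty [Fintype V] (hG : G.Connected) (hD : D.Connected)
    (hort : ∀ φ, D.boundary (G.coboundary φ) = 0) {γ : ℕ}
    (hγ : Fintype.card E + 2 ≤ Fintype.card V + Fintype.card W + 2 * γ)
    (hne : H.Nonempty) (hdeg : ∀ f, D.deg H f ≠ 1) {d : ℕ}
    (hd : ∀ l (c : Fin l → E × Bool), D.IsCycle l c → 2 * genusAlpha γ * d < l) :
    (D.deep H d).Nonempty := by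
  cases d with
  | zero => exact hne
  | succ d =>
    by_contra! hempty
    -- Let N be the number of branch vertices on the cycle. Then 2α(d+1) < l ≤ 2(d+1)N, hence N > α.
    have hq : D.BranchGirth H (genusAlpha γ + 1) := fun l c hc hcH => by
      have h1 := hc.le_card_mul hcH hempty
      have h2 := hd l c hc
      by_contra! hlt
      have h3 := Nat.mul_le_mul_right (2 * (d + 1)) (Nat.lt_succ_iff.1 hlt)
      nlinarith
    obtain ⟨l, c, hc, hcH⟩ := exists_isCycle_of_deg_ne_one hdeg hne
    obtain ⟨k, hk⟩ := Finset.card_pos.1 (lt_of_lt_of_le (Nat.succ_pos _) (hq l c hc hcH))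
    rw [Finset.mem_filter] at hk
    have hα : 5 ≤ genusAlpha γ := by
      have h1 := two_mul_add_three_sq_lt γ
      by_contra! h2
      have h3 : 2 ^ (genusAlpha γ - 1) ≤ 2 ^ 3 := Nat.pow_le_pow_right two_pos (by omega)
      nlinarith
    have hE := card_add_card_add_card_le hG hD hort hne
    have hS := sum_branch_deg hdeg
    refine not_moore_and_euler (genusAlpha γ + 1) γ _ (Nat.card (G.Pieces H))
      (∑ f with 3 ≤ D.deg H f, D.deg H f) (by omega)
      (by simpa using two_mul_add_three_sq_lt γ)
      (fun r r' h1 h2 h3 => hq.moore hdeg hk.2 r r' h1 h2 h3) ?_ (by omega) ?_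
    · rw [mul_comm, ← smul_eq_mul, ← Finset.sum_const]
      exact Finset.sum_le_sum fun f hf => (Finset.mem_filter.1 hf).2
    · rcases Nat.lt_or_ge 1 (Nat.card (G.Pieces H)) with h | h
      · exact Or.inr (hq.card_pieces_mul_le hG hort h)
      · exact Or.inl h

end MultiGraph

/-! Correctness of the selection of edges. -/

namespace ThinTree

open MultiGraph

variable {V W E : Type*}

/-- Iterating a function that maps finite sets to subsets ends with a fixed point. -/
theorem apply_iterate_eq {f : Finset E → Finset E} (hf : ∀ A, f A ⊆ A) (n : ℕ) (A : Finset E)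
    (hn : A.card ≤ n) : f (f^[n] A) = f^[n] A := by
  induction n generalizing A with
  | zero =>
    obtain rfl := Finset.card_eq_zero.1 (Nat.le_zero.1 hn)
    exact Finset.subset_empty.1 (hf ∅)
  | succ n ih =>
    rw [Function.iterate_succ_apply]
    rcases (Finset.card_le_card (hf A)).eq_or_lt with h | h
    · have hA := Finset.eq_of_subset_of_card_le (hf A) h.ge
      rw [hA, Function.iterate_fixed hA, hA]
    · exact ih _ (by omega)

theorem iterate_subset {f : Finset E → Finset E} (hf : ∀ A, f A ⊆ A) (n : ℕ) (A : Finset E) :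
    f^[n] A ⊆ A := by
  induction n generalizing A with
  | zero => exact Finset.Subset.refl _
  | succ n ih => exact (ih _).trans (hf A)

section Peel

variable [Fintype E] [DecidableEq E] [DecidableEq W] {D : MultiGraph W E} {H F : Finset E}

theorem deg_ne_one_of_pruned_eq (h : D.pruned H = H) (f : W) : D.deg H f ≠ 1 := fun hf => by
  obtain ⟨d, hd⟩ := Finset.card_pos.1 (show 0 < D.deg H f by omega)
  rw [mem_dartsAt] at hd
  obtain ⟨hdH, rfl⟩ := hd
  rw [← h, mem_pruned] at hdH
  exact hdH.2.1 hf

theorem deg_iterate_pruned_ne_one (H : Finset E) (f : W) :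
    D.deg (D.pruned^[H.card] H) f ≠ 1 :=
  deg_ne_one_of_pruned_eq (apply_iterate_eq (fun _ => pruned_subset) _ _ le_rfl) f

theorem Peel.of_pruned {d : ℕ} (h : D.Peel d (D.pruned H) F) : D.Peel d H F := by
  refine .drop pruned_subset (fun e he hne => ?_) h
  rw [pruned, Finset.mem_filter] at hne
  by_contra! hall
  exact hne ⟨he, hall true, hall false⟩

theorem Peel.of_iterate_pruned {d n : ℕ} (h : D.Peel d (D.pruned^[n] H) F) : D.Peel d H F := by
  induction n generalizing H with
  | zero => exact h
  | succ n ih => exact Peel.of_pruned (ih h)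

theorem deep_succ_subset_deep (H : Finset E) (k : ℕ) : D.deep H (k + 1) ⊆ D.deep H k := by
  cases k with
  | zero => exact deep_subset 1
  | succ k =>
    rw [deep_succ_succ]
    exact pruned_subset

theorem deep_anti (H : Finset E) {k k' : ℕ} (h : k ≤ k') : D.deep H k' ⊆ D.deep H k := by
  induction h with
  | refl => exact Finset.Subset.refl _
  | step _ ih => exact (deep_succ_subset_deep H _).trans ih

end Peel

/-- The records `r` describe the edges of the dual graph `D`, the vertices of which are labelled
by `b`. -/
structure Records (D : MultiGraph W E) (b : W → ℕ) (r : E → EdgeRecord) : Prop where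
  label_injective : Function.Injective b
  id_injective : Function.Injective fun e => (r e).1
  faces : ∀ e, (r e).2.2 = (b (D.tail (e, true)), b (D.tail (e, false)))

/-- The list `L` consists of the records of the edges in `H`. -/
def Codes [DecidableEq E] (r : E → EdgeRecord) (L : List EdgeRecord) (H : Finset E) : Prop :=
  ∃ l : List E, l.Nodup ∧ l.toFinset = H ∧ L = l.map r

/-! ### Lists of records as representations of edge sets -/

namespace Codes

variable [DecidableEq E] {r : E → EdgeRecord} {L : List EdgeRecord} {H F : Finset E}

theorem length_eq (h : Codes r L H) : L.length = H.card := by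
  obtain ⟨l, hl, rfl, rfl⟩ := h
  rw [List.length_map, List.toFinset_card_of_nodup hl]

theorem isEmpty (h : Codes r L H) : L.isEmpty = true ↔ H = ∅ := by
  rw [List.isEmpty_iff, ← List.length_eq_zero_iff, h.length_eq, Finset.card_eq_zero]

theorem filter (h : Codes r L H) (p : EdgeRecord → Bool) :
    Codes r (L.filter p) (H.filter fun e => p (r e) = true) := by
  obtain ⟨l, hl, rfl, rfl⟩ := h
  refine ⟨l.filter fun e => p (r e), hl.filter _, ?_, ?_⟩
  · rw [List.toFinset_filter]
  · rw [List.filter_map]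
    rfl

theorem orElse {A B : List EdgeRecord} {S S' : Finset E} (hA : Codes r A S) (hB : Codes r B S') :
    Codes r (ThinTree.orElse A B) (if S' = ∅ then S else S') := by
  unfold ThinTree.orElse
  simp only [hB.isEmpty]
  split_ifs
  · exact hA
  · exact hB

variable [Fintype E] [DecidableEq W] {D : MultiGraph W E} {b : W → ℕ}

theorem degree (h : Codes r L H) (hr : Records D b r) (f : W) :
    ThinTree.degree L (b f) = D.deg H f := by
  have h1 := (h.filter fun x => x.2.2.1 == b f).length_eq
  have h2 := (h.filter fun x => x.2.2.2 == b f).length_eq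
  rw [ThinTree.degree, List.length_append, h1, h2]
  simp only [hr.faces, beq_iff_eq, hr.label_injective.eq_iff]
  have : D.dartsAt H f = ((H.filter fun e => D.tail (e, true) = f).image fun e => (e, true)) ∪
      (H.filter fun e => D.tail (e, false) = f).image fun e => (e, false) := by
    ext ⟨e, c⟩
    cases c <;> simp
  rw [deg, this, Finset.card_union_of_disjoint, Finset.card_image_of_injective _
    (Prod.mk_left_injective _), Finset.card_image_of_injective _ (Prod.mk_left_injective _)]
  rw [Finset.disjoint_left]
  intro x hx hx'
  obtain ⟨e, -, rfl⟩ := Finset.mem_image.1 hx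
  obtain ⟨e', -, h⟩ := Finset.mem_image.1 hx'
  simp at h

theorem prune (h : Codes r L H) (hr : Records D b r) :
    Codes r (ThinTree.prune L) (D.pruned H) := by
  have h1 := h.filter fun x => !(ThinTree.degree L x.2.2.1 == 1) &&
    !(ThinTree.degree L x.2.2.2 == 1)
  simp only [hr.faces, h.degree hr] at h1
  convert h1 using 1
  · rfl
  · ext e
    simp [pruned]

theorem unbranched (h : Codes r L H) (hr : Records D b r) :
    Codes r (ThinTree.unbranched L) (D.unbranched H) := by
  have h1 := h.filter fun x => decide (ThinTree.degree L x.2.2.1 ≤ 2) &&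
    decide (ThinTree.degree L x.2.2.2 ≤ 2)
  simp only [hr.faces, h.degree hr] at h1
  convert h1 using 1
  · rfl
  · ext e
    simp [MultiGraph.unbranched]

theorem core (h : Codes r L H) (hr : Records D b r) :
    Codes r (ThinTree.core L) (D.pruned^[H.card] H) := by
  rw [ThinTree.core, List.foldl_const, h.length_eq]
  generalize H.card = n
  induction n generalizing L H with
  | zero => exact h
  | succ n ih => exact ih (h.prune hr)

/-- The result of `deepest` consists of deep edges. -/
theorem deepest (h : Codes r L H) (hr : Records D b r) {d : ℕ} (hd : (D.deep H d).Nonempty)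
    (hdH : d ≤ H.card) :
    ∃ S : Finset E, Codes r (ThinTree.deepest L) S ∧ S.Nonempty ∧ S ⊆ D.deep H d := by
  -- After `n` rounds the current set is either already inside the level `d` or exactly the level `n
  -- + 1`. The program keeps the last nonempty set, so it need not know `d`.
  have key : ∀ n, ∃ S : Finset E, Codes r ((fun A => ThinTree.orElse A (ThinTree.prune A))^[n]
      (ThinTree.orElse L (ThinTree.unbranched L))) S ∧ S.Nonempty ∧
      (S ⊆ D.deep H d ∨ n + 1 ≤ d ∧ S = D.deep H (n + 1)) := fun n => by
    induction n with
    | zero =>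
      refine ⟨_, h.orElse (h.unbranched hr), ?_, ?_⟩
      · split_ifs with h0
        · exact hd.mono (deep_subset d)
        · exact Finset.nonempty_iff_ne_empty.2 h0
      · rcases Nat.eq_zero_or_pos d with rfl | hpos
        · left
          split_ifs
          · exact Finset.Subset.refl _
          · exact Finset.filter_subset _ _
        · right
          have h1 : (D.unbranched H).Nonempty := hd.mono (deep_anti H (k := 1) hpos)
          rw [if_neg h1.ne_empty]
          exact ⟨hpos, rfl⟩
    | succ n ih =>
      obtain ⟨S, hS, hne, hsub⟩ := ih
      rw [Function.iterate_succ_apply']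
      refine ⟨_, hS.orElse (hS.prune hr), ?_, ?_⟩
      · split_ifs with h0
        · exact hne
        · exact Finset.nonempty_iff_ne_empty.2 h0
      · have hleft : S ⊆ D.deep H d →
            (if D.pruned S = ∅ then S else D.pruned S) ⊆ D.deep H d := fun h1 => by
          split_ifs
          · exact h1
          · exact pruned_subset.trans h1
        rcases hsub with h1 | ⟨h1, rfl⟩
        · exact Or.inl (hleft h1)
        · rcases h1.eq_or_lt with h2 | h2
          · exact Or.inl (hleft (h2 ▸ Finset.Subset.refl _))
          · right
            rw [← deep_succ_succ, if_neg (hd.mono (deep_anti H h2)).ne_empty]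
            exact ⟨h2, rfl⟩
  obtain ⟨S, h1, h2, h3⟩ := key L.length
  refine ⟨S, ?_, h2, ?_⟩
  · rw [ThinTree.deepest, List.foldl_const]
    exact h1
  -- The number of rounds is |H| ≥ d, which excludes the second alternative.
  · refine h3.resolve_right fun h4 => ?_
    rw [h.length_eq] at h4
    omega

/-- The selection peels off the dual graph. -/
theorem iterate_selectStep (hr : Records D b r) {d : ℕ}
    (hd : ∀ H : Finset E, H.Nonempty → (∀ f, D.deg H f ≠ 1) →
      (D.deep H d).Nonempty ∧ d ≤ H.card) (n : ℕ) (h : Codes r L H)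
    (hH : ∀ f, D.deg H f ≠ 1) (hn : H.card ≤ n) (A : List EdgeRecord) :
    ∃ l : List E, (selectStep^[n] (L, A)).2 = l.map r ++ A ∧ D.Peel d H l.toFinset := by
  induction n generalizing L H A with
  | zero =>
    obtain rfl := Finset.card_eq_zero.1 (Nat.le_zero.1 hn)
    exact ⟨[], rfl, .done⟩
  | succ n ih =>
    rw [Function.iterate_succ_apply]
    rcases H.eq_empty_or_nonempty with rfl | hne
    · have hL : L = [] := List.isEmpty_iff.1 (h.isEmpty.2 rfl)
      have h1 : selectStep (L, A) = (L, A) := by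
        subst hL
        rfl
      rw [h1]
      exact ih h hH (Nat.zero_le _) A
    · obtain ⟨hdH, hdn⟩ := hd H hne hH
      obtain ⟨_, ⟨l, hl, rfl, hlS⟩, hSne, hS⟩ := h.deepest hr hdH hdn
      cases l with
      | nil => simp at hSne
      | cons e l =>
        have he : e ∈ D.deep H d := hS (by simp)
        have heH : e ∈ H := deep_subset d he
        have hstep : selectStep (L, A) =
            (ThinTree.core (L.filter fun x => !sameId x.1 (r e).1), r e :: A) := by
          simp only [selectStep, hlS, List.map_cons]
        have h1 : Codes r (L.filter fun x => !sameId x.1 (r e).1) (H.erase e) := by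
          convert h.filter fun x => !sameId x.1 (r e).1 using 1
          ext x
          have : sameId (r x).1 (r e).1 = true ↔ x = e :=
            sameId_eq_true.trans hr.id_injective.eq_iff
          simp only [Finset.mem_erase, Finset.mem_filter, Bool.not_eq_true', ← Bool.not_eq_true,
            this, and_comm]
        have hcard := Finset.card_erase_lt_of_mem heH
        have h2 := Finset.card_le_card
          (iterate_subset (fun A => pruned_subset (D := D) (H := A)) (H.erase e).card (H.erase e))
        obtain ⟨l', hl', hp⟩ := ih (h1.core hr) (deg_iterate_pruned_ne_one _) (by omega) (r e :: A)
        refine ⟨l' ++ [e], ?_, ?_⟩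
        · rw [hstep, hl']
          simp
        · rw [List.toFinset_append, Finset.union_comm]
          exact .take hH heH he (Peel.of_iterate_pruned hp)

theorem select (h : Codes r L H) (hr : Records D b r) {d : ℕ}
    (hd : ∀ H : Finset E, H.Nonempty → (∀ f, D.deg H f ≠ 1) →
      (D.deep H d).Nonempty ∧ d ≤ H.card) :
    ∃ l : List E, ThinTree.select L = l.map r ∧ D.Peel d H l.toFinset := by
  have hcard := Finset.card_le_card
    (iterate_subset (fun A => pruned_subset (D := D) (H := A)) H.card H)
  obtain ⟨l, h1, h2⟩ := iterate_selectStep hr hd L.length (h.core hr)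
    (deg_iterate_pruned_ne_one _) (by rw [h.length_eq]; exact hcard) []
  refine ⟨l, ?_, Peel.of_iterate_pruned h2⟩
  rw [ThinTree.select, List.foldl_const, h1, List.append_nil]

end Codes

/-! ### The forest -/

section Forest

theorem relabel_eq_relabel {u v x y : ℕ} (h : relabel u v x = relabel u v y) :
    x = y ∨ x = u ∧ y = v ∨ x = v ∧ y = u := by
  unfold relabel at h
  by_cases huv : u ≤ v <;> simp only [huv, decide_true, decide_false, if_true, beq_iff_eq,
    Bool.false_eq_true, if_false] at h <;> split_ifs at h <;> omega

theorem relabel_left_eq_right (u v : ℕ) : relabel u v u = relabel u v v := by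
  unfold relabel
  by_cases huv : u ≤ v <;> simp only [huv, decide_true, decide_false, if_true, beq_iff_eq,
    Bool.false_eq_true, if_false] <;> split_ifs <;> omega

variable {G : MultiGraph V E}

/-- The set of edges `T` contains no cycle. -/
def Acyclic (G : MultiGraph V E) (T : Finset E) : Prop :=
  ¬ ∃ (l : ℕ) (c : Fin l → E × Bool), G.IsCycle l c ∧ ∀ i, (c i).1 ∈ T

/-- Vertices joined by an edge in `T`. -/
def Joined (G : MultiGraph V E) (T : Finset E) (x y : V) : Prop :=
  ∃ d : E × Bool, d.1 ∈ (T : Set E) ∧ G.tail d = x ∧ G.head d = y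

/-- Consider the indicator of one class of `ψ`. Along a cycle its sums over heads and over tails
agree, but on a cycle through `e` only `e` changes class. -/
theorem Acyclic.insert [DecidableEq E] {T : Finset E} (hT : Acyclic G T) {ψ : V → ℕ}
    (hψ : ∀ d : E × Bool, d.1 ∈ T → ψ (G.tail d) = ψ (G.head d)) {e : E}
    (he : ψ (G.tail (e, true)) ≠ ψ (G.tail (e, false))) : Acyclic G (insert e T) := by
  rintro ⟨l, c, hc, hcT⟩
  by_cases hex : ∃ k, (c k).1 = e
  · obtain ⟨k, hk⟩ := hex
    have hne : ψ (G.head (c k)) ≠ ψ (G.tail (c k)) := by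
      rcases eq_or_eq_rev (d := c k) (d' := (e, true)) hk with h | h
      · rw [← h]
        exact he.symm
      · have h' : c k = rev (e, true) := by rw [h, rev_rev]
        rw [h', head_rev, tail_rev]
        exact he
    set φ : V → ℕ := fun v => if ψ v = ψ (G.tail (c k)) then 1 else 0 with hφ
    have hsum : ∑ i, φ (G.head (c i)) = ∑ i, φ (G.tail (c i)) := by
      rw [← Equiv.sum_comp (finRotate l) fun i => φ (G.tail (c i))]
      exact Finset.sum_congr rfl fun i _ => by rw [hc.closed]
    rw [← Finset.add_sum_erase _ _ (Finset.mem_univ k),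
      ← Finset.add_sum_erase _ (fun i => φ (G.tail (c i))) (Finset.mem_univ k),
      Finset.sum_congr rfl fun i hi => show φ (G.head (c i)) = φ (G.tail (c i)) from by
        have hik : (c i).1 ≠ e := fun h =>
          (Finset.mem_erase.1 hi).1 (hc.edge_injective (h.trans hk.symm))
        simp only [hφ, hψ _ ((Finset.mem_insert.1 (hcT i)).resolve_left hik)]] at hsum
    simp [hφ, hne] at hsum
  · push Not at hex
    exact hT ⟨l, c, hc, fun i => (Finset.mem_insert.1 (hcT i)).resolve_left (hex i)⟩

/-- The record of an edge with vertex labels `ψ`. -/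
def labelled (G : MultiGraph V E) (r : E → EdgeRecord) (ψ : V → ℕ) (e : E) : EdgeRecord :=
  ((r e).1, (ψ (G.tail (e, true)), ψ (G.tail (e, false))), (r e).2.2)

/-- Invariants of contraction: the labels `ψ` agree exactly on vertices joined through the chosen
set `T`, and `T` is acyclic. In the end the labels agree along every edge of the list, so the chosen
edges connect whatever the list connects. -/
theorem iterate_treeStep [DecidableEq E] (G : MultiGraph V E) (r : E → EdgeRecord) (l : List E)
    (ψ : V → ℕ) (T : Finset E) (A : List (ℕ × Bool))
    (hψ : ∀ d : E × Bool, d.1 ∈ T → ψ (G.tail d) = ψ (G.head d))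
    (hψT : ∀ u v, ψ u = ψ v → Relation.ReflTransGen (Joined G T) u v) (hT : Acyclic G T) :
    ∃ (t : List E) (ψ' : V → ℕ),
      (treeStep^[l.length] (l.map (labelled G r ψ), A)).2 = t.map (fun e => (r e).1) ++ A ∧
      t ⊆ l ∧ Acyclic G (t.toFinset ∪ T) ∧ (∀ u v, ψ u = ψ v → ψ' u = ψ' v) ∧
      (∀ d : E × Bool, d.1 ∈ l → ψ' (G.tail d) = ψ' (G.head d)) ∧
      ∀ u v, ψ' u = ψ' v → Relation.ReflTransGen (Joined G (t.toFinset ∪ T)) u v := by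
  induction l generalizing ψ T A with
  | nil =>
    exact ⟨[], ψ, rfl, List.Subset.refl _, by simpa using hT, fun u v h => h, by simp,
      by simpa using hψT⟩
  | cons e l ih =>
    rw [List.length_cons, Function.iterate_succ_apply, List.map_cons]
    have hends : ∀ (φ : V → ℕ), φ (G.tail (e, true)) = φ (G.tail (e, false)) →
        ∀ d : E × Bool, d.1 = e → φ (G.tail d) = φ (G.head d) := by
      rintro φ h ⟨_, b⟩ rfl
      cases b
      · exact h.symm
      · exact h
    by_cases he : ψ (G.tail (e, true)) = ψ (G.tail (e, false))
    · obtain ⟨t, ψ', h1, h2, h3, h4, h5, h6⟩ := ih ψ T A hψ hψT hT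
      refine ⟨t, ψ', ?_, List.Subset.trans h2 (List.subset_cons_self _ _), h3, h4, ?_, h6⟩
      · rw [← h1]
        simp [treeStep, labelled, he]
      · intro d hd
        rcases List.mem_cons.1 hd with h | h
        · exact hends ψ' (h4 _ _ he) d h
        · exact h5 d h
    · set ψ₁ : V → ℕ := fun v =>
        relabel (ψ (G.tail (e, true))) (ψ (G.tail (e, false))) (ψ v) with hψ₁
      have he₁ : ψ₁ (G.tail (e, true)) = ψ₁ (G.tail (e, false)) := relabel_left_eq_right _ _
      have hmono : ∀ x y, Relation.ReflTransGen (Joined G T) x y →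
          Relation.ReflTransGen (Joined G (insert e T)) x y := fun x y h =>
        Relation.ReflTransGen.mono (show Joined G T ≤ Joined G (insert e T) from
          fun a b ⟨d, hd, h⟩ => ⟨d, Finset.mem_coe.2 (Finset.mem_insert_of_mem hd), h⟩) x y h
      obtain ⟨t, ψ', h1, h2, h3, h4, h5, h6⟩ := ih ψ₁ (insert e T) ((r e).1 :: A)
        (fun d hd => by
          rcases Finset.mem_insert.1 hd with h | h
          · exact hends ψ₁ he₁ d h
          · simp only [hψ₁, hψ d h])
        (fun u v h => by
          rcases relabel_eq_relabel h with h | ⟨hu, hv⟩ | ⟨hu, hv⟩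
          · exact hmono _ _ (hψT u v h)
          · exact ((hmono _ _ (hψT _ _ hu)).tail ⟨(e, true), by simp, rfl, rfl⟩).trans
              (hmono _ _ (hψT _ _ hv.symm))
          · exact ((hmono _ _ (hψT _ _ hu)).tail ⟨(e, false), by simp, rfl, rfl⟩).trans
              (hmono _ _ (hψT _ _ hv.symm)))
        (hT.insert hψ he)
      have hset : t.toFinset ∪ insert e T = (t ++ [e]).toFinset ∪ T := by
        ext x
        simp
      rw [hset] at h3 h6
      refine ⟨t ++ [e], ψ', ?_, ?_, h3, fun u v h => h4 u v (by simp only [hψ₁, h]), ?_, h6⟩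
      · have hstep : treeStep (labelled G r ψ e :: l.map (labelled G r ψ), A) =
            (l.map (labelled G r ψ₁), (r e).1 :: A) := by
          simp only [treeStep, labelled, beq_iff_eq, he, if_false, List.map_map]
          rfl
        rw [hstep, h1]
        simp
      · intro x hx
        rcases List.mem_append.1 hx with h | h
        · exact List.mem_cons_of_mem _ (h2 h)
        · simp only [List.mem_singleton] at h
          simp [h]
      · intro d hd
        rcases List.mem_cons.1 hd with h | h
        · exact hends ψ' (h4 _ _ he₁) d h
        · exact h5 d h

/-- The algorithm for forests finds spanning trees. -/
theorem exists_forest [Fintype E] [DecidableEq E] {G : MultiGraph V E} (hG : G.Connected)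
    {r : E → EdgeRecord} {a : V → ℕ} (ha : Function.Injective a)
    (hr : ∀ e, (r e).2.1 = (a (G.tail (e, true)), a (G.tail (e, false)))) (l : List E)
    (hl : ∀ U, (G.cut U).Nonempty → (l.toFinset ∩ G.cut U).Nonempty) :
    ∃ t : List E, forest (l.map r) = t.map (fun e => (r e).1) ∧ t ⊆ l ∧
      G.IsSpanningTree t.toFinset := by
  obtain ⟨t, ψ, h1, h2, h3, -, h5, h6⟩ := iterate_treeStep G r l a ∅ [] (by simp)
    (fun u v h => by rw [ha h]) (by
      rintro ⟨n, c, hc, hcT⟩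
      exact absurd (hcT ⟨0, hc.pos⟩) (Finset.notMem_empty _))
  rw [Finset.union_empty] at h3 h6
  have hlab : labelled G r a = r := funext fun e => by
    rw [labelled, ← hr]
  refine ⟨t, ?_, h2, ⟨hG.1, fun u v => h6 u v ?_⟩, h3⟩
  · rw [forest, List.foldl_const, List.length_map, ← hlab]
    simpa [hlab] using h1
  -- Otherwise the label class of `u` is a proper set of vertices, and its cut contains an edge of
  -- `l`, although labels agree along edges of `l`.
  · by_contra hne
    obtain ⟨e, he⟩ := hl {x | ψ x = ψ u} (hG.cut_nonempty (u := u) (v := v) rfl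
      fun h => hne h.symm)
    rw [Finset.mem_inter, List.mem_toFinset] at he
    refine (mem_cut (d := (e, true))).1 he.2 ?_
    rw [Set.mem_ofPred_eq, Set.mem_ofPred_eq, h5 (e, true) he.1]

end Forest

end ThinTree

/-! Thin spanning trees. -/

namespace MultiGraph

theorem IsCycle.girth_le {V E : Type*} {D : MultiGraph V E} {l : ℕ} {c : Fin l → E × Bool}
    (hc : D.IsCycle l c) : D.girth ≤ l :=
  iInf_le_of_le l (iInf_le_of_le c (iInf_le_of_le hc le_rfl))

theorem one_le_girth {V E : Type*} (D : MultiGraph V E) : 1 ≤ D.girth :=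
  le_iInf fun _ => le_iInf fun _ => le_iInf fun hc => by exact_mod_cast hc.pos

section Thin

variable {V E W : Type*} [Fintype E] [DecidableEq E] [DecidableEq W] {G : MultiGraph V E}
  {D : MultiGraph W E} {F T : Finset E} {d α : ℕ}

/-- A spaced set of edges is thin if the spacing is at least the `2α`-th part of the girth of the
dual graph. -/
theorem Peel.isThin (hF : D.Peel d Finset.univ F)
    (hort : ∀ φ, D.boundary (G.coboundary φ) = 0) (hα : 0 < α)
    (hd : D.girth ≠ ⊤ → D.girth.toNat ≤ 2 * α * (d + 1)) (hTF : T ⊆ F) :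
    G.IsThin T (2 * (α : ENNReal) / (D.girth : ENNReal)) := by
  intro U
  have heven := isEven_cut hort U
  rcases (G.cut U).eq_empty_or_nonempty with h0 | hne
  · simp [h0]
  -- A nonempty cut contains a dual cycle, so infinite girth leaves only empty cuts.
  obtain ⟨l, c, hc, -⟩ := exists_isCycle_of_deg_ne_one heven.deg_ne_one hne
  have htop : D.girth ≠ ⊤ := fun h => by
    have := hc.girth_le
    simp [h] at this
  have hd := hd htop
  obtain ⟨g, hg⟩ := ENat.ne_top_iff_exists.1 htop
  rw [← hg, ENat.toNat_natCast] at hd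
  have hle : ∀ l (c : Fin l → E × Bool), D.IsCycle l c → g ≤ l := fun l c hc => by
    have := hc.girth_le
    rw [← hg] at this
    exact_mod_cast this
  have hpos : 0 < g := by
    have := D.one_le_girth
    rw [← hg] at this
    exact_mod_cast this
  -- On a cycle with several selected edges the spacing is used; with at most one, the bound g ≤ l
  -- suffices.
  have h1 := heven.card_mul_le F g (2 * α) fun l c hc => by
    rcases Nat.lt_or_ge 1 (F ∩ Finset.univ.image fun k => (c k).1).card with h | h
    · have h2 := Nat.mul_le_mul_left (2 * α) (hF.card_inter_cycle hc h)
      have h3 := Nat.mul_le_mul_left (F ∩ Finset.univ.image fun k => (c k).1).card hd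
      calc _ ≤ _ := h3
        _ = _ := by ring
        _ ≤ _ := h2
    · calc _ ≤ 1 * g := Nat.mul_le_mul_right _ h
        _ ≤ 2 * α * l := Nat.mul_le_mul (by omega) (hle l c hc)
  have h2 : (T ∩ G.cut U).card * g ≤ 2 * α * (G.cut U).card :=
    (Nat.mul_le_mul_right _ (Finset.card_le_card (Finset.inter_subset_inter_right hTF))).trans h1
  rw [← hg, ← ENNReal.mul_div_right_comm, ENNReal.le_div_iff_mul_le (Or.inl (by simp [hpos.ne']))
    (Or.inl (by simp))]
  simpa using (by exact_mod_cast h2 :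
    ((T ∩ G.cut U).card : ENNReal) * g ≤ 2 * α * (G.cut U).card)

end Thin

end MultiGraph

namespace ThinTree

open MultiGraph

/-- The algorithm finds a thin spanning tree. -/
theorem exists_output {V E F : Type*} [Fintype V] [Fintype E] [DecidableEq E] [Fintype F]
    {G : MultiGraph V E} {M : G.SurfaceEmbedding F} {γ : ℕ} (hG : G.Connected)
    (hγ : M.HasGenus γ) {a : V → ℕ} (ha : Function.Injective a) {b : F → ℕ}
    (hb : Function.Injective b) {i : E → ℕ × Bool} (hi : Function.Injective i) {l : List E}
    (hnd : l.Nodup) (hl : ∀ e, e ∈ l) :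
    ∃ T : Finset E, G.IsSpanningTree T ∧
      G.IsThin T (2 * (genusAlpha γ : ENNReal) / (M.dual.girth : ENNReal)) ∧
      output (l.map fun e => (i e, (a (G.tail (e, true)), a (G.tail (e, false))),
        (b (M.faceOfDart (e, true)), b (M.faceOfDart (e, false))))) =
          l.map fun e => decide (e ∈ T) := by
  classical
  set r : E → EdgeRecord := fun e => (i e, (a (G.tail (e, true)), a (G.tail (e, false))),
    (b (M.faceOfDart (e, true)), b (M.faceOfDart (e, false)))) with hrdef
  have hr : Records M.dual b r := ⟨hb, hi, fun _ => rfl⟩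
  have hα : 0 < genusAlpha γ := by
    unfold genusAlpha
    omega
  -- For finite girth g this is the integer with 2αd < g ≤ 2α(d+1). For infinite girth `toNat` is
  -- zero, so d = 0, and no dual cycle exists.
  set d := (M.dual.girth.toNat - 1) / (2 * genusAlpha γ) with hd
  have hd1 : 2 * genusAlpha γ * d ≤ M.dual.girth.toNat - 1 := Nat.mul_div_le _ _
  have hd2 : M.dual.girth.toNat - 1 < 2 * genusAlpha γ * (d + 1) :=
    Nat.lt_mul_div_succ _ (by omega)
  have hcyc : ∀ l (c : Fin l → E × Bool), M.dual.IsCycle l c → 2 * genusAlpha γ * d < l := by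
    intro l c hc
    have h1 : M.dual.girth.toNat ≤ l := ENat.toNat_le_of_le_natCast hc.girth_le
    have := hc.pos
    omega
  have hort : ∀ φ, M.dual.boundary (G.coboundary φ) = 0 := M.boundary_coboundary
  have hcodes : Codes r (l.map r) (Finset.univ : Finset E) :=
    ⟨l, hnd, by ext e; simp [hl], rfl⟩
  obtain ⟨f, hf1, hf2⟩ := hcodes.select hr (d := d) fun H hne hdeg => by
    refine ⟨deep_nonempty hG (M.dual_connected hG) hort hγ.card_le hne hdeg hcyc, ?_⟩
    -- The set contains a cycle of length greater than 2αd ≥ d, so the algorithm performs enough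
    -- rounds of pruning.
    obtain ⟨n, c, hc, hcH⟩ := exists_isCycle_of_deg_ne_one hdeg hne
    have h1 := Finset.card_le_card (s := Finset.univ.image fun k => (c k).1) (t := H)
      (Finset.image_subset_iff.2 fun k _ => hcH k)
    rw [Finset.card_image_of_injective _ hc.edge_injective, Finset.card_univ,
      Fintype.card_fin] at h1
    have h2 := hcyc n c hc
    have h3 : 1 * d ≤ 2 * genusAlpha γ * d := Nat.mul_le_mul_right _ (by omega)
    omega
  obtain ⟨t, ht1, ht2, ht3⟩ := exists_forest hG (r := r) ha (fun _ => rfl) f fun U hU =>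
    hf2.inter_nonempty (isEven_cut hort U) hU (Finset.subset_univ _)
  refine ⟨t.toFinset, ht3, hf2.isThin hort hα (fun _ => by omega) fun e he => ?_, ?_⟩
  · rw [List.mem_toFinset] at he ⊢
    exact ht2 he
  · rw [output, hf1, ht1, List.map_map]
    refine List.map_congr_left fun e _ => ?_
    rw [Function.comp_apply, Bool.eq_iff_iff]
    simp only [List.any_eq_true, List.mem_map, sameId_eq_true, decide_eq_true_eq,
      List.mem_toFinset]
    constructor
    · rintro ⟨_, ⟨e', he', rfl⟩, h⟩
      rwa [← hi h]
    · exact fun he => ⟨_, ⟨e, he, rfl⟩, rfl⟩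

/-! ### Codes of inputs and outputs -/

section Input

variable {n m k : ℕ} {G : MultiGraph (Fin n) (Fin m)} (M : G.SurfaceEmbedding (Fin k))

/-- The description of a dart. -/
def dartRecord (d : Fin m × Bool) : DartRecord :=
  (G.tail d, (M.rot d).1, (M.rot d).2, M.faceOfDart d, ())

/-- The description of an embedded graph. -/
def input : Input :=
  (n, m, k, (List.finRange m).map fun e => (dartRecord M (e, true), dartRecord M (e, false)), ())

open Enc

theorem enc_input : enc (input M) = M.encode := by
  simp only [SurfaceEmbedding.encode, input]
  change Data.cons _ (Data.cons _ (Data.cons _ (Data.cons (Data.ofList (List.map _ (List.map _ _)))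
    _))) = _
  rw [List.map_map]
  rfl

theorem enc_decide_mem (T : Finset (Fin m)) :
    enc ((List.finRange m).map fun e => decide (e ∈ T)) = encodeEdgeSet T := by
  change Data.ofList (List.map _ (List.map _ _)) = _
  rw [List.map_map]
  rfl

theorem sz_dartRecord_le (d : Fin m × Bool) :
    sz (dartRecord M d) ≤ 2 * n + 2 * m + 2 * k + 11 := by
  have h1 := (G.tail d).2
  have h2 := (M.rot d).1.2
  have h3 := (M.faceOfDart d).2
  have h4 := sz_bool_le (M.rot d).2
  have h5 : sz () = 1 := rfl
  simp only [dartRecord, sz_prod, sz_nat, h5]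
  omega

/-- The face labels are also bounded in terms of n and m, since each face contains a boundary walk
and there are at most 2m + n of these. -/
theorem sz_input_le : sz (input M) ≤ 16 * (n + m) ^ 2 + 60 * (n + m) + 30 := by
  have hk := M.card_face_le
  simp only [Fintype.card_fin] at hk
  have h1 := sz_le_of_length_le (n := m) (k := 4 * n + 4 * m + 4 * k + 23)
    (l := (List.finRange m).map fun e => (dartRecord M (e, true), dartRecord M (e, false)))
    (by
      intro x hx
      obtain ⟨e, -, rfl⟩ := List.mem_map.1 hx
      have h1 := sz_dartRecord_le M (e, true)
      have h2 := sz_dartRecord_le M (e, false)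
      exact (Nat.add_le_add_right (Nat.add_le_add h1 h2) 1).trans (by omega)) (by simp)
  have h2 : m * (4 * n + 4 * m + 4 * k + 23 + 1) ≤ m * (8 * n + 12 * m + 24) :=
    Nat.mul_le_mul_left _ (by omega)
  have h5 : sz () = 1 := rfl
  simp only [input, sz_prod, sz_nat, h5]
  nlinarith [Nat.zero_le (n * m), Nat.zero_le (n ^ 2), Nat.zero_le (m ^ 2)]

theorem algorithm_input : algorithm (input M) =
    output ((List.finRange m).map fun e => (((M.rot (e, true)).1.val, (M.rot (e, true)).2),
      ((G.tail (e, true)).val, (G.tail (e, false)).val),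
      ((M.faceOfDart (e, true)).val, (M.faceOfDart (e, false)).val))) := by
  rw [algorithm, input, List.map_map]
  rfl

end Input

end ThinTree

/-- A connected graph embedded on an orientable surface of genus `γ` with dual girth `g` has a
spanning tree of thinness `2α / g`, and one program finds such trees in polynomial time. -/
theorem lemma3p1 :
    (∀ {V E F : Type*} [Fintype V] [Fintype E] [DecidableEq E] [Fintype F]
        (G : MultiGraph V E) (M : G.SurfaceEmbedding F) (γ : ℕ),
        G.Connected → M.HasGenus γ →
        ∃ T : Finset E, G.IsSpanningTree T ∧
          G.IsThin T (2 * (genusAlpha γ : ENNReal) / (M.dual.girth : ENNReal))) ∧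
    ∃ (p : Prog) (q : Polynomial ℕ),
      ∀ (n m k : ℕ) (G : MultiGraph (Fin n) (Fin m)) (M : G.SurfaceEmbedding (Fin k)) (γ : ℕ),
        G.Connected → M.HasGenus γ →
        ∃ (T : Finset (Fin m)) (t : ℕ), G.IsSpanningTree T ∧
          G.IsThin T (2 * (genusAlpha γ : ENNReal) / (M.dual.girth : ENNReal)) ∧
          p.Eval M.encode (MultiGraph.encodeEdgeSet T) t ∧ t ≤ q.eval (n + m) := by
  constructor
  · intro V E F _ _ _ _ G M γ hG hγ
    obtain ⟨T, h1, h2, -⟩ := ThinTree.exists_output hG hγ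
      (a := fun v => (Fintype.equivFin V v).val)
      (Fin.val_injective.comp (Fintype.equivFin V).injective)
      (b := fun f => (Fintype.equivFin F f).val)
      (Fin.val_injective.comp (Fintype.equivFin F).injective)
      -- Any injective identifiers serve for existence; the second component is a dummy.
      (i := fun e => ((Fintype.equivFin E e).val, true))
      (fun e e' h => (Fintype.equivFin E).injective (Fin.val_injective (Prod.ext_iff.1 h).1))
      (Finset.nodup_toList Finset.univ) (by simp)
    exact ⟨T, h1, h2⟩
  · obtain ⟨p, r, ⟨q, hq⟩, hp⟩ := ThinTree.polyTime_algorithm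
    refine ⟨p, q.comp (16 * Polynomial.X ^ 2 + 60 * Polynomial.X + 30),
      fun n m k G M γ hG hγ => ?_⟩
    obtain ⟨T, h1, h2, h3⟩ := ThinTree.exists_output hG hγ Fin.val_injective Fin.val_injective
      -- These are the identifiers the program reads off its input; they are injective because the
      -- rotation is a permutation.
      (i := fun e => ((M.rot (e, true)).1.val, (M.rot (e, true)).2))
      (fun e e' h => by
        have h1 : M.rot (e, true) = M.rot (e', true) :=
          Prod.ext (Fin.val_injective (Prod.ext_iff.1 h).1) (Prod.ext_iff.1 h).2
        exact (Prod.ext_iff.1 (M.rot.injective h1)).1)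
      (List.nodup_finRange m) List.mem_finRange
    obtain ⟨t, ht, hle⟩ := hp (ThinTree.input M)
    rw [ThinTree.algorithm_input, h3, ThinTree.enc_input, ThinTree.enc_decide_mem] at ht
    refine ⟨T, t, h1, h2, ht, hle.trans ((hq _).trans ?_)⟩
    rw [Polynomial.eval_comp]
    simpa using Polynomial.eval_le_eval_nat q (ThinTree.sz_input_le M)
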